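/- **Setting.** Let $E$ be a finite-dimensional real inner product space and consider a difference-of-convex program: minimize $f=g-h$ over $\mathcal C\subseteq E$, where $g,h:E\to(-\infty,+\infty]$, $\operatorname{dom}\varphi=\{\varphi<\infty\}$, and $f=+\infty$ at points of $\mathcal C\setminus\operatorname{dom} g$. Let $f^\star=\inf_{\mathcal C} f$, let $N_{\mathcal C}(x)$ be the normal cone, and let $h^*$ be the convex conjugate. A DCA sequence is a sequence with $x^{(0)}\in\mathcal C$ and $$x^{(k+1)}\in\operatorname*{argmin}_{x\in\mathcal C}\big(g(x)-h(x^{(k)})-\langle\nabla h(x^{(k)}),x-x^{(k)}\rangle\big).$$ The program satisfies the *standing assumption* with constants $\mu,r>0$ if: 1. $g,h$ are closed and convex, with open domains on which they are continuously differentiable; 2. $\mathcal C$ is bounded, closed and convex, and $\mathcal C\subseteq\overline{\operatorname{dom} g}\cap\operatorname{dom} h$; 3. $f$ has a global minimizer over $\mathcal C$, with finite value $f^\star$; 4. for every $x^{(k)}\in\mathcal C$ the DCA subproblem has a solution; 5. $\mu\,(f(x)-f^\star)\le d_{h^*}(\nabla g(x)+y,\nabla h(x))$ for all $x\in\mathcal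 C\cap\operatorname{dom} g$ and all $y\in N_{\mathcal C}(x)$ with $\|y\|\le r$, where $d_{h^*}(u,\nabla h(x))=h^*(u)-h^*(\nabla h(x))-\langle x,u-\nabla h(x)\rangle\in[0,+\infty]$ is the Bregman distance of $h^*$ (with $x$ as the (sub)gradient of $h^*$ at $\nabla h(x)$). **Proposition.** Let $A_{ij}\in\mathbb R^{m_j\times n_i}$ ($i\in[p]$, $j\in[q]$) have full row rank, let $\alpha_j\ge0$, $\beta_i\ge0$, $\rho>0$, and let $C_i\in\mathbb R^{n_i\times n_i}$ be symmetric positive semidefinite, with $C_i\succ0$ whenever $\beta_i>0$. On tuples $X=(X_1,\dots,X_p)$ of symmetric $n_i\times n_i$ matrices with inner product $\sum_i\operatorname{tr}(X_iY_i)$ let $$g(X)=-\sum_{i}\beta_i\log\det X_i,\qquad h(X)=-\sum_{j}\alpha_j\log\det\Big(\sum_i A_{ij}X_iA_{ij}^T+\rho I_{m_j}\Big),\qquad \mathcal C=\{X: 0\preceq X_i\preceq C_i,\ i\in[p]\},$$ where $-\log\det M=+\infty$ unless $M\succ0$, and terms with zero coefficient are absent. Then: (a) For every $r>0$ there is $\mu>0$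 such that the program satisfies the standing assumption with constants $\mu,r$, and every DCA sequence satisfies, for all $k\ge0$, $$f(X^{(k+1)})-f^\star\le\frac1{1+\mu}\big(f(X^{(k)})-f^\star\big).$$ (b) There are $K$ and $c\in(0,1)$ such that for every DCA sequence and all $k\ge0$ the distance from $X^{(k)}$ to the set of global minimizers is at most $Kc^k$. (c) If $\beta_i>0$ for all $i$, the global minimizer is unique (so that, by (b), DCA converges linearly to it). -/

import Mathlib

noncomputable section

/-! ### Difference-of-convex programs `minimize g - h over C` -/

namespace DCProgram

variable {E : Type*} [NormedAddCommGroup E] [InnerProductSpace ℝ E]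

/-- The effective domain of an extended-real-valued function. -/
def dom (φ : E → EReal) : Set E := {x | φ x ≠ ⊤}

/-- The epigraph of an extended-real-valued function, as a subset of `E × ℝ`. -/
def epi (φ : E → EReal) : Set (E × ℝ) := {z | φ z.1 ≤ (z.2 : EReal)}

/-- The convex conjugate `φ*(u) = sup_x (⟨u, x⟩ - φ(x))`. -/
def conj (φ : E → EReal) (u : E) : EReal := ⨆ x : E, ((inner ℝ u x : ℝ) : EReal) - φ x

/-- The normal cone of `C` at `x`. -/
def normalCone (C : Set E) (x : E) : Set E := {y | ∀ z ∈ C, inner ℝ y (z - x) ≤ (0 : ℝ)}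

/-- The Bregman distance `φ(u) - φ(v) - ⟨s, u - v⟩` from `u` to `v` generated by `φ`, where `s` is
the gradient of `φ` at `v` (or, if `φ` is not differentiable at `v`, the selected subgradient). -/
def bregman (φ : E → EReal) (s u v : E) : EReal := φ u - φ v - ((inner ℝ s (u - v) : ℝ) : EReal)

/-- The objective `f = g - h`. -/
def objective (g h : E → EReal) (x : E) : EReal := g x - h x

/-- The optimal value `f⋆`: the infimum of `f = g - h` over `C`. -/
def optValue (g h : E → EReal) (C : Set E) : EReal := ⨅ x ∈ C, objective g h x

/-- The set of global minimizers of `f = g - h` over `C`. -/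
def minimizers (g h : E → EReal) (C : Set E) : Set E := {x | x ∈ C ∧ IsMinOn (objective g h) C x}

variable [CompleteSpace E]

/-- The gradient of an extended-real-valued function at a point of (the interior of) its domain. -/
def grad (φ : E → EReal) (x : E) : E := gradient (fun z => (φ z).toReal) x

/-- The function never takes the value `-∞`, is closed and convex (closed convex epigraph), has an
open domain, and is continuously differentiable there. -/
structure IsClosedConvexC1 (φ : E → EReal) : Prop where
  ne_bot : ∀ x, φ x ≠ ⊥
  closed : IsClosed (epi φ)
  convex : Convex ℝ (epi φ)
  isOpen_dom : IsOpen (dom φ)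
  contDiffOn : ContDiffOn ℝ 1 (fun x => (φ x).toReal) (dom φ)

/-- `x'` is a DCA update of `x`: a minimizer over `C` of
`u ↦ g(u) - (h(x) + ⟨∇h(x), u - x⟩)`. -/
def IsDCAStep (g h : E → EReal) (C : Set E) (x x' : E) : Prop :=
  x' ∈ C ∧ IsMinOn
    (fun u => g u - (h x + ((inner ℝ (grad h x) (u - x) : ℝ) : EReal))) C x'

/-- A sequence of DCA iterates started at a point of `C`. -/
def IsDCASequence (g h : E → EReal) (C : Set E) (x : ℕ → E) : Prop :=
  x 0 ∈ C ∧ ∀ k, IsDCAStep g h C (x k) (x (k + 1))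

/-- The constrained DC Polyak–Łojasiewicz inequality
`μ (f(x) - f⋆) ≤ d_{h*}(∇g(x) + y, ∇h(x))` for all feasible `x` (where `∇g(x)` makes sense)
and all normal vectors `y` of length at most `r`.
The gradient of `h*` at `∇h(x)` entering the Bregman distance is `x`. -/
def DCPL (g h : E → EReal) (C : Set E) (μ r : ℝ) : Prop :=
  ∀ x ∈ C ∩ dom g, ∀ y ∈ normalCone C x, ‖y‖ ≤ r →
    (μ : EReal) * (objective g h x - optValue g h C) ≤
      bregman (conj h) x (grad g x + y) (grad h x)

/-- The standing assumption on the program `minimize g - h over C`, with constants `μ` and `r`.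
The objective is `+∞` at the points of `C` outside `dom g`. -/
structure StandingAssumption (g h : E → EReal) (C : Set E) (μ r : ℝ) : Prop where
  g_reg : IsClosedConvexC1 g
  h_reg : IsClosedConvexC1 h
  bounded : Bornology.IsBounded C
  closed : IsClosed C
  convex : Convex ℝ C
  subset_dom : C ⊆ closure (dom g) ∩ dom h
  exists_minimizer :
    ∃ x ∈ minimizers g h C, objective g h x ≠ ⊤ ∧ objective g h x ≠ ⊥
  solvable : ∀ x ∈ C, ∃ x', IsDCAStep g h C x x'
  dcpl : DCPL g h C μ r

end DCProgram

/-! ### The generalized Brascamp–Lieb problem -/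

namespace BrascampLieb

/-- Symmetric real `n × n` matrices; the Euclidean inner product of the entries is the
Frobenius inner product `tr (X Y)`. -/
def symMat (n : ℕ) : Submodule ℝ (EuclideanSpace ℝ (Fin n × Fin n)) where
  carrier := {v | ∀ a b, v (a, b) = v (b, a)}
  add_mem' := by
    intro v w hv hw a b
    simp [hv a b, hw a b]
  zero_mem' := by
    intro a b
    simp
  smul_mem' := by
    intro c v hv a b
    simp [hv a b]

/-- Tuples `(X_1, …, X_p)` of symmetric matrices, with the inner product `∑ᵢ tr (Xᵢ Yᵢ)`. -/
abbrev SymTuple {p : ℕ} (n : Fin p → ℕ) : Type := PiLp 2 (fun i => symMat (n i))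

instance instCompleteSpaceSymMat (n : ℕ) : CompleteSpace (symMat n) :=
  FiniteDimensional.complete ℝ (symMat n)

/-- The `i`-th matrix `X_i` of a tuple. -/
def block {p : ℕ} {n : Fin p → ℕ} (X : SymTuple n) (i : Fin p) :
    Matrix (Fin (n i)) (Fin (n i)) ℝ :=
  Matrix.of fun a b => (X i : EuclideanSpace ℝ (Fin (n i) × Fin (n i))) (a, b)

open scoped Classical in
/-- `-log det M`, with the value `+∞` unless `M` is (symmetric) positive definite. -/
def negLogDet {k : ℕ} (M : Matrix (Fin k) (Fin k) ℝ) : EReal :=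
  if M.PosDef then ((-Real.log M.det : ℝ) : EReal) else ⊤

/-- `g(X) = -∑ᵢ βᵢ log det Xᵢ`; a term with `βᵢ = 0` is absent (`0 * ⊤ = 0` in `EReal`). -/
def g {p : ℕ} {n : Fin p → ℕ} (β : Fin p → ℝ) (X : SymTuple n) : EReal :=
  ∑ i, (β i : EReal) * negLogDet (block X i)

/-- `h(X) = -∑ⱼ αⱼ log det (∑ᵢ Aᵢⱼ Xᵢ Aᵢⱼᵀ + ρ I)`; a term with `αⱼ = 0` is absent. -/
def h {p q : ℕ} {n : Fin p → ℕ} {m : Fin q → ℕ}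
    (A : ∀ (i : Fin p) (j : Fin q), Matrix (Fin (m j)) (Fin (n i)) ℝ)
    (α : Fin q → ℝ) (ρ : ℝ) (X : SymTuple n) : EReal :=
  ∑ j, (α j : EReal) *
    negLogDet ((∑ i, A i j * block X i * (A i j).transpose) +
      ρ • (1 : Matrix (Fin (m j)) (Fin (m j)) ℝ))

/-- The constraint set `{X | 0 ⪯ Xᵢ ⪯ Cᵢ for all i}`. -/
def feasible {p : ℕ} {n : Fin p → ℕ} (C : ∀ i : Fin p, Matrix (Fin (n i)) (Fin (n i)) ℝ) :
    Set (SymTuple n) :=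
  {X | ∀ i, (block X i).PosSemidef ∧ (C i - block X i).PosSemidef}

end BrascampLieb

end

/-! Contraction. A DCA step from x to x' makes y = ∇h(x) − ∇g(x') a normal vector at x', so the
Polyak–Łojasiewicz (PL) inequality at x' bounds μ(f(x') − f⋆) by the Bregman distance of h* between
∇h(x) and ∇h(x'). By Fenchel duality this is at most D_h(x', x) = h(x') − h(x) − ⟨∇h(x), x' − x⟩.
Optimality of x' in the subproblem gives f(x') + D_h(x', x) ≤ f(x), and the factor 1/(1+μ) follows
(`step_contract`). The normal vectors produced by steps are uniformly bounded, so one radius covers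
them all.

PL inequality. A Bregman distance of h* is a supremum over test points z, so one good z suffices.
Let X be feasible with positive definite barrier blocks (those with β_i > 0), and let Y be a
minimizer whose remaining, free, blocks vanish. Write X_i = L_i L_iᵀ and Y_i = L_i diag(x) L_iᵀ. The
affine-invariant geodesic from X to Y starts in the direction with weights log x; along it g is
affine and −h is convex, because the eigenvalues of the Gram matrices are mixtures of the weights.
The proof perturbs this direction to σ = log x + s(x − 1)², and uses σ = −R on free blocks. The
bound σ ≤ x − 1 keeps the direction feasible. A strengthened Jensen inequality, which exploits the
mass contributed by ρI, pays for the perturbation (`sum_le_log_of_jensen`). Hence the slope of f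
along S = L diag(σ) Lᵀ is at most f(Y) − f(X) minus a quadratic gain (`inner_add_gain_le`). At z = X
− tS, feasibility of S gives the normal vector a favourable sign, and the second-order error of h is
at most t² times a constant times the gain (`h_sub_le`, `quad_le_gain`). A small t leaves t(f(X) −
f⋆).

The constants are uniform only on sublevel sets of g. Elsewhere the test point X − tI works: the
slope of g along I dominates g itself, and here the bound r on the normal vector enters
(`DCProgram.IsRegular.exists_dcpl`).

Distances. At a minimizer the slope along a feasible S is nonnegative, so the gain bounds the
objective gap from below: quadratic growth in the barrier blocks, hence uniqueness if all β_i > 0.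
Free blocks obey an error bound for a face of {0 ⪯ X ⪯ C} (`exists_error_bound`). Squared distance
is then at most a constant times the gap, and the rate is the square root of the contraction factor.
-/

set_option linter.unusedSectionVars false

/-! ### Difference-of-convex programs: general theory -/

namespace DCProgram

open Filter Topology Set

/-- A derivative at `0` is bounded by any linear upper bound valid to the right of `0`. -/
lemma le_of_hasDerivAt_of_le {φ : ℝ → ℝ} {d c τ : ℝ} (hφ : HasDerivAt φ d 0) (hτ : 0 < τ)
    (hle : ∀ t, 0 < t → t < τ → φ t ≤ φ 0 + t * c) : d ≤ c := by
  have h1 := (hasDerivAt_iff_tendsto_slope_zero.1 hφ).mono_left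
    (nhdsWithin_mono 0 (fun t (ht : t ∈ Ioi (0 : ℝ)) => ne_of_gt ht))
  refine le_of_tendsto h1 ?_
  filter_upwards [Ioo_mem_nhdsGT hτ] with t ht
  have h2 := hle t ht.1 ht.2
  simp only [zero_add, smul_eq_mul]
  rw [inv_mul_le_iff₀ ht.1]
  linarith

lemma le_of_hasDerivAt_of_ge {φ : ℝ → ℝ} {d c τ : ℝ} (hφ : HasDerivAt φ d 0) (hτ : 0 < τ)
    (hle : ∀ t, 0 < t → t < τ → φ 0 + t * c ≤ φ t) : c ≤ d := by
  have := le_of_hasDerivAt_of_le hφ.neg hτ (c := -c) (fun t h1 h2 => by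
    have := hle t h1 h2
    simp only [Pi.neg_apply]
    linarith)
  linarith

variable {E : Type*} [NormedAddCommGroup E] [InnerProductSpace ℝ E]

lemma IsMinOn.sub_le_sub_toReal {a b : EReal} {u v : ℝ} (ha : a ≠ ⊤) (ha' : a ≠ ⊥) (hb : b ≠ ⊤)
    (hb' : b ≠ ⊥) (h : a - (u : EReal) ≤ b - (v : EReal)) : a.toReal - u ≤ b.toReal - v := by
  lift a to ℝ using ⟨ha, ha'⟩
  lift b to ℝ using ⟨hb, hb'⟩
  simp only [EReal.toReal_coe]
  exact_mod_cast h

lemma convex_combo_mem {C : Set E} (hC : Convex ℝ C) {x z : E} (hx : x ∈ C) (hz : z ∈ C) {t : ℝ}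
    (h0 : 0 ≤ t) (h1 : t ≤ 1) : x + t • (z - x) ∈ C :=
  hC.add_smul_sub_mem hx hz ⟨h0, h1⟩

variable [CompleteSpace E] {φ g h : E → EReal} {C : Set E}

/-! ### Gradients, tangent inequality and Bregman distances of the conjugate -/

namespace IsClosedConvexC1

lemma coe_toReal (hφ : IsClosedConvexC1 φ) {x : E} (hx : x ∈ dom φ) :
    (((φ x).toReal : ℝ) : EReal) = φ x :=
  EReal.coe_toReal hx (hφ.ne_bot x)

lemma convexOn (hφ : IsClosedConvexC1 φ) : ConvexOn ℝ (dom φ) (fun x => (φ x).toReal) := by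
  have key : ∀ x ∈ dom φ, ∀ y ∈ dom φ, ∀ a b : ℝ, 0 ≤ a → 0 ≤ b → a + b = 1 →
      φ (a • x + b • y) ≤ ((a * (φ x).toReal + b * (φ y).toReal : ℝ) : EReal) := by
    intro x hx y hy a b ha hb hab
    have := hφ.convex (x := (x, (φ x).toReal)) (by simp [epi, hφ.coe_toReal hx])
      (y := (y, (φ y).toReal)) (by simp [epi, hφ.coe_toReal hy]) ha hb hab
    simpa [epi] using this
  have hdom : ∀ x ∈ dom φ, ∀ y ∈ dom φ, ∀ a b : ℝ, 0 ≤ a → 0 ≤ b → a + b = 1 →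
      a • x + b • y ∈ dom φ := by
    intro x hx y hy a b ha hb hab
    exact ne_top_of_le_ne_top (EReal.coe_ne_top _) (key x hx y hy a b ha hb hab)
  refine ⟨fun x hx y hy a b ha hb hab => hdom x hx y hy a b ha hb hab, ?_⟩
  intro x hx y hy a b ha hb hab
  have := key x hx y hy a b ha hb hab
  rw [← hφ.coe_toReal (hdom x hx y hy a b ha hb hab)] at this
  exact_mod_cast this

lemma differentiableAt (hφ : IsClosedConvexC1 φ) {x : E} (hx : x ∈ dom φ) :
    DifferentiableAt ℝ (fun z => (φ z).toReal) x :=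
  (hφ.contDiffOn.differentiableOn one_ne_zero).differentiableAt (hφ.isOpen_dom.mem_nhds hx)

lemma hasDerivAt_line (hφ : IsClosedConvexC1 φ) {x : E} (hx : x ∈ dom φ) (v : E) :
    HasDerivAt (fun t : ℝ => (φ (x + t • v)).toReal) (inner ℝ (grad φ x) v) 0 := by
  have h1 := (hφ.differentiableAt hx).hasGradientAt.hasFDerivAt
  have h2 : HasDerivAt (fun t : ℝ => x + t • v) v 0 := by
    simpa using ((hasDerivAt_id (0 : ℝ)).smul_const v).const_add x
  have h3 := HasFDerivAt.comp_hasDerivAt_of_eq (0 : ℝ) h1 h2 (by simp)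
  have e : (fderiv ℝ (fun z => (φ z).toReal) x) v = inner ℝ (grad φ x) v := by
    simp [grad, gradient]
  rw [← e]
  simpa [Function.comp_def] using h3

lemma continuousOn_grad (hφ : IsClosedConvexC1 φ) : ContinuousOn (grad φ) (dom φ) := by
  have := hφ.contDiffOn.continuousOn_fderiv_of_isOpen hφ.isOpen_dom le_rfl
  exact (InnerProductSpace.toDual ℝ E).symm.continuous.comp_continuousOn this

lemma tangent_le (hφ : IsClosedConvexC1 φ) {x z : E} (hx : x ∈ dom φ) (hz : z ∈ dom φ) :
    (φ x).toReal + inner ℝ (grad φ x) (z - x) ≤ (φ z).toReal := by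
  have := le_of_hasDerivAt_of_le (hφ.hasDerivAt_line hx (z - x)) one_pos
    (c := (φ z).toReal - (φ x).toReal) (fun t h0 h1 => by
      have := hφ.convexOn.2 hx hz (show 0 ≤ 1 - t by linarith) h0.le (by ring)
      simp only [smul_eq_mul] at this
      have e : (1 - t) • x + t • z = x + t • (z - x) := by module
      rw [e] at this
      simp only [zero_smul, add_zero]
      linarith)
  linarith

/-- The tangent inequality says that z = x maximizes ⟨∇φ(x), z⟩ − φ(z). This half of Fenchel's
equality is all that the two Bregman bounds need. -/
lemma conj_grad_le (hφ : IsClosedConvexC1 φ) {x : E} (hx : x ∈ dom φ) :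
    conj φ (grad φ x) ≤ ((inner ℝ (grad φ x) x - (φ x).toReal : ℝ) : EReal) := by
  refine iSup_le fun z => ?_
  by_cases hz : z ∈ dom φ
  · have := hφ.tangent_le hx hz
    rw [inner_sub_right] at this
    rw [← hφ.coe_toReal hz, ← EReal.coe_sub, EReal.coe_le_coe_iff]
    linarith
  · have : φ z = ⊤ := not_not.1 hz
    simp [this]

/-- Any point of the domain yields a lower bound for the Bregman distance of the conjugate. -/
lemma le_bregman_conj (hφ : IsClosedConvexC1 φ) {x z : E} (hx : x ∈ dom φ) (hz : z ∈ dom φ)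
    (u : E) :
    ((inner ℝ u (z - x) - (φ z).toReal + (φ x).toReal : ℝ) : EReal) ≤
      bregman (conj φ) x u (grad φ x) := by
  have h1 := hφ.conj_grad_le hx
  have h2 : ((inner ℝ u z - (φ z).toReal : ℝ) : EReal) ≤ conj φ u := by
    rw [EReal.coe_sub, hφ.coe_toReal hz]
    exact le_iSup (fun x : E => ((inner ℝ u x : ℝ) : EReal) - φ x) z
  have h3 := EReal.sub_le_sub (EReal.sub_le_sub h2 h1)
    (le_refl ((inner ℝ x (u - grad φ x) : ℝ) : EReal))
  refine le_trans (le_of_eq ?_) h3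
  rw [← EReal.coe_sub, ← EReal.coe_sub]
  congr 1
  rw [inner_sub_right, inner_sub_right, real_inner_comm u x, real_inner_comm (grad φ x) x]
  ring

/-- Fenchel's equality bounds the Bregman distance of the conjugate between two gradients. -/
lemma bregman_conj_grad_le (hφ : IsClosedConvexC1 φ) {x z : E} (hx : x ∈ dom φ) (hz : z ∈ dom φ) :
    bregman (conj φ) x (grad φ z) (grad φ x) ≤
      (((φ x).toReal - (φ z).toReal - inner ℝ (grad φ z) (x - z) : ℝ) : EReal) := by
  have h1 := hφ.conj_grad_le hz
  have h2 : ((inner ℝ (grad φ x) x - (φ x).toReal : ℝ) : EReal) ≤ conj φ (grad φ x) := by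
    rw [EReal.coe_sub, hφ.coe_toReal hx]
    exact le_iSup (fun y : E => ((inner ℝ (grad φ x) y : ℝ) : EReal) - φ y) x
  have h3 := EReal.sub_le_sub (EReal.sub_le_sub h1 h2)
    (le_refl ((inner ℝ x (grad φ z - grad φ x) : ℝ) : EReal))
  refine le_trans h3 (le_of_eq ?_)
  rw [← EReal.coe_sub, ← EReal.coe_sub]
  congr 1
  rw [inner_sub_right, inner_sub_right, real_inner_comm (grad φ z) x, real_inner_comm (grad φ x) x]
  ring

lemma lowerSemicontinuous (hφ : IsClosedConvexC1 φ) : LowerSemicontinuous φ := by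
  rw [lowerSemicontinuous_iff_isClosed_preimage]
  intro y
  induction y with
  | bot =>
    have : φ ⁻¹' Iic ⊥ = ∅ := by
      ext x
      simp [hφ.ne_bot x]
    rw [this]
    exact isClosed_empty
  | top => simp
  | coe y =>
    exact hφ.closed.preimage (f := fun x : E => (x, y)) (by fun_prop)

end IsClosedConvexC1

/-! ### Regular programs: existence of minimizers, contraction, linear rate -/

/-- Regularity data shared by all DC programs below: regular `g` and `h`, a compact convex
constraint set inside `dom h` meeting `dom g`. -/
structure IsRegular (g h : E → EReal) (C : Set E) : Prop where
  g_reg : IsClosedConvexC1 g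
  h_reg : IsClosedConvexC1 h
  compact : IsCompact C
  convex : Convex ℝ C
  subset_dom : C ⊆ dom h
  nonempty : (C ∩ dom g).Nonempty

namespace IsRegular

/-- A lower semicontinuous function minus a finite continuous one attains its minimum on a compact
set. With ψ = h this gives the global minimizer, with ψ affine the DCA updates. -/
lemma exists_isMinOn_sub (hr : IsRegular g h C) {ψ : E → ℝ} (hψ : ContinuousOn ψ C) :
    ∃ x ∈ C, IsMinOn (fun x => g x - (ψ x : EReal)) C x := by
  refine LowerSemicontinuousOn.exists_isMinOn (hr.nonempty.mono inter_subset_left) hr.compact ?_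
  simp only [sub_eq_add_neg]
  refine LowerSemicontinuousOn.add' (hr.g_reg.lowerSemicontinuous.lowerSemicontinuousOn C) ?_ ?_
  · have : ContinuousOn (fun x => -((ψ x : ℝ) : EReal)) C :=
      continuous_neg.comp_continuousOn (continuous_coe_real_ereal.comp_continuousOn hψ)
    exact this.lowerSemicontinuousOn
  · intro x _
    rw [← EReal.coe_neg]
    exact EReal.continuousAt_add (Or.inr (by simp)) (Or.inr (by simp))

/-- The linearized objective of a DCA step, up to the term `g`. -/
lemma isDCAStep_iff (hr : IsRegular g h C) {x x' : E} (hx : x ∈ C) :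
    IsDCAStep g h C x x' ↔ x' ∈ C ∧ IsMinOn
      (fun u => g u - (((h x).toReal + inner ℝ (grad h x) (u - x) : ℝ) : EReal)) C x' := by
  simp only [IsDCAStep, EReal.coe_add, hr.h_reg.coe_toReal (hr.subset_dom hx)]

lemma exists_isDCAStep (hr : IsRegular g h C) {x : E} (hx : x ∈ C) :
    ∃ x', IsDCAStep g h C x x' := by
  obtain ⟨x', h1, h2⟩ := hr.exists_isMinOn_sub
    (ψ := fun u => (h x).toReal + inner ℝ (grad h x) (u - x)) (by fun_prop)
  exact ⟨x', (hr.isDCAStep_iff hx).2 ⟨h1, h2⟩⟩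

lemma mem_dom_of_isMinOn (hr : IsRegular g h C) {ψ : E → ℝ} {x : E}
    (hmin : IsMinOn (fun x => g x - (ψ x : EReal)) C x) : x ∈ dom g := by
  obtain ⟨z, hz, hzg⟩ := hr.nonempty
  intro htop
  have := hmin hz
  simp only [mem_ofPred_eq, htop, EReal.top_sub_coe, top_le_iff] at this
  rw [← hr.g_reg.coe_toReal hzg, ← EReal.coe_sub] at this
  exact EReal.coe_ne_top _ this

lemma toReal_sub_le_of_isMinOn (hr : IsRegular g h C) {ψ : E → ℝ} {x z : E}
    (hmin : IsMinOn (fun x => g x - (ψ x : EReal)) C x) (hz : z ∈ C) (hzg : z ∈ dom g) :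
    (g x).toReal - ψ x ≤ (g z).toReal - ψ z :=
  IsMinOn.sub_le_sub_toReal (hr.mem_dom_of_isMinOn hmin) (hr.g_reg.ne_bot x) hzg
    (hr.g_reg.ne_bot z) (hmin hz)

lemma step_mem_dom (hr : IsRegular g h C) {x x' : E} (hx : x ∈ C) (hs : IsDCAStep g h C x x') :
    x' ∈ dom g :=
  hr.mem_dom_of_isMinOn ((hr.isDCAStep_iff hx).1 hs).2

lemma step_le (hr : IsRegular g h C) {x x' z : E} (hx : x ∈ C) (hs : IsDCAStep g h C x x')
    (hz : z ∈ C) (hzg : z ∈ dom g) :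
    (g x').toReal - inner ℝ (grad h x) (x' - x) ≤
      (g z).toReal - inner ℝ (grad h x) (z - x) := by
  have := hr.toReal_sub_le_of_isMinOn ((hr.isDCAStep_iff hx).1 hs).2 hz hzg
  linarith

lemma eventually_mem_dom {x : E} (hφ : IsClosedConvexC1 φ) (hx : x ∈ dom φ) (v : E) :
    ∃ τ : ℝ, 0 < τ ∧ ∀ t, 0 < t → t < τ → x + t • v ∈ dom φ := by
  have h2 : Tendsto (fun t : ℝ => x + t • v) (𝓝 0) (𝓝 x) := by
    have : Continuous (fun t : ℝ => x + t • v) := by fun_prop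
    simpa using this.tendsto 0
  obtain ⟨τ, hτ, hb⟩ := Metric.eventually_nhds_iff.1 (h2 (hφ.isOpen_dom.mem_nhds hx))
  refine ⟨τ, hτ, fun t h0 h1 => hb ?_⟩
  simpa [abs_of_pos h0] using h1

/-- First-order optimality in the convex subproblem. At x' this vector y satisfies ∇g(x') + y =
∇h(x), which is how the PL inequality meets the algorithm. -/
lemma step_mem_normalCone (hr : IsRegular g h C) {x x' : E} (hx : x ∈ C)
    (hs : IsDCAStep g h C x x') : grad h x - grad g x' ∈ normalCone C x' := by
  intro z hz
  have hx'g := hr.step_mem_dom hx hs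
  obtain ⟨τ, hτ, hb⟩ := eventually_mem_dom hr.g_reg hx'g (z - x')
  have := le_of_hasDerivAt_of_ge (hr.g_reg.hasDerivAt_line hx'g (z - x')) (lt_min hτ one_pos)
    (c := inner ℝ (grad h x) (z - x')) (fun t h0 h1 => by
      have h3 := hr.step_le hx hs (convex_combo_mem hr.convex hs.1 hz h0.le
        (h1.le.trans (min_le_right _ _))) (hb t h0 (h1.trans_le (min_le_left _ _)))
      have e : x' + t • (z - x') - x = (x' - x) + t • (z - x') := by abel
      rw [e, inner_add_right, inner_smul_right] at h3
      simp only [zero_smul, add_zero]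
      linarith)
  rw [inner_sub_left]
  linarith

lemma continuousOn_toReal_h (hr : IsRegular g h C) : ContinuousOn (fun x => (h x).toReal) C :=
  hr.h_reg.contDiffOn.continuousOn.mono hr.subset_dom

/-- The values of `g` at DCA updates are uniformly bounded. -/
lemma exists_step_bound (hr : IsRegular g h C) :
    ∃ G : ℝ, ∀ x ∈ C, ∀ x', IsDCAStep g h C x x' → (g x').toReal ≤ G := by
  obtain ⟨z, hz, hzg⟩ := hr.nonempty
  obtain ⟨M, hM⟩ := (hr.compact.image_of_continuousOn
    (hr.h_reg.continuousOn_grad.mono hr.subset_dom)).isBounded.exists_norm_le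
  obtain ⟨D, hD⟩ := hr.compact.isBounded.exists_norm_le
  refine ⟨(g z).toReal + M * (D + D), fun x hx x' hs => ?_⟩
  -- The update is compared with one fixed z in C ∩ dom g; the linear terms are bounded because C
  -- and ∇h(C) are.
  have h1 := hr.step_le hx hs hz hzg
  have h2 : inner ℝ (grad h x) (x' - x) - inner ℝ (grad h x) (z - x) ≤ M * (D + D) := by
    rw [← inner_sub_right]
    refine (real_inner_le_norm _ _).trans ?_
    have e : x' - x - (z - x) = x' - z := by abel
    rw [e]
    exact mul_le_mul (hM _ (mem_image_of_mem _ hx)) ((norm_sub_le _ _).trans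
      (add_le_add (hD _ hs.1) (hD _ hz))) (norm_nonneg _)
      ((norm_nonneg _).trans (hM _ (mem_image_of_mem _ hx)))
  linarith

/-- Near the boundary of dom g the gradient of g may blow up, so compactness of C alone does not
bound it. A sublevel set of g in C is a compact subset of dom g. -/
lemma isCompact_sublevel (hr : IsRegular g h C) (G : ℝ) :
    IsCompact (C ∩ {x | g x ≤ (G : EReal)}) :=
  hr.compact.inter_right (lowerSemicontinuous_iff_isClosed_preimage.1 hr.g_reg.lowerSemicontinuous G)

/-- The normal vectors generated by DCA steps are uniformly bounded. -/
lemma exists_step_norm_bound (hr : IsRegular g h C) :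
    ∃ R : ℝ, ∀ x ∈ C, ∀ x', IsDCAStep g h C x x' → ‖grad h x - grad g x'‖ ≤ R := by
  obtain ⟨G, hG⟩ := hr.exists_step_bound
  obtain ⟨M, hM⟩ := (hr.compact.image_of_continuousOn
    (hr.h_reg.continuousOn_grad.mono hr.subset_dom)).isBounded.exists_norm_le
  obtain ⟨N, hN⟩ := ((hr.isCompact_sublevel G).image_of_continuousOn
    (hr.g_reg.continuousOn_grad.mono
      (fun x hx => ne_top_of_le_ne_top (EReal.coe_ne_top _) hx.2))).isBounded.exists_norm_le
  refine ⟨M + N, fun x hx x' hs => (norm_sub_le _ _).trans ?_⟩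
  refine add_le_add (hM _ (mem_image_of_mem _ hx)) (hN _ (mem_image_of_mem _ ⟨hs.1, ?_⟩))
  show g x' ≤ _
  rw [← hr.g_reg.coe_toReal (hr.step_mem_dom hx hs)]
  exact_mod_cast hG x hx x' hs

lemma objective_eq_coe (hr : IsRegular g h C) {x : E} (hx : x ∈ C) (hxg : x ∈ dom g) :
    objective g h x = (((g x).toReal - (h x).toReal : ℝ) : EReal) := by
  rw [EReal.coe_sub, hr.g_reg.coe_toReal hxg, hr.h_reg.coe_toReal (hr.subset_dom hx), objective]

lemma objective_eq_top (hr : IsRegular g h C) {x : E} (hx : x ∈ C) (hxg : x ∉ dom g) :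
    objective g h x = ⊤ := by
  have : g x = ⊤ := not_not.1 hxg
  rw [objective, this, ← hr.h_reg.coe_toReal (hr.subset_dom hx), EReal.top_sub_coe]

/-- Some feasible point has a finite value, so a minimizer lies in dom g and optimality becomes an
inequality between real numbers. -/
lemma mem_minimizers_iff (hr : IsRegular g h C) {x : E} :
    x ∈ minimizers g h C ↔ x ∈ C ∧ x ∈ dom g ∧
      ∀ z ∈ C, z ∈ dom g → (g x).toReal - (h x).toReal ≤ (g z).toReal - (h z).toReal := by
  constructor
  · rintro ⟨hx, hmin⟩
    have hxg : x ∈ dom g := by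
      by_contra hxg
      obtain ⟨z, hz, hzg⟩ := hr.nonempty
      have := hmin hz
      rw [mem_ofPred_eq, hr.objective_eq_top hx hxg, hr.objective_eq_coe hz hzg, top_le_iff] at this
      exact EReal.coe_ne_top _ this
    refine ⟨hx, hxg, fun z hz hzg => ?_⟩
    have := hmin hz
    rw [mem_ofPred_eq, hr.objective_eq_coe hx hxg, hr.objective_eq_coe hz hzg] at this
    exact_mod_cast this
  · rintro ⟨hx, hxg, hmin⟩
    refine ⟨hx, fun z hz => ?_⟩
    rw [mem_ofPred_eq]
    by_cases hzg : z ∈ dom g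
    · rw [hr.objective_eq_coe hx hxg, hr.objective_eq_coe hz hzg]
      exact_mod_cast hmin z hz hzg
    · rw [hr.objective_eq_top hz hzg]
      exact le_top

lemma exists_mem_minimizers (hr : IsRegular g h C) : ∃ x, x ∈ minimizers g h C := by
  obtain ⟨x, hx, hmin⟩ := hr.exists_isMinOn_sub hr.continuousOn_toReal_h
  exact ⟨x, hr.mem_minimizers_iff.2 ⟨hx, hr.mem_dom_of_isMinOn hmin,
    fun z hz hzg => hr.toReal_sub_le_of_isMinOn hmin hz hzg⟩⟩

lemma optValue_eq (hr : IsRegular g h C) {x : E} (hx : x ∈ minimizers g h C) :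
    optValue g h C = (((g x).toReal - (h x).toReal : ℝ) : EReal) := by
  rw [← hr.objective_eq_coe hx.1 (hr.mem_minimizers_iff.1 hx).2.1]
  exact le_antisymm (iInf₂_le x hx.1) (le_iInf₂ fun z hz => hx.2 hz)

/-- The DC Polyak–Łojasiewicz inequality from test points for the conjugate. -/
lemma dcpl_of_exists (hr : IsRegular g h C) {xs : E} (hxs : xs ∈ minimizers g h C) {μ r : ℝ}
    (H : ∀ x ∈ C, x ∈ dom g → ∀ y ∈ normalCone C x, ‖y‖ ≤ r → ∃ z ∈ dom h,
      μ * (((g x).toReal - (h x).toReal) - ((g xs).toReal - (h xs).toReal)) ≤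
        inner ℝ (grad g x + y) (z - x) - (h z).toReal + (h x).toReal) :
    DCPL g h C μ r := by
  rintro x ⟨hx, hxg⟩ y hy hyr
  obtain ⟨z, hz, hle⟩ := H x hx hxg y hy hyr
  refine le_trans ?_ (hr.h_reg.le_bregman_conj (hr.subset_dom hx) hz _)
  rw [hr.objective_eq_coe hx hxg, hr.optValue_eq hxs]
  exact_mod_cast hle

lemma _root_.DCProgram.DCPL.mono {μ r r' : ℝ} (hd : DCPL g h C μ r) (hrr : r' ≤ r) :
    DCPL g h C μ r' :=
  fun x hx y hy hyr => hd x hx y hy (hyr.trans hrr)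

lemma standingAssumption (hr : IsRegular g h C) (hC : C ⊆ closure (dom g)) {μ r : ℝ}
    (hd : DCPL g h C μ r) : StandingAssumption g h C μ r where
  g_reg := hr.g_reg
  h_reg := hr.h_reg
  bounded := hr.compact.isBounded
  closed := hr.compact.isClosed
  convex := hr.convex
  subset_dom := fun _ hx => ⟨hC hx, hr.subset_dom hx⟩
  exists_minimizer := by
    obtain ⟨x, hx⟩ := hr.exists_mem_minimizers
    refine ⟨x, hx, ?_⟩
    rw [hr.objective_eq_coe hx.1 (hr.mem_minimizers_iff.1 hx).2.1]
    exact ⟨EReal.coe_ne_top _, EReal.coe_ne_bot _⟩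
  solvable := fun _ hx => hr.exists_isDCAStep hx
  dcpl := hd

/-- One DCA step contracts the optimality gap, when its normal vector is within the range of the
Polyak–Łojasiewicz inequality. -/
lemma step_contract (hr : IsRegular g h C) {μ r : ℝ} (hμ : 0 < μ) (hd : DCPL g h C μ r)
    {xs x x' : E} (hxs : xs ∈ minimizers g h C) (hx : x ∈ C) (hxg : x ∈ dom g)
    (hs : IsDCAStep g h C x x') (hn : ‖grad h x - grad g x'‖ ≤ r) :
    ((g x').toReal - (h x').toReal) - ((g xs).toReal - (h xs).toReal) ≤
      1 / (1 + μ) *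
        (((g x).toReal - (h x).toReal) - ((g xs).toReal - (h xs).toReal)) := by
  have hx'g := hr.step_mem_dom hx hs
  have h1 := hd x' ⟨hs.1, hx'g⟩ _ (hr.step_mem_normalCone hx hs) hn
  have h2 := hr.h_reg.bregman_conj_grad_le (hr.subset_dom hs.1) (hr.subset_dom hx)
  -- ∇g(x') + (∇h(x) − ∇g(x')) = ∇h(x): the Bregman distance is now between two gradients of h.
  rw [add_sub_cancel] at h1
  have h3 := h1.trans h2
  rw [hr.objective_eq_coe hs.1 hx'g, hr.optValue_eq hxs] at h3
  have h4 : μ * (((g x').toReal - (h x').toReal) - ((g xs).toReal - (h xs).toReal)) ≤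
    (h x').toReal - (h x).toReal - inner ℝ (grad h x) (x' - x) := by exact_mod_cast h3
  -- The old iterate x competes in its own subproblem: f(x') + D_h(x', x) ≤ f(x).
  have h5 := hr.step_le hx hs hx hxg
  rw [sub_self, inner_zero_right] at h5
  rw [one_div, ← div_eq_inv_mul, le_div_iff₀ (by linarith)]
  linarith

/-- Only the starting point can lie outside dom g; there the right-hand side is a positive multiple
of +∞. -/
lemma step_contract_ereal (hr : IsRegular g h C) {μ r : ℝ} (hμ : 0 < μ) (hd : DCPL g h C μ r)
    {x x' : E} (hx : x ∈ C)
    (hs : IsDCAStep g h C x x') (hn : ‖grad h x - grad g x'‖ ≤ r) :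
    objective g h x' - optValue g h C ≤
      ((1 / (1 + μ) : ℝ) : EReal) * (objective g h x - optValue g h C) := by
  obtain ⟨xs, hxs⟩ := hr.exists_mem_minimizers
  rw [hr.optValue_eq hxs]
  by_cases hxg : x ∈ dom g
  · rw [hr.objective_eq_coe hx hxg, hr.objective_eq_coe hs.1 (hr.step_mem_dom hx hs)]
    exact_mod_cast hr.step_contract hμ hd hxs hx hxg hs hn
  · rw [hr.objective_eq_top hx hxg, EReal.top_sub_coe, EReal.coe_mul_top_of_pos (by positivity)]
    exact le_top

lemma sequence_mem {x : ℕ → E} (hx : IsDCASequence g h C x) (k : ℕ) : x k ∈ C := by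
  cases k with
  | zero => exact hx.1
  | succ k => exact (hx.2 k).1

/-- Linear convergence of the distances to the minimizers, from a quadratic growth condition. -/
lemma exists_linear_rate (hr : IsRegular g h C) {xs : E} (hxs : xs ∈ minimizers g h C)
    (hdcpl : ∀ r : ℝ, ∃ μ : ℝ, 0 < μ ∧ DCPL g h C μ r) {κ : ℝ} (hκ : 0 ≤ κ)
    (hgrowth : ∀ x ∈ C, x ∈ dom g → Metric.infDist x (minimizers g h C) ^ 2 ≤
      κ * (((g x).toReal - (h x).toReal) - ((g xs).toReal - (h xs).toReal))) :
    ∃ K c : ℝ, 0 < c ∧ c < 1 ∧ ∀ x : ℕ → E, IsDCASequence g h C x → ∀ k : ℕ,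
      Metric.infDist (x k) (minimizers g h C) ≤ K * c ^ k := by
  obtain ⟨R, hR⟩ := hr.exists_step_norm_bound
  obtain ⟨μ, hμ, hd⟩ := hdcpl R
  obtain ⟨G, hG⟩ := hr.exists_step_bound
  obtain ⟨D, hD⟩ := hr.compact.isBounded.exists_norm_le
  obtain ⟨H, hH⟩ := (hr.compact.image_of_continuousOn hr.continuousOn_toReal_h).isBounded.exists_norm_le
  set M : ℝ := G + H - ((g xs).toReal - (h xs).toReal) with hM
  set q : ℝ := 1 / (1 + μ) with hq
  have hq0 : 0 < q := by positivity
  have hq1 : q < 1 := by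
    rw [hq, div_lt_one (by linarith)]
    linarith
  have hc0 : 0 < √q := Real.sqrt_pos.2 hq0
  have hc1 : √q < 1 := by
    rw [Real.sqrt_lt' one_pos]
    simpa using hq1
  -- The initial gap may be infinite, so the decay starts at the first update, where the gap is at
  -- most M. The index 0 is covered by the diameter bound D + D, and dividing by √q corrects the
  -- shift by one.
  refine ⟨max (D + D) (√(κ * M) / √q), √q, hc0, hc1, fun x hx k => ?_⟩
  have hval : ∀ k, ((g (x (k + 1))).toReal - (h (x (k + 1))).toReal) -
      ((g xs).toReal - (h xs).toReal) ≤ M * q ^ k := by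
    intro k
    induction k with
    | zero =>
      have h1 := hG _ hx.1 _ (hx.2 0)
      have h2 := hH _ (mem_image_of_mem _ (sequence_mem hx 1))
      rw [Real.norm_eq_abs] at h2
      have h3 := neg_abs_le (h (x 1)).toReal
      simp only [pow_zero, mul_one, zero_add] at h1 ⊢
      linarith
    | succ k ih =>
      have h1 := hr.step_contract hμ hd hxs (sequence_mem hx (k + 1))
        (hr.step_mem_dom (sequence_mem hx k) (hx.2 k)) (hx.2 (k + 1))
        (hR _ (sequence_mem hx (k + 1)) _ (hx.2 (k + 1)))
      refine h1.trans ?_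
      rw [pow_succ, ← mul_assoc, mul_comm]
      exact mul_le_mul_of_nonneg_right ih hq0.le
  cases k with
  | zero =>
    simp only [pow_zero, mul_one]
    refine le_trans ?_ (le_max_left _ _)
    refine (Metric.infDist_le_dist_of_mem hxs).trans ?_
    rw [dist_eq_norm]
    exact (norm_sub_le _ _).trans (add_le_add (hD _ hx.1) (hD _ hxs.1))
  | succ k =>
    have h1 := hgrowth _ (sequence_mem hx (k + 1))
      (hr.step_mem_dom (sequence_mem hx k) (hx.2 k))
    have h2 := h1.trans (mul_le_mul_of_nonneg_left (hval k) hκ)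
    have h3 := Real.le_sqrt_of_sq_le h2
    rw [← mul_assoc, Real.sqrt_mul' _ (pow_nonneg hq0.le k)] at h3
    refine h3.trans ?_
    have e : √(q ^ k) = √q ^ k := by
      rw [Real.sqrt_eq_iff_mul_self_eq (by positivity) (by positivity), ← mul_pow,
        Real.mul_self_sqrt hq0.le]
    rw [e]
    calc √(κ * M) * √q ^ k = (√(κ * M) / √q) * √q ^ (k + 1) := by
          rw [pow_succ]
          field_simp
      _ ≤ _ := mul_le_mul_of_nonneg_right (le_max_right _ _) (by positivity)

end IsRegular

end DCProgram

/-! ### Log-determinants through simultaneous diagonalization -/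

namespace LogDet

open Matrix Filter Topology Set

variable {ι : Type*} [Fintype ι] [DecidableEq ι] {M N T : Matrix ι ι ℝ}

/-- The spectral theorem for real symmetric matrices. -/
lemma exists_orthogonal_diag (hN : N.IsHermitian) :
    ∃ (U : Matrix ι ι ℝ) (ν : ι → ℝ), Uᵀ * U = 1 ∧ U * Uᵀ = 1 ∧ N = U * diagonal ν * Uᵀ := by
  refine ⟨hN.eigenvectorUnitary, hN.eigenvalues, ?_, ?_, ?_⟩
  · have := Unitary.coe_star_mul_self hN.eigenvectorUnitary
    rwa [star_eq_conjTranspose, conjTranspose_eq_transpose_of_trivial] at this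
  · have := Unitary.coe_mul_star_self hN.eigenvectorUnitary
    rwa [Unitary.coe_star, star_eq_conjTranspose, conjTranspose_eq_transpose_of_trivial] at this
  · have := hN.spectral_theorem
    rw [Unitary.conjStarAlgAut_apply, star_eq_conjTranspose,
      conjTranspose_eq_transpose_of_trivial] at this
    simpa [Function.comp_def] using this

lemma isHermitian_transpose_mul_mul {κ : Type*} [Fintype κ] (hN : N.IsHermitian)
    (W : Matrix ι κ ℝ) : (Wᵀ * N * W).IsHermitian := by
  have := isHermitian_conjTranspose_mul_mul W hN
  rwa [conjTranspose_eq_transpose_of_trivial] at this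

/-- Simultaneous diagonalization of a positive definite and a symmetric matrix by congruence. -/
lemma exists_simul_diag (hM : M.PosDef) (hN : N.IsHermitian) :
    ∃ (W : Matrix ι ι ℝ) (ν : ι → ℝ), Wᵀ * M * W = 1 ∧ Wᵀ * N * W = diagonal ν := by
  obtain ⟨U, e, hU, hU', hMe⟩ := exists_orthogonal_diag hM.1
  have hdiag : Uᵀ * M * U = diagonal e := by
    rw [hMe]
    calc Uᵀ * (U * diagonal e * Uᵀ) * U = (Uᵀ * U) * diagonal e * (Uᵀ * U) := by
          simp only [Matrix.mul_assoc]
      _ = _ := by simp [hU]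
  have he : ∀ i, 0 < e i := by
    have h1 : (Uᵀ * M * U).PosDef := by
      have hu : IsUnit U := ⟨⟨U, Uᵀ, hU', hU⟩, rfl⟩
      have := (Matrix.IsUnit.posDef_star_left_conjugate_iff (x := M) hu).2 hM
      rwa [star_eq_conjTranspose, conjTranspose_eq_transpose_of_trivial] at this
    rw [hdiag] at h1
    exact posDef_diagonal_iff.1 h1
  -- W₀ = U diag(e)^(−1/2) whitens M. An orthogonal V then diagonalizes the transformed N without
  -- disturbing the identity.
  set W₀ : Matrix ι ι ℝ := U * diagonal (fun i => (√(e i))⁻¹) with hW₀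
  have h0 : W₀ᵀ * M * W₀ = 1 := by
    have : W₀ᵀ * M * W₀ = diagonal (fun i => (√(e i))⁻¹) * (Uᵀ * M * U) *
        diagonal (fun i => (√(e i))⁻¹) := by
      rw [hW₀, transpose_mul, diagonal_transpose]
      simp only [Matrix.mul_assoc]
    rw [this, hdiag, diagonal_mul_diagonal, diagonal_mul_diagonal, ← diagonal_one]
    congr 1
    ext i
    have h2 := Real.sqrt_pos.2 (he i)
    have h3 := Real.mul_self_sqrt (he i).le
    field_simp
    nlinarith
  obtain ⟨V, ν, hV, hV', hNν⟩ := exists_orthogonal_diag (isHermitian_transpose_mul_mul hN W₀)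
  refine ⟨W₀ * V, ν, ?_, ?_⟩
  · calc (W₀ * V)ᵀ * M * (W₀ * V) = Vᵀ * (W₀ᵀ * M * W₀) * V := by
          rw [transpose_mul]
          simp only [Matrix.mul_assoc]
      _ = 1 := by rw [h0, Matrix.mul_one, hV]
  · calc (W₀ * V)ᵀ * N * (W₀ * V) = Vᵀ * (W₀ᵀ * N * W₀) * V := by
          rw [transpose_mul]
          simp only [Matrix.mul_assoc]
      _ = (Vᵀ * V) * diagonal ν * (Vᵀ * V) := by
          rw [hNν]
          simp only [Matrix.mul_assoc]
      _ = _ := by simp [hV]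

section Frame

variable {W : Matrix ι ι ℝ} {ν : ι → ℝ}

lemma det_mul_sq (hW : Wᵀ * M * W = 1) : M.det * W.det ^ 2 = 1 := by
  have := congrArg det hW
  rw [det_mul, det_mul, det_transpose, det_one] at this
  linarith

lemma isUnit_frame (hW : Wᵀ * M * W = 1) : IsUnit W := by
  rw [isUnit_iff_isUnit_det]
  have := det_mul_sq hW
  exact isUnit_iff_ne_zero.2 (fun h => by simp [h] at this)

lemma inv_eq_frame (hW : Wᵀ * M * W = 1) : M⁻¹ = W * Wᵀ := by
  refine inv_eq_left_inv ?_
  have h1 : W * (Wᵀ * M) = 1 := mul_eq_one_comm.1 hW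
  rw [Matrix.mul_assoc, h1]

lemma trace_inv_mul_frame (hW : Wᵀ * M * W = 1) (T : Matrix ι ι ℝ) :
    (M⁻¹ * T).trace = ∑ k, (Wᵀ * T * W) k k := by
  rw [inv_eq_frame hW, Matrix.mul_assoc, trace_mul_comm]
  rfl

lemma trace_inv_mul_diag (hW : Wᵀ * M * W = 1) (hν : Wᵀ * N * W = diagonal ν) :
    (M⁻¹ * N).trace = ∑ k, ν k := by
  simp [trace_inv_mul_frame hW, hν]

lemma det_diag (hW : Wᵀ * M * W = 1) (hν : Wᵀ * N * W = diagonal ν) :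
    N.det = M.det * ∏ k, ν k := by
  have h1 := congrArg det hν
  rw [det_mul, det_mul, det_transpose, det_diagonal] at h1
  have h2 := det_mul_sq hW
  rw [← h1]
  linear_combination -N.det * h2

lemma posDef_iff_frame (hW : Wᵀ * M * W = 1) (hν : Wᵀ * N * W = diagonal ν) :
    N.PosDef ↔ ∀ k, 0 < ν k := by
  rw [← Matrix.IsUnit.posDef_star_left_conjugate_iff (isUnit_frame hW), star_eq_conjTranspose,
    conjTranspose_eq_transpose_of_trivial, hν, posDef_diagonal_iff]

lemma log_det_diag (hM : M.PosDef) (hW : Wᵀ * M * W = 1) (hν : Wᵀ * N * W = diagonal ν)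
    (hpos : ∀ k, 0 < ν k) : Real.log N.det = Real.log M.det + ∑ k, Real.log (ν k) := by
  rw [det_diag hW hν, Real.log_mul hM.det_pos.ne' (Finset.prod_pos fun k _ => hpos k).ne',
    Real.log_prod (fun k _ => (hpos k).ne')]

end Frame

/-- The tangent inequality for the concave function `log det`. -/
lemma log_det_le_add_trace (hM : M.PosDef) (hN : N.PosDef) :
    Real.log N.det ≤ Real.log M.det + (M⁻¹ * (N - M)).trace := by
  obtain ⟨W, ν, hW, hν⟩ := exists_simul_diag hM hN.1
  have hpos := (posDef_iff_frame hW hν).1 hN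
  rw [log_det_diag hM hW hν hpos, Matrix.mul_sub, trace_sub, trace_inv_mul_diag hW hν,
    nonsing_inv_mul _ ((isUnit_iff_isUnit_det _).1 hM.isUnit), trace_one, ← Finset.card_univ,
    Finset.cast_card, ← Finset.sum_sub_distrib]
  gcongr with k
  exact Real.log_le_sub_one_of_pos (hpos k)

/-- Average the tangent inequalities at the combination P: the trace terms cancel because a(M − P) +
b(N − P) = 0. -/
lemma log_det_concave (hM : M.PosDef) (hN : N.PosDef) {a b : ℝ} (ha : 0 ≤ a) (hb : 0 ≤ b)
    (hab : a + b = 1) (hP : (a • M + b • N).PosDef) :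
    a * Real.log M.det + b * Real.log N.det ≤ Real.log (a • M + b • N).det := by
  have h1 := log_det_le_add_trace hP hM
  have h2 := log_det_le_add_trace hP hN
  set P := a • M + b • N with hPdef
  have h3 : a * (P⁻¹ * (M - P)).trace + b * (P⁻¹ * (N - P)).trace = 0 := by
    have : a • (M - P) + b • (N - P) = 0 := by
      have e : a • (M - P) + b • (N - P) = P - (a + b) • P := by
        rw [hPdef]
        module
      rw [e, hab, one_smul, sub_self]
    have e : a * (P⁻¹ * (M - P)).trace + b * (P⁻¹ * (N - P)).trace =
        (P⁻¹ * (a • (M - P) + b • (N - P))).trace := by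
      rw [Matrix.mul_add, Matrix.mul_smul, Matrix.mul_smul, trace_add, trace_smul, trace_smul]
      rfl
    rw [e, this, Matrix.mul_zero, trace_zero]
  have h4 : Real.log P.det = a * Real.log P.det + b * Real.log P.det := by
    rw [← add_mul, hab, one_mul]
  rw [h4]
  nlinarith [mul_le_mul_of_nonneg_left h1 ha, mul_le_mul_of_nonneg_left h2 hb]

lemma posDef_combo (hM : M.PosDef) (hN : N.PosDef) {a b : ℝ} (ha : 0 ≤ a) (hb : 0 ≤ b)
    (hab : a + b = 1) : (a • M + b • N).PosDef := by
  rcases ha.eq_or_lt with rfl | ha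
  · simp only [zero_add] at hab
    simpa [hab] using hN
  · exact (hM.smul ha).add_posSemidef (hN.posSemidef.smul hb)

/-- The derivative of `log det` along a line. -/
lemma hasDerivAt_log_det (hM : M.PosDef) (hT : T.IsHermitian) :
    HasDerivAt (fun t : ℝ => Real.log (M + t • T).det) (M⁻¹ * T).trace 0 := by
  obtain ⟨W, θ, hW, hθ⟩ := exists_simul_diag hM hT
  have hd : ∀ t : ℝ, Wᵀ * (M + t • T) * W = diagonal (fun k => 1 + t * θ k) := by
    intro t
    rw [Matrix.mul_add, Matrix.add_mul, hW, Matrix.mul_smul, Matrix.smul_mul, hθ, ← diagonal_one,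
      ← diagonal_smul, diagonal_add]
    rfl
  have hder : HasDerivAt (fun t : ℝ => Real.log M.det + ∑ k, Real.log (1 + t * θ k))
      (∑ k, θ k) 0 := by
    have h1 : ∀ k ∈ Finset.univ, HasDerivAt (fun t : ℝ => Real.log (1 + t * θ k)) (θ k) 0 := by
      intro k _
      have := (((hasDerivAt_id (0 : ℝ)).mul_const (θ k)).const_add 1).log (by simp)
      simpa using this
    exact (HasDerivAt.fun_sum h1).const_add _
  rw [trace_inv_mul_diag hW hθ]
  refine hder.congr_of_eventuallyEq ?_
  have hev : ∀ᶠ t : ℝ in 𝓝 0, ∀ k, 0 < 1 + t * θ k := by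
    rw [Filter.eventually_all]
    intro k
    have : Continuous (fun t : ℝ => 1 + t * θ k) := by fun_prop
    exact this.continuousAt.eventually (lt_mem_nhds (by simp))
  filter_upwards [hev] with t ht
  exact log_det_diag hM hW (hd t) ht

lemma isClosed_posSemidef : IsClosed {M : Matrix ι ι ℝ | M.PosSemidef} := by
  have : {M : Matrix ι ι ℝ | M.PosSemidef} =
      {M | Mᴴ = M} ∩ ⋂ x : ι → ℝ, {M | 0 ≤ x ⬝ᵥ (M *ᵥ x)} := by
    ext M
    simp only [mem_ofPred_eq, mem_inter_iff, mem_iInter, posSemidef_iff_dotProduct_mulVec,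
      IsHermitian, star_trivial]
  rw [this]
  refine (isClosed_eq (by fun_prop) (by fun_prop)).inter (isClosed_iInter fun x => ?_)
  exact isClosed_le (by fun_prop) (by fun_prop)

lemma posDef_of_posSemidef_of_det_pos (hM : M.PosSemidef) (hd : 0 < M.det) : M.PosDef := by
  rw [hM.1.posDef_iff_eigenvalues_pos]
  intro i
  refine lt_of_le_of_ne (hM.eigenvalues_nonneg i) fun h => ?_
  rw [hM.1.det_eq_prod_eigenvalues, Finset.prod_eq_zero (Finset.mem_univ i) (by simp [← h])] at hd
  exact lt_irrefl _ hd

/-- Positive definiteness is an open condition on continuous families of symmetric matrices. -/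
lemma isOpen_posDef {X : Type*} [TopologicalSpace X] {F : X → Matrix ι ι ℝ} (hF : Continuous F)
    (hsym : ∀ x, (F x).IsHermitian) : IsOpen {x | (F x).PosDef} := by
  rw [isOpen_iff_mem_nhds]
  intro x₀ hx₀
  have hK : IsCompact (Metric.sphere (0 : ι → ℝ) 1) := isCompact_sphere _ _
  have hcont : Continuous (fun z : X × (ι → ℝ) => z.2 ⬝ᵥ (F z.1 *ᵥ z.2)) := by fun_prop
  -- The quadratic form is positive on the compact unit sphere at x₀, so it stays positive there for
  -- all nearby x; homogeneity then reaches every nonzero vector.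
  have := hK.eventually_forall_of_forall_eventually (x₀ := x₀)
    (P := fun x u => 0 < u ⬝ᵥ (F x *ᵥ u)) (fun u hu => by
      refine hcont.continuousAt.eventually (lt_mem_nhds ?_)
      have hu0 : u ≠ 0 := fun h => by simp [h] at hu
      simpa using PosDef.dotProduct_mulVec_pos hx₀ hu0)
  filter_upwards [this] with x hx
  refine PosDef.of_dotProduct_mulVec_pos (hsym x) fun u hu => ?_
  have hn : 0 < ‖u‖ := norm_pos_iff.2 hu
  have h1 := hx (‖u‖⁻¹ • u) (by simp [norm_smul, hn.ne'])
  rw [mulVec_smul, dotProduct_smul, smul_dotProduct, smul_eq_mul, smul_eq_mul, ← mul_assoc] at h1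
  rw [star_trivial]
  exact pos_of_mul_pos_right h1 (by positivity)

end LogDet

/-! ### Weighted sums of −log det: closedness, convexity, smoothness, gradient -/

noncomputable section

namespace LogDet

open Matrix Filter Topology Set BrascampLieb DCProgram

section NegLogDet

variable {k : ℕ} {M : Matrix (Fin k) (Fin k) ℝ}

/-- A positive semidefinite matrix with positive determinant is positive definite, so sublevel sets
are cut out by two closed conditions. This is the source of lower semicontinuity. -/
lemma negLogDet_le_coe_iff {t : ℝ} :
    negLogDet M ≤ (t : EReal) ↔ M.PosSemidef ∧ Real.exp (-t) ≤ M.det := by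
  unfold negLogDet
  split_ifs with hM
  · rw [EReal.coe_le_coe_iff, neg_le, Real.le_log_iff_exp_le hM.det_pos]
    exact ⟨fun h => ⟨hM.posSemidef, h⟩, fun h => h.2⟩
  · simp only [top_le_iff, EReal.coe_ne_top, false_iff]
    rintro ⟨h1, h2⟩
    exact hM (posDef_of_posSemidef_of_det_pos h1 ((Real.exp_pos _).trans_le h2))

lemma coe_mul_negLogDet_ne_bot {c : ℝ} (hc : 0 ≤ c) (M : Matrix (Fin k) (Fin k) ℝ) :
    (c : EReal) * negLogDet M ≠ ⊥ := by
  unfold negLogDet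
  split_ifs
  · rw [← EReal.coe_mul]
    exact EReal.coe_ne_bot _
  · rcases hc.eq_or_lt with rfl | hc
    · simp
    · simp [EReal.coe_mul_top_of_pos hc]

lemma lowerSemicontinuous_negLogDet {X : Type*} [TopologicalSpace X]
    {F : X → Matrix (Fin k) (Fin k) ℝ} (hF : Continuous F) {c : ℝ} (hc : 0 ≤ c) :
    LowerSemicontinuous fun x => (c : EReal) * negLogDet (F x) := by
  rcases hc.eq_or_lt with rfl | hc'
  · simpa using lowerSemicontinuous_const
  rw [lowerSemicontinuous_iff_isClosed_preimage]
  intro y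
  induction y with
  | bot =>
    have : (fun x => (c : EReal) * negLogDet (F x)) ⁻¹' Iic ⊥ = ∅ := by
      ext x
      simp only [mem_preimage, mem_Iic, le_bot_iff, mem_empty_iff_false, iff_false]
      exact coe_mul_negLogDet_ne_bot hc _
    rw [this]
    exact isClosed_empty
  | top => simp
  | coe y =>
    have : (fun x => (c : EReal) * negLogDet (F x)) ⁻¹' Iic (y : EReal) =
        F ⁻¹' {M | M.PosSemidef} ∩ {x | Real.exp (-(y / c)) ≤ (F x).det} := by
      ext x
      simp only [mem_preimage, mem_Iic, mem_inter_iff, mem_ofPred_eq]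
      rw [← negLogDet_le_coe_iff]
      unfold negLogDet
      split_ifs
      · rw [← EReal.coe_mul, EReal.coe_le_coe_iff, EReal.coe_le_coe_iff, le_div_iff₀ hc',
          mul_comm]
      · simp [EReal.coe_mul_top_of_pos hc']
    rw [this]
    exact (isClosed_posSemidef.preimage hF).inter (isClosed_le continuous_const hF.matrix_det)

end NegLogDet

variable {E : Type*} [NormedAddCommGroup E] [InnerProductSpace ℝ E] [FiniteDimensional ℝ E]
variable {N : ℕ} {d : Fin N → ℕ}

/-- The weighted sum `∑ₖ cₖ (-log det Fₖ(x))`. -/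
def negLogDetSum (c : Fin N → ℝ) (F : ∀ k, E → Matrix (Fin (d k)) (Fin (d k)) ℝ) (x : E) : EReal :=
  ∑ k, (c k : EReal) * negLogDet (F k x)

variable {c : Fin N → ℝ} {F : ∀ k, E → Matrix (Fin (d k)) (Fin (d k)) ℝ}

lemma sum_ne_bot {κ : Type*} (s : Finset κ) {f : κ → EReal} (hf : ∀ k, f k ≠ ⊥) :
    ∑ k ∈ s, f k ≠ ⊥ := by
  classical
  induction s using Finset.induction_on with
  | empty => simp
  | insert a s ha ih =>
    rw [Finset.sum_insert ha, Ne, EReal.add_eq_bot_iff]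
    exact fun h => h.elim (hf a) ih

lemma coe_sum_ereal {κ : Type*} (s : Finset κ) (f : κ → ℝ) :
    ((∑ k ∈ s, f k : ℝ) : EReal) = ∑ k ∈ s, (f k : EReal) := by
  classical
  induction s using Finset.induction_on with
  | empty => simp
  | insert a s ha ih => rw [Finset.sum_insert ha, Finset.sum_insert ha, EReal.coe_add, ih]

lemma negLogDetSum_ne_bot (hc : ∀ k, 0 ≤ c k) (x : E) : negLogDetSum c F x ≠ ⊥ :=
  sum_ne_bot _ fun k => coe_mul_negLogDet_ne_bot (hc k) _

lemma lowerSemicontinuous_negLogDetSum (hc : ∀ k, 0 ≤ c k) (hF : ∀ k, Continuous (F k)) :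
    LowerSemicontinuous (negLogDetSum c F) := by
  unfold negLogDetSum
  generalize (Finset.univ : Finset (Fin N)) = s
  classical
  induction s using Finset.induction_on with
  | empty => simpa using lowerSemicontinuous_const
  | insert a s ha ih =>
    simp only [Finset.sum_insert ha]
    refine LowerSemicontinuous.add' (lowerSemicontinuous_negLogDet (hF a) (hc a)) ih fun x => ?_
    -- Neither summand takes the value −∞, so extended addition is continuous there and lower
    -- semicontinuity passes to the sum.
    exact EReal.continuousAt_add
      (Or.inr (sum_ne_bot _ fun k => coe_mul_negLogDet_ne_bot (hc k) _))
      (Or.inl (coe_mul_negLogDet_ne_bot (hc a) _))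

lemma negLogDetSum_eq_coe (hc : ∀ k, 0 ≤ c k) {x : E} (hx : ∀ k, 0 < c k → (F k x).PosDef) :
    negLogDetSum c F x = ((-∑ k, c k * Real.log (F k x).det : ℝ) : EReal) := by
  rw [← Finset.sum_neg_distrib, coe_sum_ereal]
  refine Finset.sum_congr rfl fun k _ => ?_
  rcases (hc k).eq_or_lt with h | h
  · simp [← h]
  · rw [negLogDet, if_pos (hx k h), ← EReal.coe_mul, mul_neg]

lemma dom_negLogDetSum (hc : ∀ k, 0 ≤ c k) :
    dom (negLogDetSum c F) = {x | ∀ k, 0 < c k → (F k x).PosDef} := by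
  ext x
  refine ⟨fun hx k hk => ?_, fun hx => ?_⟩
  · by_contra hPD
    refine hx ?_
    rw [negLogDetSum, ← Finset.add_sum_erase _ _ (Finset.mem_univ k), negLogDet, if_neg hPD,
      EReal.coe_mul_top_of_pos hk]
    exact EReal.top_add_of_ne_bot (sum_ne_bot _ fun k => coe_mul_negLogDet_ne_bot (hc k) _)
  · rw [dom, mem_ofPred_eq, negLogDetSum_eq_coe hc hx]
    exact EReal.coe_ne_top _

/-- Affine maps into symmetric matrices. -/
structure IsSymAffine (F : ∀ k, E → Matrix (Fin (d k)) (Fin (d k)) ℝ)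
    (B : ∀ k, E → Matrix (Fin (d k)) (Fin (d k)) ℝ) : Prop where
  add_apply : ∀ k x v, F k (x + v) = F k x + B k v
  smul_apply : ∀ k (a : ℝ) v, B k (a • v) = a • B k v
  isHermitian : ∀ k x, (F k x).IsHermitian

variable {B : ∀ k, E → Matrix (Fin (d k)) (Fin (d k)) ℝ}

namespace IsSymAffine

lemma eq_add (hF : IsSymAffine F B) (k : Fin N) (x : E) : F k x = F k 0 + B k x := by
  rw [← hF.add_apply, zero_add]

lemma linear_add (hF : IsSymAffine F B) (k : Fin N) (x y : E) : B k (x + y) = B k x + B k y := by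
  have h1 := hF.add_apply k 0 (x + y)
  rw [← add_assoc, hF.add_apply, hF.add_apply, add_assoc] at h1
  exact (add_left_cancel h1).symm

/-- The linear part as a linear map. -/
def toLin (hF : IsSymAffine F B) (k : Fin N) : E →ₗ[ℝ] Matrix (Fin (d k)) (Fin (d k)) ℝ where
  toFun := B k
  map_add' := hF.linear_add k
  map_smul' := hF.smul_apply k

lemma isHermitian_linear (hF : IsSymAffine F B) (k : Fin N) (x : E) : (B k x).IsHermitian := by
  have : B k x = F k x - F k 0 := by
    rw [hF.eq_add]
    abel
  rw [this]
  exact (hF.isHermitian k x).sub (hF.isHermitian k 0)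

lemma continuous (hF : IsSymAffine F B) (k : Fin N) : Continuous (F k) := by
  have : F k = fun x => F k 0 + B k x := funext (hF.eq_add k)
  rw [this]
  exact continuous_const.add (hF.toLin k).continuous_of_finiteDimensional

lemma combo (hF : IsSymAffine F B) (k : Fin N) (x y : E) {a b : ℝ} (hab : a + b = 1) :
    F k (a • x + b • y) = a • F k x + b • F k y := by
  rw [hF.eq_add, hF.eq_add k x, hF.eq_add k y, hF.linear_add, hF.smul_apply, hF.smul_apply,
    smul_add, smul_add]
  have : F k 0 = a • F k 0 + b • F k 0 := by rw [← add_smul, hab, one_smul]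
  nth_rewrite 1 [this]
  abel

lemma contDiff_det (hF : IsSymAffine F B) (k : Fin N) : ContDiff ℝ 1 fun x => (F k x).det := by
  have hent : ∀ a b, ContDiff ℝ 1 fun x => F k x a b := by
    intro a b
    have : (fun x => F k x a b) = fun x => F k 0 a b +
        LinearMap.toContinuousLinearMap ((Matrix.entryLinearMap ℝ ℝ a b) ∘ₗ (hF.toLin k)) x := by
      funext x
      rw [hF.eq_add]
      rfl
    rw [this]
    exact contDiff_const.add (ContinuousLinearMap.contDiff _)
  simp only [det_apply]
  refine ContDiff.sum fun σ _ => ContDiff.const_smul _ ?_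
  exact contDiff_prod fun i _ => hent _ _

lemma mem_dom_iff (hc : ∀ k, 0 ≤ c k) {x : E} :
    x ∈ dom (negLogDetSum c F) ↔ ∀ k, 0 < c k → (F k x).PosDef := by
  rw [dom_negLogDetSum hc]
  rfl

lemma toReal_eq (hc : ∀ k, 0 ≤ c k) {x : E} (hx : x ∈ dom (negLogDetSum c F)) :
    (negLogDetSum c F x).toReal = -∑ k, c k * Real.log (F k x).det := by
  rw [negLogDetSum_eq_coe hc ((mem_dom_iff hc).1 hx), EReal.toReal_coe]

lemma isClosedConvexC1 (hF : IsSymAffine F B) (hc : ∀ k, 0 ≤ c k) :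
    IsClosedConvexC1 (negLogDetSum c F) where
  ne_bot := negLogDetSum_ne_bot hc
  closed := by
    have h1 := (lowerSemicontinuous_negLogDetSum hc hF.continuous).isClosed_epigraph
    exact h1.preimage (f := fun z : E × ℝ => (z.1, (z.2 : EReal)))
      (continuous_fst.prodMk (continuous_coe_real_ereal.comp continuous_snd))
  convex := by
    rintro ⟨x, s⟩ hx ⟨y, t⟩ hy a b ha hb hab
    simp only [epi, mem_ofPred_eq] at hx hy
    have hxd : x ∈ dom (negLogDetSum c F) := ne_top_of_le_ne_top (EReal.coe_ne_top _) hx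
    have hyd : y ∈ dom (negLogDetSum c F) := ne_top_of_le_ne_top (EReal.coe_ne_top _) hy
    rw [mem_dom_iff hc] at hxd hyd
    rw [negLogDetSum_eq_coe hc hxd, EReal.coe_le_coe_iff] at hx
    rw [negLogDetSum_eq_coe hc hyd, EReal.coe_le_coe_iff] at hy
    have hzd : ∀ k, 0 < c k → (F k (a • x + b • y)).PosDef := fun k hk => by
      rw [hF.combo k x y hab]
      exact posDef_combo (hxd k hk) (hyd k hk) ha hb hab
    show negLogDetSum c F (a • x + b • y) ≤ ((a • s + b • t : ℝ) : EReal)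
    rw [negLogDetSum_eq_coe hc hzd, EReal.coe_le_coe_iff, smul_eq_mul, smul_eq_mul]
    have key : a * ∑ k, c k * Real.log (F k x).det + b * ∑ k, c k * Real.log (F k y).det ≤
        ∑ k, c k * Real.log (F k (a • x + b • y)).det := by
      rw [Finset.mul_sum, Finset.mul_sum, ← Finset.sum_add_distrib]
      refine Finset.sum_le_sum fun k _ => ?_
      rcases (hc k).eq_or_lt with h | h
      · simp [← h]
      · have := log_det_concave (hxd k h) (hyd k h) ha hb hab
          (posDef_combo (hxd k h) (hyd k h) ha hb hab)
        rw [hF.combo k x y hab]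
        nlinarith [mul_le_mul_of_nonneg_left this h.le]
    nlinarith [mul_le_mul_of_nonneg_left hx ha, mul_le_mul_of_nonneg_left hy hb]
  isOpen_dom := by
    rw [dom_negLogDetSum hc]
    simp only [ofPred_forall]
    refine isOpen_iInter_of_finite fun k => isOpen_iInter_of_finite fun _ => ?_
    exact isOpen_posDef (hF.continuous k) (hF.isHermitian k)
  contDiffOn := by
    have : ContDiffOn ℝ 1 (fun x => -∑ k, c k * Real.log (F k x).det)
        (dom (negLogDetSum c F)) := by
      refine ContDiffOn.neg (ContDiffOn.sum fun k _ => ?_)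
      rcases (hc k).eq_or_lt with h | h
      · simpa [← h] using contDiffOn_const
      · refine contDiffOn_const.mul ((hF.contDiff_det k).contDiffOn.log fun x hx => ?_)
        exact ((mem_dom_iff hc).1 hx k h).det_pos.ne'
    exact this.congr fun x hx => toReal_eq hc hx

/-- The gradient of a weighted sum of `-log det` terms. -/
lemma inner_grad (hF : IsSymAffine F B) (hc : ∀ k, 0 ≤ c k) [CompleteSpace E] {x : E}
    (hx : x ∈ dom (negLogDetSum c F)) (v : E) :
    inner ℝ (grad (negLogDetSum c F) x) v = -∑ k, c k * ((F k x)⁻¹ * B k v).trace := by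
  have h1 := (hF.isClosedConvexC1 hc).hasDerivAt_line hx v
  have h2 : HasDerivAt (fun t : ℝ => -∑ k, c k * Real.log (F k x + t • B k v).det)
      (-∑ k, c k * ((F k x)⁻¹ * B k v).trace) 0 := by
    refine (HasDerivAt.fun_sum fun k _ => ?_).neg
    rcases (hc k).eq_or_lt with h | h
    · simpa [← h] using hasDerivAt_const (0 : ℝ) (0 : ℝ)
    · exact (hasDerivAt_log_det ((mem_dom_iff hc).1 hx k h) (hF.isHermitian_linear k v)).const_mul _
  refine h1.unique (h2.congr_of_eventuallyEq ?_)
  have hcont : Tendsto (fun t : ℝ => x + t • v) (𝓝 0) (𝓝 x) := by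
    have : Continuous (fun t : ℝ => x + t • v) := by fun_prop
    simpa using this.tendsto 0
  filter_upwards [hcont ((hF.isClosedConvexC1 hc).isOpen_dom.mem_nhds hx)] with t ht
  refine (toReal_eq hc (x := x + t • v) ht).trans ?_
  simp only [hF.add_apply, hF.smul_apply]

end IsSymAffine

end LogDet

end

namespace LogDet

open Matrix

/-! ### Scalar inequalities for the logarithm -/

section Scalar

/-- A second-order refinement of the tangent inequality of the logarithm on `(0, b]`. -/
lemma log_le_tangent_sub_sq {x v b : ℝ} (hx : 0 < x) (hv : 0 < v) (hxb : x ≤ b) (hvb : v ≤ b) :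
    Real.log x ≤ Real.log v + (x - v) / v - (x - v) ^ 2 / (4 * b ^ 2) := by
  -- With w = √(x/v), log x − log v = 2 log w ≤ 2(w − 1) = (w² − 1) − (w − 1)². The last square is
  -- the refinement, and (x − v)² = (w − 1)²((w + 1)v)² with the second factor at most 4b².
  set w := √(x / v) with hw
  have hxv : 0 < x / v := div_pos hx hv
  have hw0 : 0 < w := Real.sqrt_pos.2 hxv
  have hww : w ^ 2 = x / v := Real.sq_sqrt hxv.le
  have hxw : x = w ^ 2 * v := by rw [hww, div_mul_cancel₀ _ hv.ne']
  have h1 : Real.log x = Real.log v + 2 * Real.log w := by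
    rw [hxw, Real.log_mul (by positivity) hv.ne', Real.log_pow]
    push_cast
    ring
  have h2 := Real.log_le_sub_one_of_pos hw0
  have h3 : (x - v) / v = w ^ 2 - 1 := by
    rw [hww]
    field_simp
  have h4 : (x - v) ^ 2 / (4 * b ^ 2) ≤ (w - 1) ^ 2 := by
    have hb : 0 < b := hx.trans_le hxb
    rw [div_le_iff₀ (by positivity)]
    have h5 : (x - v) ^ 2 = (w - 1) ^ 2 * ((w + 1) * v) ^ 2 := by
      rw [hxw]
      ring
    have h6 : ((w + 1) * v) ^ 2 ≤ 4 * b ^ 2 := by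
      have h7 : (w + 1) ^ 2 ≤ 2 * (w ^ 2 + 1) := by nlinarith [sq_nonneg (w - 1)]
      have h8 : ((w + 1) * v) ^ 2 ≤ 2 * (x + v) * v := by
        calc ((w + 1) * v) ^ 2 = (w + 1) ^ 2 * v ^ 2 := by ring
          _ ≤ 2 * (w ^ 2 + 1) * v ^ 2 := by gcongr
          _ = 2 * (w ^ 2 * v + v) * v := by ring
          _ = 2 * (x + v) * v := by rw [← hxw]
      nlinarith [mul_le_mul (add_le_add hxb hvb) hvb hv.le (by linarith)]
    rw [h5]
    gcongr
  rw [h1, h3]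
  nlinarith

/-- The quadratic slack in log x ≤ x − 1 leaves room for s(x − 1)². In matrix form the perturbed
direction stays below Y − X, hence is feasible. -/
lemma log_add_sq_le_sub_one {x b s : ℝ} (hx : 0 < x) (hxb : x ≤ b) (hb : 1 ≤ b)
    (hs : s ≤ 1 / (4 * b ^ 2)) : Real.log x + s * (x - 1) ^ 2 ≤ x - 1 := by
  have h1 := log_le_tangent_sub_sq hx one_pos hxb hb
  rw [Real.log_one, div_one] at h1
  have h2 : s * (x - 1) ^ 2 ≤ 1 / (4 * b ^ 2) * (x - 1) ^ 2 := by gcongr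
  have h3 : 1 / (4 * b ^ 2) * (x - 1) ^ 2 = (x - 1) ^ 2 / (4 * b ^ 2) := by ring
  linarith

/-- On [a, b] the perturbed logarithm is squeezed between multiples of x − 1. The squared direction
weights, which govern the second-order error, are thus comparable to the gain. -/
lemma sq_log_add_sq_le {x a b s : ℝ} (ha : 0 < a) (hxa : a ≤ x) (hxb : x ≤ b) (hb : 1 ≤ b)
    (hs0 : 0 ≤ s) (hs : s ≤ 1 / (4 * b ^ 2)) :
    (Real.log x + s * (x - 1) ^ 2) ^ 2 ≤ (1 + 1 / a) ^ 2 * (x - 1) ^ 2 := by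
  have hx : 0 < x := ha.trans_le hxa
  have h1 := log_add_sq_le_sub_one hx hxb hb hs
  have h2 := Real.one_sub_inv_le_log_of_pos hx
  have h3 : 0 ≤ s * (x - 1) ^ 2 := by positivity
  have h4 : 1 - x⁻¹ = (x - 1) * x⁻¹ := by field_simp
  have h5 : x⁻¹ ≤ 1 / a := by
    rw [one_div]
    exact inv_anti₀ ha hxa
  have hi : 0 < x⁻¹ := inv_pos.2 hx
  have ha' : 0 < 1 / a := by positivity
  rw [← mul_pow, ← sq_abs, ← sq_abs ((1 + 1 / a) * (x - 1)), abs_mul,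
    abs_of_pos (show 0 < 1 + 1 / a by linarith)]
  refine pow_le_pow_left₀ (abs_nonneg _) ?_ 2
  rcases le_total 1 x with h | h
  · rw [abs_of_nonneg (show 0 ≤ x - 1 by linarith), abs_le]
    constructor <;> nlinarith
  · rw [abs_of_nonpos (show x - 1 ≤ 0 by linarith), abs_le]
    constructor <;> nlinarith

/-- A strengthened Jensen inequality for the logarithm. Part of the mass `c₀` sits at the
value `1`; the entries with `x = 0` are compared with a large negative constant. -/
lemma sum_le_log_of_jensen {κ : Type*} [Fintype κ] {w x σ e : κ → ℝ} {w₀ w₁ b s R v : ℝ}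
    (hw : ∀ l, 0 ≤ w l) (hsum : ∑ l, w l + w₀ = 1) (hw₁ : 0 < w₁) (hw₁₀ : w₁ ≤ w₀) (hb : 1 ≤ b)
    (hs : s = w₁ / (8 * b ^ 2)) (hR : R = 2 - Real.log w₁)
    (hv : v = ∑ l, w l * x l + w₀)
    (hx : ∀ l, (e l = 0 ∧ 0 < x l ∧ x l ≤ b ∧ σ l = Real.log (x l) + s * (x l - 1) ^ 2) ∨
      (e l = 1 ∧ x l = 0 ∧ σ l = -R)) :
    ∑ l, w l * (σ l + e l) ≤ Real.log v := by
  have hw₀ : w₀ ≤ 1 := by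
    have := Finset.sum_nonneg fun l (_ : l ∈ Finset.univ) => hw l
    linarith
  have hb0 : 0 < b := by linarith
  have hx0 : ∀ l, 0 ≤ x l := fun l => by
    rcases hx l with h | h
    · exact h.2.1.le
    · exact h.2.1.ge
  have hxb : ∀ l, x l ≤ b := fun l => by
    rcases hx l with h | h
    · exact h.2.2.1
    · linarith [h.2.1]
  have hv0 : w₁ ≤ v := by
    have := Finset.sum_nonneg fun l (_ : l ∈ Finset.univ) => mul_nonneg (hw l) (hx0 l)
    linarith
  have hvpos : 0 < v := hw₁.trans_le hv0
  have hvb : v ≤ b := by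
    have h1 : ∑ l, w l * x l ≤ ∑ l, w l * b :=
      Finset.sum_le_sum fun l _ => mul_le_mul_of_nonneg_left (hxb l) (hw l)
    rw [← Finset.sum_mul] at h1
    nlinarith
  have hs0 : 0 ≤ s := by rw [hs]; positivity
  have hs1 : 2 * s ≤ 1 / (4 * b ^ 2) := by
    rw [hs, show 2 * (w₁ / (8 * b ^ 2)) = w₁ * (1 / (4 * b ^ 2)) by ring]
    exact mul_le_of_le_one_left (by positivity) (hw₁₀.trans hw₀)
  -- The term s(x − 1)² is split as 2s(x − v)² + 2s(1 − v)². The first part is absorbed by the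
  -- refined tangent inequality at v, the second is carried along.
  have hpt : ∀ l, σ l + e l ≤ Real.log v + (x l - v) / v + 2 * s * (1 - v) ^ 2 := by
    intro l
    rcases hx l with ⟨h1, h2, h3, h4⟩ | ⟨h1, h2, h3⟩
    · have h5 := log_le_tangent_sub_sq h2 hvpos h3 hvb
      have h6 : (x l - 1) ^ 2 ≤ 2 * (x l - v) ^ 2 + 2 * (1 - v) ^ 2 := by
        nlinarith [sq_nonneg ((x l - v) + (1 - v))]
      have h7 : 2 * s * (x l - v) ^ 2 ≤ (x l - v) ^ 2 / (4 * b ^ 2) := by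
        rw [div_eq_mul_one_div, mul_comm ((x l - v) ^ 2)]
        exact mul_le_mul_of_nonneg_right hs1 (sq_nonneg _)
      rw [h1, h4]
      nlinarith [mul_le_mul_of_nonneg_left h6 hs0]
    -- Here the tangent term equals −1, so −R + 1 = log w₁ − 1 ≤ log v − 1: this dictates R = 2 −
    -- log w₁.
    · have h4 := Real.log_le_log hw₁ hv0
      have h5 : (0 - v) / v = -1 := by
        rw [zero_sub, neg_div, div_self hvpos.ne']
      have h6 : 0 ≤ 2 * s * (1 - v) ^ 2 := by positivity
      rw [h1, h2, h3, h5, hR]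
      linarith
  -- The refinement at the mass w₀ located at 1 pays for the leftover 2s(1 − v)²; the choice s =
  -- w₁/(8b²) makes w₁(1 − v)²/(4b²) exactly that amount.
  have hone := log_le_tangent_sub_sq one_pos hvpos hb hvb
  rw [Real.log_one] at hone
  have hw₀s : 2 * s * (1 - v) ^ 2 ≤ w₀ * ((1 - v) ^ 2 / (4 * b ^ 2)) := by
    rw [hs, show 2 * (w₁ / (8 * b ^ 2)) * (1 - v) ^ 2 = w₁ * ((1 - v) ^ 2 / (4 * b ^ 2)) by ring]
    gcongr
  have h1 : ∑ l, w l * (σ l + e l) ≤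
      ∑ l, w l * (Real.log v + (x l - v) / v + 2 * s * (1 - v) ^ 2) :=
    Finset.sum_le_sum fun l _ => mul_le_mul_of_nonneg_left (hpt l) (hw l)
  have h2 : ∑ l, w l * (Real.log v + (x l - v) / v + 2 * s * (1 - v) ^ 2) =
      (∑ l, w l) * (Real.log v - 1 + 2 * s * (1 - v) ^ 2) + (∑ l, w l * x l) / v := by
    rw [Finset.sum_mul, Finset.sum_div, ← Finset.sum_add_distrib]
    refine Finset.sum_congr rfl fun l _ => ?_
    field_simp
    ring
  have h3 : ∑ l, w l * x l = v - w₀ := by linarith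
  have h4 : ∑ l, w l = 1 - w₀ := by linarith
  rw [h2, h3, h4] at h1
  have h5 : (1 - v) / v = 1 / v - 1 := by field_simp
  have h6 : (v - w₀) / v = 1 - w₀ * (1 / v) := by field_simp
  rw [h5] at hone
  rw [h6] at h1
  have hw₀0 : 0 ≤ w₀ := hw₁.le.trans hw₁₀
  have h7 := mul_le_mul_of_nonneg_left hone hw₀0
  have h8 : 0 ≤ w₀ * (2 * s * (1 - v) ^ 2) := by positivity
  nlinarith

lemma neg_log_one_sub_le {u : ℝ} (hu : |u| ≤ 1 / 2) : -Real.log (1 - u) - u ≤ 2 * u ^ 2 := by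
  have h1 := Real.abs_log_sub_add_sum_range_le (lt_of_le_of_lt hu (by norm_num)) 1
  simp only [Finset.range_one, Finset.sum_singleton, zero_add, pow_one, Nat.cast_zero, div_one,
    Nat.reduceAdd, sq_abs] at h1
  have h2 : u ^ 2 / (1 - |u|) ≤ 2 * u ^ 2 := by
    rw [div_le_iff₀ (by linarith)]
    nlinarith [sq_nonneg u]
  have h3 := (neg_abs_le (u + Real.log (1 - u)))
  linarith

end Scalar

/-! ### First- and second-order bounds for log det of P diag(x) Pᵀ + ρI -/

section Gram

variable {m κ : Type*} [Fintype m] [DecidableEq m] [Fintype κ] [DecidableEq κ]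
variable {P : Matrix m κ ℝ} {ρ : ℝ}

/-- The matrix `P diag(x) Pᵀ + ρ I`. -/
def weightedGram (P : Matrix m κ ℝ) (ρ : ℝ) (x : κ → ℝ) : Matrix m m ℝ :=
  P * diagonal x * Pᵀ + ρ • (1 : Matrix m m ℝ)

lemma isHermitian_mul_diagonal_mul (P : Matrix m κ ℝ) (x : κ → ℝ) :
    (P * diagonal x * Pᵀ).IsHermitian := by
  have := isHermitian_transpose_mul_mul (isHermitian_diagonal x) Pᵀ
  rwa [transpose_transpose] at this

lemma posSemidef_mul_diagonal_mul (P : Matrix m κ ℝ) {x : κ → ℝ} (hx : ∀ l, 0 ≤ x l) :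
    (P * diagonal x * Pᵀ).PosSemidef := by
  have := (posSemidef_diagonal_iff.2 hx).mul_mul_conjTranspose_same P
  rwa [conjTranspose_eq_transpose_of_trivial] at this

lemma posDef_gram (hρ : 0 < ρ) {x : κ → ℝ} (hx : ∀ l, 0 ≤ x l) : (weightedGram P ρ x).PosDef :=
  (PosDef.one.smul hρ).posSemidef_add (posSemidef_mul_diagonal_mul P hx)

lemma conj_mul_diagonal_apply (W : Matrix m m ℝ) (x : κ → ℝ) (k : m) :
    (Wᵀ * (P * diagonal x * Pᵀ) * W) k k = ∑ l, (Wᵀ * P) k l ^ 2 * x l := by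
  have : Wᵀ * (P * diagonal x * Pᵀ) * W = (Wᵀ * P) * diagonal x * (Wᵀ * P)ᵀ := by
    rw [transpose_mul, transpose_transpose]
    simp only [Matrix.mul_assoc]
  rw [this, mul_apply]
  refine Finset.sum_congr rfl fun l _ => ?_
  rw [mul_diagonal, transpose_apply]
  ring

variable {W : Matrix m m ℝ}

lemma trace_inv_gram_mul {M : Matrix m m ℝ} (hW : Wᵀ * M * W = 1) (x : κ → ℝ) :
    (M⁻¹ * (P * diagonal x * Pᵀ)).trace = ∑ k, ∑ l, (Wᵀ * P) k l ^ 2 * x l := by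
  rw [trace_inv_mul_frame hW]
  exact Finset.sum_congr rfl fun k _ => conj_mul_diagonal_apply W x k

lemma conj_gram_apply (W : Matrix m m ℝ) (x : κ → ℝ) (k : m) :
    (Wᵀ * weightedGram P ρ x * W) k k = ∑ l, (Wᵀ * P) k l ^ 2 * x l + ρ * (Wᵀ * W) k k := by
  rw [weightedGram, Matrix.mul_add, Matrix.add_mul, Matrix.add_apply, conj_mul_diagonal_apply]
  simp

/-- In a frame whitening the Gram matrix at x = 1, the numbers (WᵀP)²_{kl} together with ρ(WᵀW)_{kk}
form a probability vector. The diagonal entries at a general x are therefore averages of the weights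
x_l and of the value 1. -/
lemma frame_weights (hW : Wᵀ * weightedGram P ρ (fun _ => 1) * W = 1) (k : m) :
    ∑ l, (Wᵀ * P) k l ^ 2 + ρ * (Wᵀ * W) k k = 1 := by
  have := conj_gram_apply (P := P) (ρ := ρ) W (fun _ => 1) k
  rw [hW, one_apply_eq] at this
  simpa using this.symm

lemma frame_norm_nonneg (W : Matrix m m ℝ) (k : m) : 0 ≤ (Wᵀ * W) k k := by
  have := posSemidef_conjTranspose_mul_self W
  rw [conjTranspose_eq_transpose_of_trivial] at this
  exact this.diag_nonneg

lemma frame_weights_le (hρ : 0 < ρ) (hW : Wᵀ * weightedGram P ρ (fun _ => 1) * W = 1) (k : m) :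
    ∑ l, (Wᵀ * P) k l ^ 2 ≤ 1 := by
  have := frame_weights hW k
  nlinarith [frame_norm_nonneg W k]

/-- Conjugating M ⪯ τI by W gives I ⪯ τWᵀW. It bounds below by ρ/τ the mass that ρI places at the
value 1. -/
lemma one_le_frame_norm {M : Matrix m m ℝ} {τ : ℝ} (hM : (τ • (1 : Matrix m m ℝ) - M).PosSemidef)
    (hW : Wᵀ * M * W = 1) (k : m) : 1 ≤ τ * (Wᵀ * W) k k := by
  have h1 := (hM.conjTranspose_mul_mul_same W).diag_nonneg (i := k)
  rw [conjTranspose_eq_transpose_of_trivial, Matrix.mul_sub, Matrix.sub_mul, hW] at h1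
  simpa using h1

/-- Strong concavity of `log det` along the directions `σ` that are logarithmic in the target
weights `x`, up to the quadratic term. -/
lemma trace_add_trace_le_log_det_sub {x σ e : κ → ℝ} {τ b s R : ℝ} (hρ : 0 < ρ)
    (hτ : (τ • (1 : Matrix m m ℝ) - weightedGram P ρ (fun _ => 1)).PosSemidef) (hτ0 : 0 < τ) (hb : 1 ≤ b)
    (hs : s = ρ / τ / (8 * b ^ 2)) (hR : R = 2 - Real.log (ρ / τ))
    (hx : ∀ l, (e l = 0 ∧ 0 < x l ∧ x l ≤ b ∧ σ l = Real.log (x l) + s * (x l - 1) ^ 2) ∨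
      (e l = 1 ∧ x l = 0 ∧ σ l = -R)) :
    ((weightedGram P ρ (fun _ => 1))⁻¹ * (P * diagonal σ * Pᵀ)).trace +
        ((weightedGram P ρ (fun _ => 1))⁻¹ * (P * diagonal e * Pᵀ)).trace ≤
      Real.log (weightedGram P ρ x).det - Real.log (weightedGram P ρ (fun _ => 1)).det := by
  have hx0 : ∀ l, 0 ≤ x l := fun l => by
    rcases hx l with h | h
    · exact h.2.1.le
    · exact h.2.1.ge
  have hM : (weightedGram P ρ (fun _ => 1)).PosDef := posDef_gram hρ fun _ => zero_le_one
  have hN : (weightedGram P ρ x).PosDef := posDef_gram hρ hx0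
  obtain ⟨W, ν, hW, hν⟩ := exists_simul_diag hM hN.1
  rw [log_det_diag hM hW hν ((posDef_iff_frame hW hν).1 hN), trace_inv_gram_mul hW,
    trace_inv_gram_mul hW, add_sub_cancel_left, ← Finset.sum_add_distrib]
  refine Finset.sum_le_sum fun k _ => ?_
  rw [← Finset.sum_add_distrib]
  simp only [← mul_add]
  -- The inequality reduces to one scalar Jensen inequality for each eigenvalue ν_k, with the frame
  -- weights as probabilities.
  refine sum_le_log_of_jensen (w₀ := ρ * (Wᵀ * W) k k) (w₁ := ρ / τ) (fun l => sq_nonneg _)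
    (frame_weights hW k) (by positivity) ?_ hb hs hR ?_ hx
  · rw [div_eq_mul_inv]
    refine mul_le_mul_of_nonneg_left ?_ hρ.le
    rw [inv_le_iff_one_le_mul₀' hτ0]
    exact one_le_frame_norm hτ hW k
  · rw [← conj_gram_apply, hν, diagonal_apply_eq]

/-- A second-order upper bound for `-log det` along bounded weight perturbations. -/
lemma neg_log_det_sub_le {σ : κ → ℝ} {Θ t : ℝ} (hρ : 0 < ρ) (hΘ : 0 ≤ Θ) (hσ : ∀ l, |σ l| ≤ Θ) (ht : 0 ≤ t)
    (htΘ : t * Θ ≤ 1 / 2) :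
    (weightedGram P ρ (fun _ => 1) - t • (P * diagonal σ * Pᵀ)).PosDef ∧
    -Real.log (weightedGram P ρ (fun _ => 1) - t • (P * diagonal σ * Pᵀ)).det +
        Real.log (weightedGram P ρ (fun _ => 1)).det -
        t * ((weightedGram P ρ (fun _ => 1))⁻¹ * (P * diagonal σ * Pᵀ)).trace ≤
      2 * t ^ 2 * ((weightedGram P ρ (fun _ => 1))⁻¹ * (P * diagonal (fun l => σ l ^ 2) * Pᵀ)).trace := by
  have hM : (weightedGram P ρ (fun _ => 1)).PosDef := posDef_gram hρ fun _ => zero_le_one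
  obtain ⟨W, θ, hW, hθ⟩ := exists_simul_diag hM (isHermitian_mul_diagonal_mul P σ)
  set T := P * diagonal σ * Pᵀ with hT
  have hMt : Wᵀ * (weightedGram P ρ (fun _ => 1) - t • T) * W = diagonal (fun k => 1 - t * θ k) := by
    rw [Matrix.mul_sub, Matrix.sub_mul, hW, Matrix.mul_smul, Matrix.smul_mul, hθ, ← diagonal_one,
      ← diagonal_smul, diagonal_sub]
    rfl
  have hθe : ∀ k, θ k = ∑ l, (Wᵀ * P) k l ^ 2 * σ l := fun k => by
    rw [← conj_mul_diagonal_apply, ← hT, hθ, diagonal_apply_eq]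
  have hwle := fun k => frame_weights_le hρ hW k
  have hθle : ∀ k, |θ k| ≤ Θ := by
    intro k
    rw [hθe k]
    refine (Finset.abs_sum_le_sum_abs _ _).trans ?_
    calc ∑ l, |(Wᵀ * P) k l ^ 2 * σ l| ≤ ∑ l, (Wᵀ * P) k l ^ 2 * Θ := by
            refine Finset.sum_le_sum fun l _ => ?_
            rw [abs_mul, abs_of_nonneg (sq_nonneg _)]
            exact mul_le_mul_of_nonneg_left (hσ l) (sq_nonneg _)
        _ = (∑ l, (Wᵀ * P) k l ^ 2) * Θ := by rw [Finset.sum_mul]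
        _ ≤ Θ := mul_le_of_le_one_left hΘ (hwle k)
  have hsmall : ∀ k, |t * θ k| ≤ 1 / 2 := fun k => by
    rw [abs_mul, abs_of_nonneg ht]
    exact (mul_le_mul_of_nonneg_left (hθle k) ht).trans htΘ
  have hpos : ∀ k, 0 < 1 - t * θ k := fun k => by linarith [(abs_le.1 (hsmall k)).2]
  refine ⟨(posDef_iff_frame hW hMt).2 hpos, ?_⟩
  rw [log_det_diag hM hW hMt hpos, trace_inv_mul_diag hW hθ, trace_inv_gram_mul hW]
  -- Cauchy–Schwarz with frame weights of total mass at most 1.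
  have hsq : ∀ k, θ k ^ 2 ≤ ∑ l, (Wᵀ * P) k l ^ 2 * σ l ^ 2 := by
    intro k
    have h1 := Finset.sum_mul_sq_le_sq_mul_sq Finset.univ (fun l => (Wᵀ * P) k l)
      (fun l => (Wᵀ * P) k l * σ l)
    have h2 : ∑ l, (Wᵀ * P) k l * ((Wᵀ * P) k l * σ l) = θ k := by
      rw [hθe k]
      exact Finset.sum_congr rfl fun l _ => by ring
    have h3 : ∑ l, ((Wᵀ * P) k l * σ l) ^ 2 = ∑ l, (Wᵀ * P) k l ^ 2 * σ l ^ 2 :=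
      Finset.sum_congr rfl fun l _ => by ring
    rw [h2, h3] at h1
    exact h1.trans (mul_le_of_le_one_left
      (Finset.sum_nonneg fun l _ => by positivity) (hwle k))
  calc -(Real.log (weightedGram P ρ (fun _ => 1)).det + ∑ k, Real.log (1 - t * θ k)) +
        Real.log (weightedGram P ρ (fun _ => 1)).det - t * ∑ k, θ k
      = ∑ k, (-Real.log (1 - t * θ k) - t * θ k) := by
        rw [Finset.sum_sub_distrib, Finset.sum_neg_distrib, Finset.mul_sum]
        ring
    _ ≤ ∑ k, 2 * (t * θ k) ^ 2 := Finset.sum_le_sum fun k _ => neg_log_one_sub_le (hsmall k)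
    _ ≤ ∑ k, 2 * t ^ 2 * ∑ l, (Wᵀ * P) k l ^ 2 * σ l ^ 2 := by
        refine Finset.sum_le_sum fun k _ => ?_
        rw [mul_pow, ← mul_assoc]
        exact mul_le_mul_of_nonneg_left (hsq k) (by positivity)
    _ = _ := by rw [Finset.mul_sum]

lemma trace_inv_gram_mul_nonneg {x : κ → ℝ} (hρ : 0 < ρ) (hx : ∀ l, 0 ≤ x l) :
    0 ≤ ((weightedGram P ρ (fun _ => 1))⁻¹ * (P * diagonal x * Pᵀ)).trace := by
  have hM : (weightedGram P ρ (fun _ => 1)).PosDef := posDef_gram hρ fun _ => zero_le_one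
  obtain ⟨W, θ, hW, hθ⟩ := exists_simul_diag hM hM.1
  rw [trace_inv_gram_mul hW]
  exact Finset.sum_nonneg fun k _ => Finset.sum_nonneg fun l _ => mul_nonneg (sq_nonneg _) (hx l)

/-- Each frame weight is at most 1, so the y-part is bounded crudely by a plain sum. The e-part is
kept as a trace, since the gain controls the free blocks only through that trace. -/
lemma trace_inv_gram_mul_le {x y e : κ → ℝ} {q : ℝ} (hρ : 0 < ρ) (hy : ∀ l, 0 ≤ y l)
    (hx : ∀ l, x l ≤ y l + q * e l) :
    ((weightedGram P ρ (fun _ => 1))⁻¹ * (P * diagonal x * Pᵀ)).trace ≤ Fintype.card m * ∑ l, y l +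
      q * ((weightedGram P ρ (fun _ => 1))⁻¹ * (P * diagonal e * Pᵀ)).trace := by
  have hM : (weightedGram P ρ (fun _ => 1)).PosDef := posDef_gram hρ fun _ => zero_le_one
  obtain ⟨W, θ, hW, hθ⟩ := exists_simul_diag hM hM.1
  have hcard : (Fintype.card m : ℝ) * ∑ l, y l = ∑ _k : m, ∑ l, y l := by simp
  rw [trace_inv_gram_mul hW, trace_inv_gram_mul hW, hcard, Finset.mul_sum,
    ← Finset.sum_add_distrib]
  refine Finset.sum_le_sum fun k _ => ?_
  rw [Finset.mul_sum, ← Finset.sum_add_distrib]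
  refine Finset.sum_le_sum fun l _ => ?_
  have h1 : (Wᵀ * P) k l ^ 2 ≤ 1 :=
    (Finset.single_le_sum (f := fun l => (Wᵀ * P) k l ^ 2) (fun l _ => sq_nonneg _)
      (Finset.mem_univ l)).trans (frame_weights_le hρ hW k)
  have h2 := mul_le_mul_of_nonneg_left (hx l) (sq_nonneg ((Wᵀ * P) k l))
  have h3 := mul_le_mul_of_nonneg_right h1 (hy l)
  nlinarith

end Gram

end LogDet

/-! ### Matrix factorizations, Frobenius norms, and an error bound for faces of {0 ⪯ X ⪯ C} -/

namespace LogDet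

open Matrix

variable {ι κ : Type*} [Fintype ι] [DecidableEq ι] [Fintype κ] [DecidableEq κ]
variable {X Y C Q M N : Matrix ι ι ℝ}

/-- Simultaneous diagonalization read backwards, with L the inverse transpose of the frame W. -/
lemma exists_factor_of_posDef (hX : X.PosDef) (hY : Y.IsHermitian) :
    ∃ (L : Matrix ι ι ℝ) (x : ι → ℝ), IsUnit L.det ∧ X = L * Lᵀ ∧ Y = L * diagonal x * Lᵀ := by
  obtain ⟨W, x, hW, hx⟩ := exists_simul_diag hX hY
  have hu : IsUnit W.det := (isUnit_iff_isUnit_det _).1 (isUnit_frame hW)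
  have h1 : Wᵀ⁻¹ * Wᵀ = 1 := nonsing_inv_mul _ (by rwa [det_transpose])
  have h2 : W * W⁻¹ = 1 := mul_nonsing_inv _ hu
  have key : ∀ Z : Matrix ι ι ℝ, Z = Wᵀ⁻¹ * (Wᵀ * Z * W) * W⁻¹ := fun Z => by
    calc Z = (Wᵀ⁻¹ * Wᵀ) * Z * (W * W⁻¹) := by rw [h1, h2, Matrix.one_mul, Matrix.mul_one]
      _ = _ := by simp only [Matrix.mul_assoc]
  have hT : (Wᵀ⁻¹)ᵀ = W⁻¹ := by rw [transpose_nonsing_inv, transpose_transpose]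
  refine ⟨Wᵀ⁻¹, x, ?_, ?_, ?_⟩
  · rw [det_nonsing_inv, det_transpose]
    exact hu.ringInverse
  · rw [hT]
    conv_lhs => rw [key X, hW, Matrix.mul_one]
  · rw [hT]
    conv_lhs => rw [key Y, hx]

lemma exists_factor_of_posSemidef (hX : X.PosSemidef) : ∃ L : Matrix ι ι ℝ, X = L * Lᵀ := by
  obtain ⟨U, x, hU, hU', hX'⟩ := exists_orthogonal_diag hX.1
  have hx : ∀ l, 0 ≤ x l := by
    have h1 := hX.conjTranspose_mul_mul_same U
    have h2 : Uᴴ * X * U = diagonal x := by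
      rw [conjTranspose_eq_transpose_of_trivial, hX']
      calc Uᵀ * (U * diagonal x * Uᵀ) * U = (Uᵀ * U) * diagonal x * (Uᵀ * U) := by
            simp only [Matrix.mul_assoc]
        _ = _ := by simp [hU]
    rw [h2] at h1
    exact posSemidef_diagonal_iff.1 h1
  refine ⟨U * diagonal fun l => √(x l), ?_⟩
  rw [transpose_mul, diagonal_transpose]
  calc X = U * diagonal x * Uᵀ := hX'
    _ = U * (diagonal (fun l => √(x l)) * diagonal fun l => √(x l)) * Uᵀ := by
      rw [diagonal_mul_diagonal]
      simp only [Real.mul_self_sqrt (hx _)]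
    _ = _ := by simp only [Matrix.mul_assoc]

lemma posSemidef_mul_mul_transpose (hX : X.PosSemidef) (A : Matrix κ ι ℝ) :
    (A * X * Aᵀ).PosSemidef := by
  have := hX.mul_mul_conjTranspose_same A
  rwa [conjTranspose_eq_transpose_of_trivial] at this

lemma posSemidef_factor_iff {L : Matrix ι ι ℝ} (hL : IsUnit L.det) {x : ι → ℝ} :
    (L * diagonal x * Lᵀ).PosSemidef ↔ ∀ l, 0 ≤ x l := by
  have := (Matrix.IsUnit.posSemidef_star_right_conjugate_iff (x := diagonal x)
    ((isUnit_iff_isUnit_det L).2 hL))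
  rw [star_eq_conjTranspose, conjTranspose_eq_transpose_of_trivial] at this
  rw [this, posSemidef_diagonal_iff]

lemma exists_smul_one_sub_posSemidef (hM : M.IsHermitian) :
    ∃ τ : ℝ, 0 < τ ∧ ∀ t, τ ≤ t → (t • (1 : Matrix ι ι ℝ) - M).PosSemidef := by
  obtain ⟨U, x, hU, hU', hX'⟩ := exists_orthogonal_diag hM
  refine ⟨∑ l, |x l| + 1, add_pos_of_nonneg_of_pos (Finset.sum_nonneg fun l _ => abs_nonneg _)
    one_pos, fun t ht => ?_⟩
  have h1 : t • (1 : Matrix ι ι ℝ) - M = U * diagonal (fun l => t - x l) * Uᵀ := by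
    have : diagonal (fun l => t - x l) = t • (1 : Matrix ι ι ℝ) - diagonal x := by
      rw [smul_one_eq_diagonal, diagonal_sub]
    rw [this, Matrix.mul_sub, Matrix.sub_mul, ← hX', Matrix.mul_smul, Matrix.mul_one,
      Matrix.smul_mul, hU']
  rw [h1]
  refine posSemidef_mul_diagonal_mul U fun l => ?_
  have := Finset.single_le_sum (f := fun l => |x l|) (fun l _ => abs_nonneg _) (Finset.mem_univ l)
  have h3 := le_abs_self (x l)
  linarith

lemma exists_smul_sub_posSemidef (hX : X.PosDef) (hN : N.IsHermitian) :
    ∃ b : ℝ, 0 < b ∧ ∀ t, b ≤ t → (t • X - N).PosSemidef := by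
  obtain ⟨L, x, hL, hX', hN'⟩ := exists_factor_of_posDef hX hN
  refine ⟨∑ l, |x l| + 1, add_pos_of_nonneg_of_pos (Finset.sum_nonneg fun l _ => abs_nonneg _)
    one_pos, fun t ht => ?_⟩
  have h1 : t • X - N = L * diagonal (fun l => t - x l) * Lᵀ := by
    have : diagonal (fun l => t - x l) = t • (1 : Matrix ι ι ℝ) - diagonal x := by
      rw [smul_one_eq_diagonal, diagonal_sub]
    rw [this, Matrix.mul_sub, Matrix.sub_mul, ← hN', Matrix.mul_smul, Matrix.mul_one,
      Matrix.smul_mul, hX']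
  rw [h1]
  refine posSemidef_mul_diagonal_mul L fun l => ?_
  have := Finset.single_le_sum (f := fun l => |x l|) (fun l _ => abs_nonneg _) (Finset.mem_univ l)
  have h3 := le_abs_self (x l)
  linarith

/-- The squared Frobenius norm. -/
def frobSq {m n : Type*} [Fintype m] [Fintype n] (X : Matrix m n ℝ) : ℝ := ∑ a, ∑ b, X a b ^ 2

section FrobSq

variable {m n o : Type*} [Fintype m] [Fintype n] [Fintype o]

lemma frobSq_nonneg (X : Matrix m n ℝ) : 0 ≤ frobSq X :=
  Finset.sum_nonneg fun _ _ => Finset.sum_nonneg fun _ _ => sq_nonneg _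

lemma frobSq_eq_trace (X : Matrix m n ℝ) : frobSq X = (X * Xᵀ).trace := by
  simp [frobSq, trace, mul_apply, sq]

lemma frobSq_transpose (X : Matrix m n ℝ) : frobSq Xᵀ = frobSq X := by
  rw [frobSq, Finset.sum_comm]
  rfl

lemma frobSq_mul_le (X : Matrix m n ℝ) (Y : Matrix n o ℝ) :
    frobSq (X * Y) ≤ frobSq X * frobSq Y := by
  rw [← frobSq_transpose Y]
  unfold frobSq
  rw [Finset.sum_mul_sum]
  refine Finset.sum_le_sum fun a _ => Finset.sum_le_sum fun b _ => ?_
  rw [mul_apply]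
  exact Finset.sum_mul_sq_le_sq_mul_sq _ _ _

lemma frobSq_diagonal [DecidableEq n] (x : n → ℝ) : frobSq (diagonal x) = ∑ l, x l ^ 2 := by
  simp [frobSq_eq_trace, trace, sq]

lemma frobSq_mul_diagonal_mul_le [DecidableEq n] (L : Matrix m n ℝ) (x : n → ℝ) :
    frobSq (L * diagonal x * Lᵀ) ≤ (L * Lᵀ).trace ^ 2 * ∑ l, x l ^ 2 := by
  refine (frobSq_mul_le _ _).trans ?_
  rw [frobSq_transpose, ← frobSq_diagonal, ← frobSq_eq_trace]
  have := mul_le_mul_of_nonneg_right (frobSq_mul_le L (diagonal x)) (frobSq_nonneg L)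
  linarith

end FrobSq

lemma trace_le_of_sub_posSemidef (h : (C - X).PosSemidef) : X.trace ≤ C.trace := by
  have := h.trace_nonneg
  rw [trace_sub] at this
  linarith

lemma frobSq_le_of_posSemidef (hX : X.PosSemidef) : frobSq X ≤ X.trace ^ 2 := by
  obtain ⟨L, rfl⟩ := exists_factor_of_posSemidef hX
  refine (frobSq_mul_le _ _).trans ?_
  rw [frobSq_transpose, ← frobSq_eq_trace, sq]

lemma trace_mul_nonneg (hQ : Q.PosSemidef) (hX : X.PosSemidef) : 0 ≤ (Q * X).trace := by
  obtain ⟨L, rfl⟩ := exists_factor_of_posSemidef hX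
  have h1 := (hQ.conjTranspose_mul_mul_same L).trace_nonneg
  rwa [conjTranspose_eq_transpose_of_trivial, trace_mul_comm, ← Matrix.mul_assoc,
    trace_mul_comm] at h1

/-- M ⪯ τI means I ⪯ τM⁻¹; pair this with X ⪰ 0. -/
lemma trace_le_smul_trace_inv_mul {τ : ℝ} (hM : M.PosDef)
    (hτ : (τ • (1 : Matrix ι ι ℝ) - M).PosSemidef) (hX : X.PosSemidef) :
    X.trace ≤ τ * (M⁻¹ * X).trace := by
  obtain ⟨U, x, hU, hU', hMx⟩ := exists_orthogonal_diag hM.1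
  have hconj : ∀ Z : Matrix ι ι ℝ, U * (Uᵀ * Z * U) * Uᵀ = Z := fun Z => by
    calc U * (Uᵀ * Z * U) * Uᵀ = (U * Uᵀ) * Z * (U * Uᵀ) := by simp only [Matrix.mul_assoc]
      _ = Z := by rw [hU', Matrix.one_mul, Matrix.mul_one]
  have hUu : IsUnit U.det := (isUnit_iff_isUnit_det U).1 ⟨⟨U, Uᵀ, hU', hU⟩, rfl⟩
  have hx : ∀ l, 0 ≤ τ - x l := by
    rw [← posSemidef_factor_iff hUu]
    convert! hτ using 1
    rw [← diagonal_sub, ← smul_one_eq_diagonal, Matrix.mul_sub, Matrix.sub_mul, ← hMx,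
      Matrix.mul_smul, Matrix.mul_one, Matrix.smul_mul, hU']
  have hx0 : ∀ l, 0 < x l := by
    have h1 := (Matrix.IsUnit.posDef_star_right_conjugate_iff (x := diagonal x)
      ((isUnit_iff_isUnit_det U).2 hUu))
    rw [star_eq_conjTranspose, conjTranspose_eq_transpose_of_trivial, ← hMx,
      posDef_diagonal_iff] at h1
    exact h1.1 hM
  have hinv : M⁻¹ = U * diagonal (fun l => (x l)⁻¹) * Uᵀ := by
    refine inv_eq_left_inv ?_
    calc U * diagonal (fun l => (x l)⁻¹) * Uᵀ * M
        = U * (diagonal (fun l => (x l)⁻¹) * (Uᵀ * U) * diagonal x) * Uᵀ := by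
          rw [hMx]
          simp only [Matrix.mul_assoc]
      _ = 1 := by
          rw [hU, Matrix.mul_one, diagonal_mul_diagonal]
          simp only [inv_mul_cancel₀ (hx0 _).ne', diagonal_one, Matrix.mul_one, hU']
  have hpsd : (τ • M⁻¹ - 1).PosSemidef := by
    have : τ • M⁻¹ - 1 = U * diagonal (fun l => τ * (x l)⁻¹ - 1) * Uᵀ := by
      rw [← diagonal_sub, diagonal_one, Matrix.mul_sub, Matrix.sub_mul, Matrix.mul_one, hU', hinv]
      congr 1
      rw [← Matrix.smul_mul, ← Matrix.mul_smul, ← diagonal_smul]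
      rfl
    rw [this]
    refine posSemidef_mul_diagonal_mul U fun l => ?_
    rw [← div_eq_mul_inv, sub_nonneg, one_le_div (hx0 l)]
    linarith [hx l]
  have := trace_mul_nonneg hpsd hX
  rw [Matrix.sub_mul, trace_sub, Matrix.one_mul, Matrix.smul_mul, trace_smul, smul_eq_mul] at this
  linarith

/-- With X = KKᵀ the trace is the squared Frobenius norm of RK. -/
lemma mul_eq_zero_of_trace_eq_zero {R : Matrix κ ι ℝ} (hX : X.PosSemidef)
    (h : (R * X * Rᵀ).trace ≤ 0) : R * X = 0 := by
  obtain ⟨K, rfl⟩ := exists_factor_of_posSemidef hX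
  have h1 : R * (K * Kᵀ) * Rᵀ = (R * K) * (R * K)ᴴ := by
    rw [conjTranspose_eq_transpose_of_trivial, transpose_mul]
    simp only [Matrix.mul_assoc]
  rw [h1] at h
  have h2 := trace_mul_conjTranspose_self_eq_zero_iff.1
    (le_antisymm h (posSemidef_self_mul_conjTranspose (R * K)).trace_nonneg)
  rw [← Matrix.mul_assoc, h2, Matrix.zero_mul]

/-- Factorization of the order interval below a positive semidefinite matrix. -/
lemma exists_interval_factor (hC : C.PosSemidef) :
    ∃ L K : Matrix ι ι ℝ, C = L * Lᵀ ∧ ∀ X : Matrix ι ι ℝ, X.PosSemidef → (C - X).PosSemidef →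
      X = L * (K * X * Kᵀ) * Lᵀ ∧ (1 - K * X * Kᵀ).PosSemidef := by
  obtain ⟨U, c, hU, hU', hCc⟩ := exists_orthogonal_diag hC.1
  have hUu : IsUnit U.det := (isUnit_iff_isUnit_det U).1 ⟨⟨U, Uᵀ, hU', hU⟩, rfl⟩
  have hc : ∀ l, 0 ≤ c l := by rwa [← posSemidef_factor_iff hUu, ← hCc]
  have hUdU : ∀ x y : ι → ℝ, diagonal x * Uᵀ * (U * diagonal y) = diagonal fun l => x l * y l :=
    fun x y => by
      calc diagonal x * Uᵀ * (U * diagonal y) = diagonal x * (Uᵀ * U) * diagonal y := by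
            simp only [Matrix.mul_assoc]
        _ = _ := by rw [hU, Matrix.mul_one, diagonal_mul_diagonal]
  -- C may be singular: since 0⁻¹ = 0, the second matrix is a pseudoinverse of the first.
  refine ⟨U * diagonal fun l => √(c l), (diagonal fun l => (√(c l))⁻¹) * Uᵀ, ?_, ?_⟩
  · rw [transpose_mul, diagonal_transpose]
    calc C = U * diagonal c * Uᵀ := hCc
      _ = U * (diagonal (fun l => √(c l)) * diagonal fun l => √(c l)) * Uᵀ := by
        rw [diagonal_mul_diagonal]
        simp only [Real.mul_self_sqrt (hc _)]
      _ = _ := by simp only [Matrix.mul_assoc]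
  · intro X hX hCX
    -- r is the 0/1 indicator of c ≠ 0, so U diag(r) Uᵀ projects onto the range of C. As 0 ⪯ X ⪯ C,
    -- the complementary R annihilates X because it annihilates C.
    set r : ι → ℝ := fun l => √(c l) * (√(c l))⁻¹ with hr
    set R : Matrix ι ι ℝ := (diagonal fun l => 1 - r l) * Uᵀ with hR
    have hRC : R * C * Rᵀ = 0 := by
      have hrc : ∀ l, (1 - r l) * c l * (1 - r l) = 0 := fun l => by
        rcases (hc l).eq_or_lt with h | h
        · simp [← h]
        · have h1 := Real.sqrt_pos.2 h
          simp [hr, mul_inv_cancel₀ h1.ne']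
      rw [hR, transpose_mul, diagonal_transpose, transpose_transpose, hCc]
      calc _ = (diagonal fun l => 1 - r l) * (Uᵀ * U) * diagonal c * (Uᵀ * U) *
            (diagonal fun l => 1 - r l) := by simp only [Matrix.mul_assoc]
        _ = _ := by
          rw [hU, Matrix.mul_one, Matrix.mul_one, diagonal_mul_diagonal, diagonal_mul_diagonal]
          simp only [hrc, diagonal_zero]
    have hRX : R * X = 0 := by
      refine mul_eq_zero_of_trace_eq_zero hX ?_
      have := (posSemidef_mul_mul_transpose hCX R).trace_nonneg
      rw [Matrix.mul_sub, Matrix.sub_mul, hRC, trace_sub, trace_zero] at this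
      linarith
    have hPX : U * diagonal r * Uᵀ * X = X := by
      have h1 : U * diagonal r * Uᵀ = 1 - U * R := by
        rw [hR, ← diagonal_sub, diagonal_one, Matrix.sub_mul, Matrix.mul_sub, Matrix.one_mul, hU']
        simp only [Matrix.mul_assoc]
        abel
      rw [h1, Matrix.sub_mul, Matrix.one_mul, Matrix.mul_assoc, hRX, Matrix.mul_zero, sub_zero]
    have hXP : X * (U * diagonal r * Uᵀ) = X := by
      have h1 := congrArg transpose hPX
      have h2 : Xᵀ = X := by
        rw [← conjTranspose_eq_transpose_of_trivial]
        exact hX.1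
      simp only [transpose_mul, transpose_transpose, diagonal_transpose, h2] at h1
      rw [← Matrix.mul_assoc] at h1
      simpa only [Matrix.mul_assoc] using h1
    have hLK : U * (diagonal fun l => √(c l)) * ((diagonal fun l => (√(c l))⁻¹) * Uᵀ) =
        U * diagonal r * Uᵀ := by
      calc _ = U * ((diagonal fun l => √(c l)) * (diagonal fun l => (√(c l))⁻¹)) * Uᵀ := by
            simp only [Matrix.mul_assoc]
        _ = _ := by rw [diagonal_mul_diagonal]
    set L := U * diagonal fun l => √(c l) with hL
    set K := (diagonal fun l => (√(c l))⁻¹) * Uᵀ with hK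
    have hKL : Kᵀ * Lᵀ = U * diagonal r * Uᵀ := by
      rw [← transpose_mul, hLK, transpose_mul, transpose_mul, diagonal_transpose,
        transpose_transpose]
      simp only [Matrix.mul_assoc]
    refine ⟨?_, ?_⟩
    · calc X = (U * diagonal r * Uᵀ) * X * (U * diagonal r * Uᵀ) := by rw [hPX, hXP]
        _ = (L * K) * X * (Kᵀ * Lᵀ) := by rw [hLK, hKL]
        _ = _ := by simp only [Matrix.mul_assoc]
    · have h1 : K * C * Kᵀ = diagonal fun l => (√(c l))⁻¹ * c l * (√(c l))⁻¹ := by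
        rw [hK, transpose_mul, diagonal_transpose, transpose_transpose, hCc]
        calc _ = (diagonal fun l => (√(c l))⁻¹) * (Uᵀ * U) * diagonal c * (Uᵀ * U) *
              (diagonal fun l => (√(c l))⁻¹) := by simp only [Matrix.mul_assoc]
          _ = _ := by
            rw [hU, Matrix.mul_one, Matrix.mul_one, diagonal_mul_diagonal, diagonal_mul_diagonal]
      have h2 : (1 - K * C * Kᵀ).PosSemidef := by
        rw [h1, ← diagonal_one, diagonal_sub, posSemidef_diagonal_iff]
        intro l
        rcases (hc l).eq_or_lt with h | h
        · simp [← h]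
        · have h3 := Real.sqrt_pos.2 h
          have h4 := Real.mul_self_sqrt h.le
          have h5 : (√(c l))⁻¹ * c l * (√(c l))⁻¹ = 1 := by
            field_simp
            nlinarith
          rw [h5, sub_self]
      have h3 := h2.add (posSemidef_mul_mul_transpose hCX K)
      convert! h3 using 1
      rw [Matrix.mul_sub, Matrix.sub_mul]
      abel

/-- A quadratic error bound for the face of `{0 ⪯ X ⪯ C}` exposed by a positive semidefinite
matrix. -/
lemma exists_error_bound (hC : C.PosSemidef) (hQ : Q.PosSemidef) :
    ∃ K : ℝ, 0 ≤ K ∧ ∀ X : Matrix ι ι ℝ, X.PosSemidef → (C - X).PosSemidef →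
      ∃ Z : Matrix ι ι ℝ, Z.PosSemidef ∧ (C - Z).PosSemidef ∧ (Q * Z).trace = 0 ∧
        frobSq (X - Z) ≤ K * (Q * X).trace := by
  obtain ⟨L, K, hCL, hLK⟩ := exists_interval_factor hC
  -- With G = LV the interval becomes {G S Gᵀ : 0 ⪯ S ⪯ I}, and tr(QX) becomes the weighted sum ∑
  -- q_l S_ll.
  obtain ⟨V, q, hV, hV', hq⟩ := exists_orthogonal_diag (isHermitian_transpose_mul_mul hQ.1 L)
  have hVu : IsUnit V.det := (isUnit_iff_isUnit_det V).1 ⟨⟨V, Vᵀ, hV', hV⟩, rfl⟩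
  have hq0 : ∀ l, 0 ≤ q l := by
    rw [← posSemidef_factor_iff hVu, ← hq]
    have := posSemidef_mul_mul_transpose hQ Lᵀ
    rwa [transpose_transpose] at this
  set G := L * V with hG
  have hCG : C = G * Gᵀ := by
    calc C = L * (V * Vᵀ) * Lᵀ := by rw [hV', Matrix.mul_one, hCL]
      _ = _ := by rw [hG, transpose_mul]; simp only [Matrix.mul_assoc]
  have hGQ : Gᵀ * Q * G = diagonal q := by
    calc Gᵀ * Q * G = Vᵀ * (Lᵀ * Q * L) * V := by
          rw [hG, transpose_mul]
          simp only [Matrix.mul_assoc]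
      _ = (Vᵀ * V) * diagonal q * (Vᵀ * V) := by
          rw [hq]
          simp only [Matrix.mul_assoc]
      _ = _ := by rw [hV, Matrix.one_mul, Matrix.mul_one]
  have htr : ∀ S : Matrix ι ι ℝ, (Q * (G * S * Gᵀ)).trace = ∑ l, q l * S l l := by
    intro S
    have h1 : (Q * (G * S * Gᵀ)).trace = (Gᵀ * Q * G * S).trace := by
      rw [← Matrix.mul_assoc, trace_mul_comm]
      simp only [Matrix.mul_assoc]
    rw [h1, hGQ]
    simp [trace, diagonal_mul]
  -- Zero eigenvalues contribute nothing since 0⁻¹ = 0; K₀ dominates 1/q_l for every nonzero q_l.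
  set K₀ : ℝ := ∑ l, (q l)⁻¹ with hK₀
  have hK₀0 : 0 ≤ K₀ := Finset.sum_nonneg fun l _ => inv_nonneg.2 (hq0 l)
  refine ⟨frobSq G * frobSq G * (4 * K₀), by have := frobSq_nonneg G; positivity,
    fun X hX hCX => ?_⟩
  obtain ⟨hXL, hK1⟩ := hLK X hX hCX
  set S := Vᵀ * (K * X * Kᵀ) * V with hS
  have hXS : X = G * S * Gᵀ := by
    calc X = L * ((V * Vᵀ) * (K * X * Kᵀ) * (V * Vᵀ)) * Lᵀ := by
          rw [hV', Matrix.one_mul, Matrix.mul_one]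
          exact hXL
      _ = _ := by
          rw [hG, hS, transpose_mul]
          simp only [Matrix.mul_assoc]
  have hS0 : S.PosSemidef := by
    have := posSemidef_mul_mul_transpose (posSemidef_mul_mul_transpose hX K) Vᵀ
    rwa [transpose_transpose] at this
  have hS1 : (1 - S).PosSemidef := by
    have := posSemidef_mul_mul_transpose hK1 Vᵀ
    rw [transpose_transpose, Matrix.mul_sub, Matrix.sub_mul, Matrix.mul_one, hV] at this
    exact this
  have hST : Sᵀ = S := by
    rw [← conjTranspose_eq_transpose_of_trivial]
    exact hS0.1
  -- The approximating point of the face is obtained by deleting the rows and columns of S with q_l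
  -- ≠ 0.
  set r : ι → ℝ := fun l => if q l = 0 then 1 else 0 with hr
  have hR0 : (diagonal r * S * diagonal r).PosSemidef := by
    have := posSemidef_mul_mul_transpose hS0 (diagonal r)
    rwa [diagonal_transpose] at this
  refine ⟨G * (diagonal r * S * diagonal r) * Gᵀ, posSemidef_mul_mul_transpose hR0 G, ?_, ?_, ?_⟩
  · have h1 : (1 - diagonal r * S * diagonal r).PosSemidef := by
      have h2 : (diagonal fun l => 1 - r l * r l).PosSemidef := by
        rw [posSemidef_diagonal_iff]
        intro l
        simp only [hr]
        split_ifs <;> norm_num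
      have h3 := posSemidef_mul_mul_transpose hS1 (diagonal r)
      have h4 := h2.add h3
      rw [← diagonal_sub, ← diagonal_mul_diagonal, diagonal_one, diagonal_transpose,
        Matrix.mul_sub, Matrix.sub_mul, Matrix.mul_one] at h4
      convert! h4 using 1
      abel
    have := posSemidef_mul_mul_transpose h1 G
    rwa [Matrix.mul_sub, Matrix.sub_mul, Matrix.mul_one, ← hCG] at this
  · rw [htr]
    refine Finset.sum_eq_zero fun l _ => ?_
    rw [mul_diagonal, diagonal_mul]
    simp only [hr]
    split_ifs with h <;> simp [h]
  · have h1 : X - G * (diagonal r * S * diagonal r) * Gᵀ =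
        G * (S - diagonal r * S * diagonal r) * Gᵀ := by
      rw [Matrix.mul_sub, Matrix.sub_mul, ← hXS]
    -- S(1 − S)S + (1 − S)S(1 − S) = S − S² is positive semidefinite, so the squared norm of a row
    -- is at most its diagonal entry. Hence the squared error is linear in tr(QX).
    have hSsq : ∀ a, ∑ b, S a b ^ 2 ≤ S a a := by
      intro a
      have h2 : (S - S * S).PosSemidef := by
        have h3 := (posSemidef_mul_mul_transpose hS1 S).add
          (posSemidef_mul_mul_transpose hS0 (1 - S))
        rw [transpose_sub, transpose_one, hST] at h3
        convert! h3 using 1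
        noncomm_ring
      have h3 := h2.diag_nonneg (i := a)
      rw [Matrix.sub_apply, mul_apply, sub_nonneg] at h3
      refine le_trans (le_of_eq (Finset.sum_congr rfl fun b _ => ?_)) h3
      rw [sq]
      congr 1
      exact congrFun (congrFun hST.symm a) b
    have hrb : ∀ a b, (S - diagonal r * S * diagonal r) a b ^ 2 ≤
        (1 - r a) * S a b ^ 2 + (1 - r b) * S a b ^ 2 := by
      intro a b
      rw [Matrix.sub_apply, mul_diagonal, diagonal_mul]
      simp only [hr]
      split_ifs <;> nlinarith [sq_nonneg (S a b)]
    have hle : frobSq (S - diagonal r * S * diagonal r) ≤ 2 * ∑ a, (1 - r a) * S a a := by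
      have hsym : ∑ a, ∑ b, (1 - r b) * S a b ^ 2 = ∑ a, ∑ b, (1 - r a) * S a b ^ 2 := by
        rw [Finset.sum_comm]
        refine Finset.sum_congr rfl fun a _ => Finset.sum_congr rfl fun b _ => ?_
        rw [show S b a = S a b from congrFun (congrFun hST a) b]
      calc frobSq (S - diagonal r * S * diagonal r)
          ≤ ∑ a, ∑ b, ((1 - r a) * S a b ^ 2 + (1 - r b) * S a b ^ 2) :=
            Finset.sum_le_sum fun a _ => Finset.sum_le_sum fun b _ => hrb a b
        _ = 2 * ∑ a, (1 - r a) * ∑ b, S a b ^ 2 := by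
            simp only [Finset.sum_add_distrib, hsym]
            simp only [Finset.mul_sum]
            rw [← Finset.sum_add_distrib]
            refine Finset.sum_congr rfl fun a _ => ?_
            rw [← Finset.sum_add_distrib]
            exact Finset.sum_congr rfl fun b _ => by ring
        _ ≤ _ := by
            refine mul_le_mul_of_nonneg_left (Finset.sum_le_sum fun a _ => ?_) two_pos.le
            refine mul_le_mul_of_nonneg_left (hSsq a) ?_
            simp only [hr]
            split_ifs <;> norm_num
    have hsum : ∑ a, (1 - r a) * S a a ≤ K₀ * ∑ l, q l * S l l := by
      rw [Finset.mul_sum]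
      refine Finset.sum_le_sum fun a _ => ?_
      rw [← mul_assoc]
      refine mul_le_mul_of_nonneg_right ?_ hS0.diag_nonneg
      simp only [hr]
      split_ifs with h
      · simp [h]
      · have h2 := Finset.single_le_sum (f := fun l => (q l)⁻¹)
          (fun l _ => inv_nonneg.2 (hq0 l)) (Finset.mem_univ a)
        have h3 := mul_le_mul_of_nonneg_right h2 (hq0 a)
        rw [inv_mul_cancel₀ h] at h3
        linarith
    have hpos : 0 ≤ ∑ l, q l * S l l :=
      Finset.sum_nonneg fun l _ => mul_nonneg (hq0 l) hS0.diag_nonneg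
    have hfin : frobSq (X - G * (diagonal r * S * diagonal r) * Gᵀ) ≤
        frobSq G * frobSq (S - diagonal r * S * diagonal r) * frobSq G := by
      rw [h1]
      refine (frobSq_mul_le _ _).trans ?_
      rw [frobSq_transpose]
      exact mul_le_mul_of_nonneg_right (frobSq_mul_le _ _) (frobSq_nonneg _)
    rw [hXS, htr, ← hXS]
    have hg := frobSq_nonneg G
    have h5 : frobSq (S - diagonal r * S * diagonal r) ≤ 4 * K₀ * ∑ l, q l * S l l := by
      have : 0 ≤ K₀ * ∑ l, q l * S l l := mul_nonneg hK₀0 hpos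
      linarith
    have h6 := mul_le_mul_of_nonneg_left h5 (mul_nonneg hg hg)
    linarith

end LogDet

/-! ### The Brascamp–Lieb program: blocks, gradients, regularity -/

noncomputable section

namespace BrascampLieb

open Matrix LogDet DCProgram Set

variable {p q : ℕ} {n : Fin p → ℕ} {m : Fin q → ℕ}

section Blocks

lemma block_add (X Y : SymTuple n) (i : Fin p) : block (X + Y) i = block X i + block Y i := by
  ext a b
  simp [block]

lemma block_sub (X Y : SymTuple n) (i : Fin p) : block (X - Y) i = block X i - block Y i := by
  ext a b
  simp [block]

lemma block_smul (c : ℝ) (X : SymTuple n) (i : Fin p) : block (c • X) i = c • block X i := by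
  ext a b
  simp [block]

lemma isHermitian_block (X : SymTuple n) (i : Fin p) : (block X i).IsHermitian := by
  ext a b
  simp only [conjTranspose_apply, star_trivial, block, of_apply]
  exact (X i).2 b a

/-- The tuple with prescribed symmetric blocks. -/
def ofBlocks (f : ∀ i, Matrix (Fin (n i)) (Fin (n i)) ℝ) (hf : ∀ i, (f i).IsHermitian) :
    SymTuple n :=
  WithLp.toLp 2 fun i => ⟨WithLp.toLp 2 fun ab => f i ab.1 ab.2, fun a b => by
    have := congrFun (congrFun (hf i) b) a
    simpa using this⟩

@[simp] lemma block_ofBlocks (f : ∀ i, Matrix (Fin (n i)) (Fin (n i)) ℝ)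
    (hf : ∀ i, (f i).IsHermitian) (i : Fin p) : block (ofBlocks f hf) i = f i := rfl

lemma norm_sq_eq (X : SymTuple n) : ‖X‖ ^ 2 = ∑ i, frobSq (block X i) := by
  rw [PiLp.norm_sq_eq_of_L2]
  refine Finset.sum_congr rfl fun i _ => ?_
  rw [Submodule.coe_norm, EuclideanSpace.norm_sq_eq, Fintype.sum_prod_type]
  refine Finset.sum_congr rfl fun a _ => Finset.sum_congr rfl fun b _ => ?_
  rw [Real.norm_eq_abs, sq_abs]
  rfl

end Blocks

variable (A : ∀ (i : Fin p) (j : Fin q), Matrix (Fin (m j)) (Fin (n i)) ℝ)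

/-- The linear part `∑ᵢ Aᵢⱼ Xᵢ Aᵢⱼᵀ` of the matrices in `h`. -/
def gramLin (j : Fin q) (X : SymTuple n) : Matrix (Fin (m j)) (Fin (m j)) ℝ :=
  ∑ i, A i j * block X i * (A i j)ᵀ

lemma gramLin_add (j : Fin q) (X Y : SymTuple n) :
    gramLin A j (X + Y) = gramLin A j X + gramLin A j Y := by
  simp only [gramLin, block_add, Matrix.mul_add, Matrix.add_mul, Finset.sum_add_distrib]

lemma gramLin_smul (j : Fin q) (c : ℝ) (X : SymTuple n) :
    gramLin A j (c • X) = c • gramLin A j X := by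
  simp only [gramLin, block_smul, Matrix.mul_smul, Matrix.smul_mul, ← Finset.smul_sum]

/-- The matrix `∑ᵢ Aᵢⱼ Xᵢ Aᵢⱼᵀ + ρ I`. -/
def gramMat (ρ : ℝ) (j : Fin q) (X : SymTuple n) : Matrix (Fin (m j)) (Fin (m j)) ℝ :=
  gramLin A j X + ρ • (1 : Matrix (Fin (m j)) (Fin (m j)) ℝ)

lemma isHermitian_mul_mul_transpose {ι κ : Type*} [Fintype ι] {X : Matrix ι ι ℝ}
    (hX : X.IsHermitian) (A : Matrix κ ι ℝ) : (A * X * Aᵀ).IsHermitian := by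
  have := isHermitian_mul_mul_conjTranspose A hX
  rwa [conjTranspose_eq_transpose_of_trivial] at this

lemma isHermitian_sum {ι κ : Type*} (s : Finset ι) {f : ι → Matrix κ κ ℝ}
    (hf : ∀ i, (f i).IsHermitian) : (∑ i ∈ s, f i).IsHermitian := by
  unfold IsHermitian
  rw [conjTranspose_sum]
  exact Finset.sum_congr rfl fun i _ => hf i

lemma isHermitian_gramLin (j : Fin q) (X : SymTuple n) : (gramLin A j X).IsHermitian :=
  isHermitian_sum _ fun i => isHermitian_mul_mul_transpose (isHermitian_block X i) (A i j)

lemma isSymAffine_block : IsSymAffine (fun (i : Fin p) (X : SymTuple n) => block X i)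
    (fun (i : Fin p) (X : SymTuple n) => block X i) where
  add_apply := fun i X V => block_add X V i
  smul_apply := fun i c X => block_smul c X i
  isHermitian := fun i X => isHermitian_block X i

lemma continuous_block (i : Fin p) : Continuous fun X : SymTuple n => block X i :=
  isSymAffine_block.continuous i

lemma isSymAffine_gramMat (ρ : ℝ) : IsSymAffine (gramMat A ρ) (gramLin A) where
  add_apply := fun j X V => by
    rw [gramMat, gramMat, gramLin_add]
    abel
  smul_apply := fun j c X => gramLin_smul A j c X
  isHermitian := fun j X => by
    refine (isHermitian_gramLin A j X).add ?_
    unfold IsHermitian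
    simp

variable {A} {α : Fin q → ℝ} {β : Fin p → ℝ} {ρ : ℝ}
  {C : ∀ i : Fin p, Matrix (Fin (n i)) (Fin (n i)) ℝ}

lemma g_reg (hβ : ∀ i, 0 ≤ β i) : IsClosedConvexC1 (g (n := n) β) :=
  isSymAffine_block.isClosedConvexC1 hβ

lemma h_reg (hα : ∀ j, 0 ≤ α j) : IsClosedConvexC1 (h A α ρ) :=
  (isSymAffine_gramMat A ρ).isClosedConvexC1 hα

lemma mem_dom_g (hβ : ∀ i, 0 ≤ β i) {X : SymTuple n} :
    X ∈ dom (g β) ↔ ∀ i, 0 < β i → (block X i).PosDef :=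
  IsSymAffine.mem_dom_iff (F := fun (i : Fin p) (X : SymTuple n) => block X i) hβ

lemma mem_dom_h (hα : ∀ j, 0 ≤ α j) {X : SymTuple n} :
    X ∈ dom (h A α ρ) ↔ ∀ j, 0 < α j → (gramMat A ρ j X).PosDef :=
  IsSymAffine.mem_dom_iff (F := gramMat A ρ) hα

lemma toReal_g (hβ : ∀ i, 0 ≤ β i) {X : SymTuple n} (hX : X ∈ dom (g β)) :
    (g β X).toReal = -∑ i, β i * Real.log (block X i).det :=
  IsSymAffine.toReal_eq (F := fun (i : Fin p) (X : SymTuple n) => block X i) hβ hX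

lemma toReal_h (hα : ∀ j, 0 ≤ α j) {X : SymTuple n} (hX : X ∈ dom (h A α ρ)) :
    (h A α ρ X).toReal = -∑ j, α j * Real.log (gramMat A ρ j X).det :=
  IsSymAffine.toReal_eq (F := gramMat A ρ) hα hX

lemma inner_grad_g (hβ : ∀ i, 0 ≤ β i) {X : SymTuple n} (hX : X ∈ dom (g β)) (S : SymTuple n) :
    inner ℝ (grad (g β) X) S = -∑ i, β i * ((block X i)⁻¹ * block S i).trace :=
  isSymAffine_block.inner_grad hβ hX S

lemma inner_grad_h (hα : ∀ j, 0 ≤ α j) {X : SymTuple n} (hX : X ∈ dom (h A α ρ))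
    (S : SymTuple n) :
    inner ℝ (grad (h A α ρ) X) S =
      -∑ j, α j * ((gramMat A ρ j X)⁻¹ * gramLin A j S).trace :=
  (isSymAffine_gramMat A ρ).inner_grad hα hX S

lemma posSemidef_gramLin {X : SymTuple n} (hX : ∀ i, (block X i).PosSemidef) (j : Fin q) :
    (gramLin A j X).PosSemidef :=
  posSemidef_sum _ fun i _ => posSemidef_mul_mul_transpose (hX i) (A i j)

lemma posDef_gramMat (hρ : 0 < ρ) {X : SymTuple n} (hX : ∀ i, (block X i).PosSemidef)
    (j : Fin q) : (gramMat A ρ j X).PosDef :=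
  (PosDef.one.smul hρ).posSemidef_add (posSemidef_gramLin hX j)

lemma feasible_subset_dom_h (hα : ∀ j, 0 ≤ α j) (hρ : 0 < ρ) : feasible C ⊆ dom (h A α ρ) :=
  fun _ hX => (mem_dom_h hα).2 fun j _ => posDef_gramMat hρ (fun i => (hX i).1) j

lemma convex_feasible : Convex ℝ (feasible C) := by
  intro X hX Y hY a b ha hb hab i
  rw [block_add, block_smul, block_smul]
  refine ⟨((hX i).1.smul ha).add ((hY i).1.smul hb), ?_⟩
  have := ((hX i).2.smul ha).add ((hY i).2.smul hb)
  convert! this using 1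
  rw [smul_sub, smul_sub]
  nth_rewrite 1 [← one_smul ℝ (C i), ← hab, add_smul]
  abel

/-- Boundedness: the Frobenius norm of X_i is at most tr X_i, which is at most tr C_i. -/
lemma isCompact_feasible : IsCompact (feasible C) := by
  refine Metric.isCompact_of_isClosed_isBounded ?_ ?_
  · have : feasible C = ⋂ i, ((fun X : SymTuple n => block X i) ⁻¹' {M | M.PosSemidef} ∩
        (fun X : SymTuple n => C i - block X i) ⁻¹' {M | M.PosSemidef}) := by
      ext X
      simp [feasible]
    rw [this]
    exact isClosed_iInter fun i => (isClosed_posSemidef.preimage (continuous_block i)).inter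
      (isClosed_posSemidef.preimage (continuous_const.sub (continuous_block i)))
  · refine isBounded_iff_forall_norm_le.2 ⟨√(∑ i, (C i).trace ^ 2), fun X hX => ?_⟩
    refine Real.le_sqrt_of_sq_le ?_
    rw [norm_sq_eq]
    refine Finset.sum_le_sum fun i _ => (frobSq_le_of_posSemidef (hX i).1).trans ?_
    exact pow_le_pow_left₀ (hX i).1.trace_nonneg (trace_le_of_sub_posSemidef (hX i).2) 2

lemma ofBlocks_mem_feasible (hC : ∀ i, (C i).PosSemidef) :
    ofBlocks C (fun i => (hC i).1) ∈ feasible C :=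
  fun i => ⟨hC i, by simpa using PosSemidef.zero⟩

lemma isRegular (hC : ∀ i, (C i).PosSemidef) (hα : ∀ j, 0 ≤ α j) (hβ : ∀ i, 0 ≤ β i)
    (hCβ : ∀ i, 0 < β i → (C i).PosDef) (hρ : 0 < ρ) :
    IsRegular (g β) (h A α ρ) (feasible C) where
  g_reg := g_reg hβ
  h_reg := h_reg hα
  compact := isCompact_feasible
  convex := convex_feasible
  subset_dom := feasible_subset_dom_h hα hρ
  nonempty := ⟨ofBlocks C fun i => (hC i).1, ofBlocks_mem_feasible hC,
    (mem_dom_g hβ).2 fun i hi => hCβ i hi⟩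

/-- Feasible blocks may be singular, but adding tI with t > 0 makes them positive definite. -/
lemma feasible_subset_closure (hβ : ∀ i, 0 ≤ β i) :
    feasible C ⊆ closure (dom (g (n := n) β)) := by
  intro X hX
  set I : SymTuple n := ofBlocks (fun _ => 1) fun _ => isHermitian_one with hI
  have hlim : Filter.Tendsto (fun t : ℝ => X + t • I) (nhdsWithin 0 (Ioi 0)) (nhds X) := by
    have : Continuous fun t : ℝ => X + t • I := by fun_prop
    have := this.tendsto 0
    simp only [zero_smul, add_zero] at this
    exact this.mono_left nhdsWithin_le_nhds
  refine mem_closure_of_tendsto hlim ?_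
  filter_upwards [self_mem_nhdsWithin] with t ht
  refine (mem_dom_g hβ).2 fun i _ => ?_
  rw [block_add, block_smul, hI, block_ofBlocks]
  exact (PosDef.one.smul ht).posSemidef_add (hX i).1

end BrascampLieb

end

/-! ### Frames and the perturbed geodesic direction -/

noncomputable section

namespace BrascampLieb

open Matrix LogDet DCProgram Set

variable {p q : ℕ} {n : Fin p → ℕ} {m : Fin q → ℕ}
  {A : ∀ (i : Fin p) (j : Fin q), Matrix (Fin (m j)) (Fin (n i)) ℝ}
  {α : Fin q → ℝ} {β : Fin p → ℝ} {ρ : ℝ} {C : ∀ i : Fin p, Matrix (Fin (n i)) (Fin (n i)) ℝ}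

/-- A simultaneous factorization `Xᵢ = Lᵢ Lᵢᵀ`, `Yᵢ = Lᵢ diag(xᵢ) Lᵢᵀ`. -/
structure IsFrame (β : Fin p → ℝ) (X Y : SymTuple n)
    (L : ∀ i, Matrix (Fin (n i)) (Fin (n i)) ℝ) (x : (Σ i, Fin (n i)) → ℝ) : Prop where
  left : ∀ i, block X i = L i * (L i)ᵀ
  right : ∀ i, block Y i = L i * diagonal (fun l => x ⟨i, l⟩) * (L i)ᵀ
  isUnit : ∀ i, 0 < β i → IsUnit (L i).det
  pos : ∀ l : Σ i, Fin (n i), 0 < β l.1 → 0 < x l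
  zero : ∀ l : Σ i, Fin (n i), ¬0 < β l.1 → x l = 0

lemma posDef_factor_iff {k : ℕ} {L : Matrix (Fin k) (Fin k) ℝ} (hL : IsUnit L.det)
    {x : Fin k → ℝ} : (L * diagonal x * Lᵀ).PosDef ↔ ∀ l, 0 < x l := by
  have := (Matrix.IsUnit.posDef_star_right_conjugate_iff (x := diagonal x)
    ((isUnit_iff_isUnit_det L).2 hL))
  rw [star_eq_conjTranspose, conjTranspose_eq_transpose_of_trivial] at this
  rw [this, posDef_diagonal_iff]

/-- On barrier blocks X_i is positive definite and the pair is diagonalized simultaneously. On free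
blocks Y_i = 0, so zero weights work with any factor of X_i, invertible or not. -/
lemma exists_isFrame {X Y : SymTuple n} (hX : ∀ i, (block X i).PosSemidef)
    (hX' : ∀ i, 0 < β i → (block X i).PosDef) (hY : ∀ i, 0 < β i → (block Y i).PosDef)
    (hY' : ∀ i, ¬0 < β i → block Y i = 0) : ∃ L x, IsFrame β X Y L x := by
  have key : ∀ i, ∃ (L : Matrix (Fin (n i)) (Fin (n i)) ℝ) (x : Fin (n i) → ℝ),
      block X i = L * Lᵀ ∧ block Y i = L * diagonal x * Lᵀ ∧
      (0 < β i → IsUnit L.det ∧ ∀ l, 0 < x l) ∧ (¬0 < β i → ∀ l, x l = 0) := by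
    intro i
    by_cases hi : 0 < β i
    · obtain ⟨L, x, hL, h1, h2⟩ := exists_factor_of_posDef (hX' i hi) (isHermitian_block Y i)
      refine ⟨L, x, h1, h2, fun _ => ⟨hL, ?_⟩, fun h => absurd hi h⟩
      rw [← posDef_factor_iff hL, ← h2]
      exact hY i hi
    · obtain ⟨L, h1⟩ := exists_factor_of_posSemidef (hX i)
      refine ⟨L, 0, h1, ?_, fun h => absurd h hi, fun _ _ => rfl⟩
      rw [hY' i hi]
      simp
  choose L x h1 h2 h3 h4 using key
  exact ⟨L, fun l => x l.1 l.2, h1, h2, fun i hi => (h3 i hi).1, fun l hl => (h3 l.1 hl).2 l.2,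
    fun l hl => h4 l.1 hl l.2⟩

/-- The concatenation of the matrices `Aᵢⱼ Lᵢ`. -/
def flat (A : ∀ (i : Fin p) (j : Fin q), Matrix (Fin (m j)) (Fin (n i)) ℝ)
    (L : ∀ i, Matrix (Fin (n i)) (Fin (n i)) ℝ) (j : Fin q) :
    Matrix (Fin (m j)) (Σ i, Fin (n i)) ℝ :=
  of fun r l => (A l.1 j * L l.1) r l.2

lemma flat_mul (L : ∀ i, Matrix (Fin (n i)) (Fin (n i)) ℝ) (j : Fin q)
    (x : (Σ i, Fin (n i)) → ℝ) :
    flat A L j * diagonal x * (flat A L j)ᵀ =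
      ∑ i, A i j * (L i * diagonal (fun l => x ⟨i, l⟩) * (L i)ᵀ) * (A i j)ᵀ := by
  ext a b
  rw [mul_apply, Fintype.sum_sigma, Matrix.sum_apply]
  refine Finset.sum_congr rfl fun i _ => ?_
  have : A i j * (L i * diagonal (fun l => x ⟨i, l⟩) * (L i)ᵀ) * (A i j)ᵀ =
      (A i j * L i) * diagonal (fun l => x ⟨i, l⟩) * (A i j * L i)ᵀ := by
    rw [transpose_mul]
    simp only [Matrix.mul_assoc]
  rw [this, mul_apply]
  refine Finset.sum_congr rfl fun l _ => ?_
  rw [mul_diagonal, mul_diagonal]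
  rfl

lemma gramLin_eq_flat {S : SymTuple n} {L : ∀ i, Matrix (Fin (n i)) (Fin (n i)) ℝ}
    {σ : (Σ i, Fin (n i)) → ℝ}
    (hS : ∀ i, block S i = L i * diagonal (fun l => σ ⟨i, l⟩) * (L i)ᵀ) (j : Fin q) :
    gramLin A j S = flat A L j * diagonal σ * (flat A L j)ᵀ := by
  rw [flat_mul, gramLin]
  simp only [hS]

lemma gramMat_eq_gram {S : SymTuple n} {L : ∀ i, Matrix (Fin (n i)) (Fin (n i)) ℝ}
    {σ : (Σ i, Fin (n i)) → ℝ}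
    (hS : ∀ i, block S i = L i * diagonal (fun l => σ ⟨i, l⟩) * (L i)ᵀ) (j : Fin q) :
    gramMat A ρ j S = weightedGram (flat A L j) ρ σ := by
  rw [gramMat, gramLin_eq_flat hS, weightedGram]

/-- The tuple with blocks `Lᵢ diag(σᵢ) Lᵢᵀ`. -/
def ofWeights (L : ∀ i, Matrix (Fin (n i)) (Fin (n i)) ℝ) (σ : (Σ i, Fin (n i)) → ℝ) :
    SymTuple n :=
  ofBlocks (fun i => L i * diagonal (fun l => σ ⟨i, l⟩) * (L i)ᵀ)
    fun _ => isHermitian_mul_diagonal_mul _ _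

lemma block_ofWeights (L : ∀ i, Matrix (Fin (n i)) (Fin (n i)) ℝ) (σ : (Σ i, Fin (n i)) → ℝ)
    (i : Fin p) : block (ofWeights L σ) i = L i * diagonal (fun l => σ ⟨i, l⟩) * (L i)ᵀ := rfl

lemma gramLin_ofWeights (L : ∀ i, Matrix (Fin (n i)) (Fin (n i)) ℝ) (σ : (Σ i, Fin (n i)) → ℝ)
    (j : Fin q) :
    gramLin A j (ofWeights L σ) = flat A L j * diagonal σ * (flat A L j)ᵀ :=
  gramLin_eq_flat (σ := σ) (fun i => block_ofWeights L σ i) j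

/-- The indicator of the blocks without barrier term. -/
def freeWeight (n : Fin p → ℕ) (β : Fin p → ℝ) (l : Σ i, Fin (n i)) : ℝ := if 0 < β l.1 then 0 else 1

/-- The weights of the descent direction towards the tuple with weights `x`. -/
def dirWeight (β : Fin p → ℝ) (s R : ℝ) (x : (Σ i, Fin (n i)) → ℝ) (l : Σ i, Fin (n i)) : ℝ :=
  if 0 < β l.1 then Real.log (x l) + s * (x l - 1) ^ 2 else -R

/-- The strong convexity gain. -/
def gain (A : ∀ (i : Fin p) (j : Fin q), Matrix (Fin (m j)) (Fin (n i)) ℝ) (α : Fin q → ℝ)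
    (β : Fin p → ℝ) (ρ s : ℝ) (X : SymTuple n) (L : ∀ i, Matrix (Fin (n i)) (Fin (n i)) ℝ)
    (x : (Σ i, Fin (n i)) → ℝ) : ℝ :=
  s * ∑ i, β i * ∑ l, (x ⟨i, l⟩ - 1) ^ 2 + ∑ j, α j * ((gramMat A ρ j X)⁻¹ *
    (flat A L j * diagonal (freeWeight n β) * (flat A L j)ᵀ)).trace

namespace IsFrame

variable {X Y : SymTuple n} {L : ∀ i, Matrix (Fin (n i)) (Fin (n i)) ℝ}
  {x : (Σ i, Fin (n i)) → ℝ}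

lemma left' (hF : IsFrame β X Y L x) (i : Fin p) :
    block X i = L i * diagonal (fun l => (fun _ => 1 : (Σ i, Fin (n i)) → ℝ) ⟨i, l⟩) * (L i)ᵀ := by
  rw [hF.left i, diagonal_one, Matrix.mul_one]

lemma gramMat_left (hF : IsFrame β X Y L x) (j : Fin q) :
    gramMat A ρ j X = weightedGram (flat A L j) ρ fun _ => 1 :=
  gramMat_eq_gram (σ := fun _ => 1) (fun i => hF.left' i) j

lemma gramMat_right (hF : IsFrame β X Y L x) (j : Fin q) :
    gramMat A ρ j Y = weightedGram (flat A L j) ρ x :=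
  gramMat_eq_gram hF.right j

/-- This is the alternative of the strengthened Jensen inequality, with the indicator of free blocks
in the role of e. -/
lemma weights_cases (hF : IsFrame β X Y L x) {b s R : ℝ} (hb : ∀ l, x l ≤ b)
    (l : Σ i, Fin (n i)) :
    (freeWeight n β l = 0 ∧ 0 < x l ∧ x l ≤ b ∧
      dirWeight β s R x l = Real.log (x l) + s * (x l - 1) ^ 2) ∨
    (freeWeight n β l = 1 ∧ x l = 0 ∧ dirWeight β s R x l = -R) := by
  unfold freeWeight dirWeight
  split_ifs with h
  · exact Or.inl ⟨rfl, hF.pos l h, hb l, rfl⟩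
  · exact Or.inr ⟨rfl, hF.zero l h, rfl⟩

lemma frame_of_isUnit (hF : IsFrame β X Y L x) {i : Fin p} (hi : 0 < β i) :
    ((L i)⁻¹ᵀ)ᵀ * block X i * (L i)⁻¹ᵀ = 1 ∧
    ∀ d : Fin (n i) → ℝ, ((L i)⁻¹ᵀ)ᵀ * (L i * diagonal d * (L i)ᵀ) * (L i)⁻¹ᵀ = diagonal d := by
  have h1 : (L i)⁻¹ * L i = 1 := nonsing_inv_mul _ (hF.isUnit i hi)
  have h2 : (L i)ᵀ * (L i)⁻¹ᵀ = 1 := by rw [← transpose_mul, h1, transpose_one]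
  have h3 : ∀ d : Fin (n i) → ℝ,
      ((L i)⁻¹ᵀ)ᵀ * (L i * diagonal d * (L i)ᵀ) * (L i)⁻¹ᵀ = diagonal d := fun d => by
    rw [transpose_transpose]
    calc _ = ((L i)⁻¹ * L i) * diagonal d * ((L i)ᵀ * (L i)⁻¹ᵀ) := by
          simp only [Matrix.mul_assoc]
      _ = _ := by rw [h1, h2, Matrix.one_mul, Matrix.mul_one]
  refine ⟨?_, h3⟩
  have := h3 fun _ => 1
  rwa [diagonal_one, Matrix.mul_one, ← hF.left] at this

lemma mem_dom_left (hF : IsFrame β X Y L x) (hβ : ∀ i, 0 ≤ β i) : X ∈ dom (g β) := by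
  refine (mem_dom_g hβ).2 fun i hi => ?_
  rw [hF.left' i]
  exact (posDef_factor_iff (hF.isUnit i hi)).2 fun _ => one_pos

lemma mem_dom_right (hF : IsFrame β X Y L x) (hβ : ∀ i, 0 ≤ β i) : Y ∈ dom (g β) := by
  refine (mem_dom_g hβ).2 fun i hi => ?_
  rw [hF.right i]
  exact (posDef_factor_iff (hF.isUnit i hi)).2 fun l => hF.pos ⟨i, l⟩ hi

lemma posSemidef_left (hF : IsFrame β X Y L x) (i : Fin p) : (block X i).PosSemidef := by
  rw [hF.left' i]
  exact posSemidef_mul_diagonal_mul _ fun _ => zero_le_one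

lemma nonneg (hF : IsFrame β X Y L x) (l : Σ i, Fin (n i)) : 0 ≤ x l := by
  by_cases h : 0 < β l.1
  · exact (hF.pos l h).le
  · exact (hF.zero l h).ge

lemma posSemidef_right (hF : IsFrame β X Y L x) (i : Fin p) : (block Y i).PosSemidef := by
  rw [hF.right i]
  exact posSemidef_mul_diagonal_mul _ fun l => hF.nonneg ⟨i, l⟩

/-- The first-order inequality with gain along the descent direction. -/
lemma inner_add_gain_le (hF : IsFrame β X Y L x) (hα : ∀ j, 0 ≤ α j) (hβ : ∀ i, 0 ≤ β i)
    {τ b s R : ℝ} (hρ : 0 < ρ) (hτ0 : 0 < τ)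
    (hτ : ∀ j, (τ • (1 : Matrix (Fin (m j)) (Fin (m j)) ℝ) - gramMat A ρ j X).PosSemidef)
    (hb : 1 ≤ b) (hs : s = ρ / τ / (8 * b ^ 2)) (hR : R = 2 - Real.log (ρ / τ))
    (hxb : ∀ l, x l ≤ b) :
    inner ℝ (grad (g β) X) (ofWeights L (dirWeight β s R x)) -
        inner ℝ (grad (h A α ρ) X) (ofWeights L (dirWeight β s R x)) + gain A α β ρ s X L x ≤
      ((g β Y).toReal - (h A α ρ Y).toReal) - ((g β X).toReal - (h A α ρ X).toReal) := by
  have hXh : X ∈ dom (h A α ρ) :=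
    (mem_dom_h hα).2 fun j _ => posDef_gramMat hρ hF.posSemidef_left j
  have hYh : Y ∈ dom (h A α ρ) :=
    (mem_dom_h hα).2 fun j _ => posDef_gramMat hρ hF.posSemidef_right j
  have hXg := hF.mem_dom_left hβ
  have hYg := hF.mem_dom_right hβ
  rw [inner_grad_g hβ hXg, inner_grad_h hα hXh, toReal_g hβ hXg, toReal_g hβ hYg,
    toReal_h hα hXh, toReal_h hα hYh, gain]
  -- For g the first-order expansion is exact: log det is affine along the geodesic, and the
  -- perturbation s(x − 1)² appears as pure gain.
  have hg : -∑ i, β i * ((block X i)⁻¹ *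
        block (ofWeights L (dirWeight β s R x)) i).trace + s * ∑ i, β i * ∑ l, (x ⟨i, l⟩ - 1) ^ 2 =
      -∑ i, β i * Real.log (block Y i).det + ∑ i, β i * Real.log (block X i).det := by
    rw [← Finset.sum_neg_distrib, ← Finset.sum_neg_distrib, Finset.mul_sum,
      ← Finset.sum_add_distrib, ← Finset.sum_add_distrib]
    refine Finset.sum_congr rfl fun i _ => ?_
    rcases (hβ i).eq_or_lt with h0 | h0
    · simp [← h0]
    · obtain ⟨hW, hd⟩ := hF.frame_of_isUnit h0
      have h1 := hd fun l => x ⟨i, l⟩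
      rw [← hF.right] at h1
      rw [block_ofWeights, trace_inv_mul_diag hW (hd _),
        log_det_diag ((mem_dom_g hβ).1 hXg i h0) hW h1 fun l => hF.pos ⟨i, l⟩ h0]
      simp only [dirWeight, h0, if_true, Finset.sum_add_distrib, ← Finset.mul_sum]
      ring
  have hh : ∑ j, α j * ((gramMat A ρ j X)⁻¹ *
        gramLin A j (ofWeights L (dirWeight β s R x))).trace +
      ∑ j, α j * ((gramMat A ρ j X)⁻¹ *
        (flat A L j * diagonal (freeWeight n β) * (flat A L j)ᵀ)).trace ≤
      ∑ j, α j * Real.log (gramMat A ρ j Y).det - ∑ j, α j * Real.log (gramMat A ρ j X).det := by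
    rw [← Finset.sum_add_distrib, ← Finset.sum_sub_distrib]
    refine Finset.sum_le_sum fun j _ => ?_
    have hτj := hτ j
    rw [hF.gramMat_left] at hτj
    have := trace_add_trace_le_log_det_sub hρ hτj hτ0 hb hs hR
      (hF.weights_cases (s := s) (R := R) hxb)
    rw [hF.gramMat_left, hF.gramMat_right,
      gramLin_ofWeights]
    nlinarith [mul_le_mul_of_nonneg_left this (hα j)]
  linarith

lemma dirWeight_le (hF : IsFrame β X Y L x) {b s R : ℝ} (hb : 1 ≤ b)
    (hs : s ≤ 1 / (4 * b ^ 2)) (hR : 1 ≤ R) (hxb : ∀ l, x l ≤ b) (l : Σ i, Fin (n i)) :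
    dirWeight β s R x l ≤ x l - 1 := by
  unfold dirWeight
  split_ifs with h
  · exact log_add_sq_le_sub_one (hF.pos l h) (hxb l) hb hs
  · rw [hF.zero l h]
    linarith

/-- The descent direction is feasible. -/
lemma exists_add_smul_mem (hF : IsFrame β X Y L x) (hX : X ∈ feasible C) (hY : Y ∈ feasible C)
    {σ : (Σ i, Fin (n i)) → ℝ} (hσ : ∀ l, σ l ≤ x l - 1) :
    ∃ t : ℝ, 0 < t ∧ X + t • ofWeights L σ ∈ feasible C := by
  -- The step 1/Θ is at most 1 and keeps every weight 1 + σ/Θ nonnegative.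
  set Θ : ℝ := ∑ l, |σ l| + 1 with hΘ
  have hΘ1 : 1 ≤ Θ := by
    have := Finset.sum_nonneg fun l (_ : l ∈ Finset.univ) => abs_nonneg (σ l)
    linarith
  have hΘ0 : 0 < Θ := by linarith
  have ht1 : Θ⁻¹ ≤ 1 := inv_le_one_of_one_le₀ hΘ1
  have ht0 : 0 < Θ⁻¹ := inv_pos.2 hΘ0
  refine ⟨Θ⁻¹, ht0, fun i => ?_⟩
  rw [block_add, block_smul, block_ofWeights]
  constructor
  · have h1 : block X i + Θ⁻¹ • (L i * diagonal (fun l => σ ⟨i, l⟩) * (L i)ᵀ) =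
        L i * diagonal (fun l => 1 + Θ⁻¹ * σ ⟨i, l⟩) * (L i)ᵀ := by
      have : diagonal (fun l => 1 + Θ⁻¹ * σ ⟨i, l⟩) =
          1 + Θ⁻¹ • diagonal (fun l => σ ⟨i, l⟩) := by
        rw [← diagonal_one, ← diagonal_smul, diagonal_add]
        rfl
      rw [this, Matrix.mul_add, Matrix.add_mul, Matrix.mul_one, hF.left, Matrix.mul_smul,
        Matrix.smul_mul]
    rw [h1]
    refine posSemidef_mul_diagonal_mul _ fun l => ?_
    have h2 := Finset.single_le_sum (f := fun l => |σ l|) (fun l _ => abs_nonneg _)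
      (Finset.mem_univ (⟨i, l⟩ : Σ i, Fin (n i)))
    have h3 := neg_abs_le (σ ⟨i, l⟩)
    have h4 : Θ⁻¹ * (-Θ) ≤ Θ⁻¹ * σ ⟨i, l⟩ := mul_le_mul_of_nonneg_left (by linarith) ht0.le
    rw [mul_neg, inv_mul_cancel₀ hΘ0.ne'] at h4
    linarith
  · have h1 : (L i * diagonal (fun l => x ⟨i, l⟩ - 1 - σ ⟨i, l⟩) * (L i)ᵀ).PosSemidef :=
      posSemidef_mul_diagonal_mul _ fun l => by linarith [hσ ⟨i, l⟩]
    -- With t = 1/Θ, C − X − tS = (1 − t)(C − X) + t(C − Y) + t(Y − X − S), and Y − X − S has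
    -- weights x − 1 − σ ≥ 0.
    have h2 := (((hX i).2.smul (sub_nonneg.2 ht1)).add ((hY i).2.smul ht0.le)).add
      (h1.smul ht0.le)
    have h3 : L i * diagonal (fun l => x ⟨i, l⟩ - 1 - σ ⟨i, l⟩) * (L i)ᵀ =
        block Y i - block X i - L i * diagonal (fun l => σ ⟨i, l⟩) * (L i)ᵀ := by
      have : diagonal (fun l => x ⟨i, l⟩ - 1 - σ ⟨i, l⟩) =
          diagonal (fun l => x ⟨i, l⟩) - 1 - diagonal (fun l => σ ⟨i, l⟩) := by
        rw [← diagonal_one, diagonal_sub, diagonal_sub]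
      rw [this, Matrix.mul_sub, Matrix.mul_sub, Matrix.sub_mul, Matrix.sub_mul, Matrix.mul_one,
        hF.right, hF.left]
    rw [h3] at h2
    convert! h2 using 1
    module

/-- The second-order upper bound of `h` against the descent direction. -/
lemma h_sub_le (hF : IsFrame β X Y L x) (hα : ∀ j, 0 ≤ α j) {a b s R Θ t : ℝ}
    (hρ : 0 < ρ) (hb : 1 ≤ b) (hs0 : 0 ≤ s) (hs : s ≤ 1 / (4 * b ^ 2)) (ha : 0 < a)
    (hxa : ∀ l : Σ i, Fin (n i), 0 < β l.1 → a ≤ x l) (hxb : ∀ l, x l ≤ b) (hΘ : 0 ≤ Θ)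
    (hσ : ∀ l, |dirWeight β s R x l| ≤ Θ) (ht : 0 ≤ t) (htΘ : t * Θ ≤ 1 / 2) :
    X - t • ofWeights L (dirWeight β s R x) ∈ dom (h A α ρ) ∧
    (h A α ρ (X - t • ofWeights L (dirWeight β s R x))).toReal - (h A α ρ X).toReal +
        t * inner ℝ (grad (h A α ρ) X) (ofWeights L (dirWeight β s R x)) ≤
      2 * t ^ 2 * ∑ j, α j * (m j * ∑ l : Σ i, Fin (n i),
          (1 + 1 / a) ^ 2 * ((1 - freeWeight n β l) * (x l - 1) ^ 2) +
        R ^ 2 * ((gramMat A ρ j X)⁻¹ *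
          (flat A L j * diagonal (freeWeight n β) * (flat A L j)ᵀ)).trace) := by
  have hXh : X ∈ dom (h A α ρ) :=
    (mem_dom_h hα).2 fun j _ => posDef_gramMat hρ hF.posSemidef_left j
  set S := ofWeights L (dirWeight β s R x) with hS
  have hmat : ∀ j, gramMat A ρ j (X - t • S) = weightedGram (flat A L j) ρ (fun _ => 1) -
      t • (flat A L j * diagonal (dirWeight β s R x) * (flat A L j)ᵀ) := by
    intro j
    rw [← hF.gramMat_left, ← gramLin_ofWeights,
      sub_eq_add_neg, ← neg_smul, (isSymAffine_gramMat A ρ).add_apply, gramLin_smul, neg_smul,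
      ← sub_eq_add_neg]
  have key := fun j => neg_log_det_sub_le (P := flat A L j) hρ hΘ hσ ht htΘ
  have hZh : X - t • S ∈ dom (h A α ρ) := (mem_dom_h hα).2 fun j _ => by
    rw [hmat]
    exact (key j).1
  refine ⟨hZh, ?_⟩
  rw [toReal_h hα hXh, toReal_h hα hZh, inner_grad_h hα hXh, Finset.mul_sum, mul_neg,
    Finset.mul_sum, sub_neg_eq_add, ← sub_eq_add_neg, ← Finset.sum_neg_distrib,
    ← Finset.sum_add_distrib, ← Finset.sum_sub_distrib]
  refine Finset.sum_le_sum fun j _ => ?_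
  have h1 := (key j).2
  -- Squared weights are split: barrier entries are at most a multiple of (x − 1)², free entries
  -- equal R².
  have h2 := trace_inv_gram_mul_le (P := flat A L j) (x := fun l => dirWeight β s R x l ^ 2)
    (y := fun l => (1 + 1 / a) ^ 2 * ((1 - freeWeight n β l) * (x l - 1) ^ 2))
    (e := freeWeight n β) (q := R ^ 2) hρ (fun l => by
      unfold freeWeight
      split_ifs
      · rw [sub_zero, one_mul]; positivity
      · simp) (fun l => by
      unfold dirWeight freeWeight
      split_ifs with h
      · rw [mul_zero, add_zero, sub_zero, one_mul]
        exact sq_log_add_sq_le ha (hxa l h) (hxb l) hb hs0 hs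
      · simp)
  rw [Fintype.card_fin] at h2
  rw [hmat, gramLin_ofWeights, hF.gramMat_left]
  have h3 := mul_le_mul_of_nonneg_left
    (h1.trans (mul_le_mul_of_nonneg_left h2 (by positivity : 0 ≤ 2 * t ^ 2))) (hα j)
  linarith

end IsFrame

end BrascampLieb

end

/-! ### Globalizing the PL inequality; uniform bounds; removal of free blocks -/

noncomputable section

namespace DCProgram.IsRegular

open Set

variable {E : Type*} [NormedAddCommGroup E] [InnerProductSpace ℝ E] [CompleteSpace E]
  {g h : E → EReal} {C : Set E}

/-- First-order optimality of a minimizer along a feasible direction. -/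
lemma inner_grad_nonneg (hr : IsRegular g h C) {x v : E} (hx : x ∈ minimizers g h C) {τ : ℝ}
    (hτ : 0 < τ) (hv : x + τ • v ∈ C) :
    0 ≤ inner ℝ (grad g x) v - inner ℝ (grad h x) v := by
  obtain ⟨hxC, hxg, hmin⟩ := hr.mem_minimizers_iff.1 hx
  obtain ⟨δ, hδ, hb⟩ := eventually_mem_dom hr.g_reg hxg v
  have hder := (hr.g_reg.hasDerivAt_line hxg v).sub
    (hr.h_reg.hasDerivAt_line (hr.subset_dom hxC) v)
  refine le_of_hasDerivAt_of_ge hder (lt_min hδ hτ) fun t h0 h1 => ?_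
  have hmem : x + t • v ∈ C := by
    have := convex_combo_mem hr.convex hxC hv (t := t / τ) (by positivity)
      ((div_le_one hτ).2 (h1.le.trans (min_le_right _ _)))
    rwa [add_sub_cancel_left, smul_smul, div_mul_cancel₀ _ hτ.ne'] at this
  have := hmin _ hmem (hb t h0 (h1.trans_le (min_le_left _ _)))
  simpa using this

/-- The test point moves backwards along a feasible v. As ⟨y, v⟩ ≤ 0, the normal vector only
increases the value and needs no size bound. -/
lemma le_test_of_feasible {x y v : E} (hy : y ∈ normalCone C x) {τ t a b : ℝ} (hτ : 0 < τ)
    (hv : x + τ • v ∈ C) (ht : 0 ≤ t) :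
    -t * (inner ℝ (grad g x) v - inner ℝ (grad h x) v) - (a - b + t * inner ℝ (grad h x) v) ≤
      inner ℝ (grad g x + y) (x - t • v - x) - a + b := by
  have h1 : inner ℝ y v ≤ 0 := by
    have := hy _ hv
    rw [add_sub_cancel_left, inner_smul_right] at this
    exact nonpos_of_mul_nonpos_right this hτ
  have e : x - t • v - x = (-t) • v := by
    rw [neg_smul]
    abel
  rw [e, inner_smul_right, inner_add_left]
  nlinarith

/-- The Polyak–Łojasiewicz inequality from its validity on sublevel sets of `g`, when `g` is
dominated by its slope in a direction along which one can leave `C` inside `dom h`. -/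
lemma exists_dcpl (hr : IsRegular g h C) {xs : E} (hxs : xs ∈ minimizers g h C) {t : ℝ}
    (ht : 0 < t) {v : E} (hmem : ∀ x ∈ C, x - t • v ∈ dom h)
    (hslope : ∀ x ∈ C, x ∈ dom g → (g x).toReal ≤ -inner ℝ (grad g x) v)
    (hnear : ∀ G : ℝ, ∃ μ : ℝ, 0 < μ ∧ ∀ x ∈ C, x ∈ dom g → (g x).toReal ≤ G →
      ∀ y ∈ normalCone C x, ∃ z ∈ dom h,
        μ * (((g x).toReal - (h x).toReal) - ((g xs).toReal - (h xs).toReal)) ≤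
          inner ℝ (grad g x + y) (z - x) - (h z).toReal + (h x).toReal) (r : ℝ) :
    ∃ μ : ℝ, 0 < μ ∧ DCPL g h C μ r := by
  obtain ⟨H, hH⟩ :=
    (hr.compact.image_of_continuousOn hr.continuousOn_toReal_h).isBounded.exists_norm_le
  have hcont : ContinuousOn (fun x => (h (x - t • v)).toReal) C :=
    hr.h_reg.contDiffOn.continuousOn.comp (f := fun x => x - t • v) (by fun_prop)
      fun x hx => hmem x hx
  obtain ⟨H', hH'⟩ := (hr.compact.image_of_continuousOn hcont).isBounded.exists_norm_le
  set fs := (g xs).toReal - (h xs).toReal with hfs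
  set c₁ := H - fs with hc₁
  set c₂ := t * (r * ‖v‖) + H' + H with hc₂
  -- Beyond this threshold t·g(x) − c₂ ≥ (t/2)(g(x) + c₁), and g(x) + c₁ bounds the gap. Here c₂
  -- collects the normal vector and both values of h.
  obtain ⟨μ, hμ, hnear⟩ := hnear (2 / t * c₂ + c₁)
  refine ⟨min (t / 2) μ, lt_min (by positivity) hμ, hr.dcpl_of_exists hxs ?_⟩
  intro x hx hxg y hy hyr
  have hgap : 0 ≤ ((g x).toReal - (h x).toReal) - fs :=
    sub_nonneg.2 ((hr.mem_minimizers_iff.1 hxs).2.2 x hx hxg)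
  by_cases hG : (g x).toReal ≤ 2 / t * c₂ + c₁
  · obtain ⟨z, hz, hle⟩ := hnear x hx hxg hG y hy
    exact ⟨z, hz, (mul_le_mul_of_nonneg_right (min_le_right _ _) hgap).trans hle⟩
  · refine ⟨x - t • v, hmem x hx, (mul_le_mul_of_nonneg_right (min_le_left _ _) hgap).trans ?_⟩
    have h1 := hslope x hx hxg
    have h2 : inner ℝ y v ≤ r * ‖v‖ :=
      (real_inner_le_norm y v).trans (mul_le_mul_of_nonneg_right hyr (norm_nonneg v))
    have h3 := abs_le.1 (hH _ (mem_image_of_mem _ hx))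
    have h4 := abs_le.1 (hH' _ (mem_image_of_mem _ hx))
    have e : x - t • v - x = (-t) • v := by
      rw [neg_smul]
      abel
    rw [e, inner_smul_right, inner_add_left]
    have h5 := mul_le_mul_of_nonneg_left h1 ht.le
    have h6 := mul_le_mul_of_nonneg_left h2 ht.le
    have h7 : c₂ * 2 + c₁ * t ≤ (g x).toReal * t := by
      have := mul_le_mul_of_nonneg_right (not_le.1 hG).le ht.le
      have e2 : (2 / t * c₂ + c₁) * t = c₂ * 2 + c₁ * t := by field_simp
      linarith
    nlinarith

end DCProgram.IsRegular

namespace BrascampLieb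

open Matrix LogDet DCProgram Set

variable {p q : ℕ} {n : Fin p → ℕ} {m : Fin q → ℕ}
  {A : ∀ (i : Fin p) (j : Fin q), Matrix (Fin (m j)) (Fin (n i)) ℝ}
  {α : Fin q → ℝ} {β : Fin p → ℝ} {ρ : ℝ} {C : ∀ i : Fin p, Matrix (Fin (n i)) (Fin (n i)) ℝ}

lemma gramLin_sub (j : Fin q) (X Y : SymTuple n) :
    gramLin A j (X - Y) = gramLin A j X - gramLin A j Y := by
  simp only [gramLin, block_sub, Matrix.mul_sub, Matrix.sub_mul, Finset.sum_sub_distrib]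

/-- The Gram matrices are monotone in X, so a bound at X = C holds on the whole feasible set. -/
lemma exists_gram_bound (hC : ∀ i, (C i).PosSemidef) (ρ : ℝ) :
    ∃ τ : ℝ, 0 < τ ∧ ρ ≤ τ ∧ ∀ X ∈ feasible C, ∀ j : Fin q,
      (τ • (1 : Matrix (Fin (m j)) (Fin (m j)) ℝ) - gramMat A ρ j X).PosSemidef := by
  set XC : SymTuple n := ofBlocks C fun i => (hC i).1
  choose τ hτ0 hτ using fun j : Fin q =>
    exists_smul_one_sub_posSemidef ((isSymAffine_gramMat A ρ).isHermitian j XC)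
  have hsum : 0 ≤ ∑ j, τ j := Finset.sum_nonneg fun j _ => (hτ0 j).le
  refine ⟨∑ j, τ j + |ρ| + 1, by positivity, by linarith [le_abs_self ρ], fun X hX j => ?_⟩
  have h1 : τ j ≤ ∑ j, τ j + |ρ| + 1 := by
    have := Finset.single_le_sum (fun j _ => (hτ0 j).le) (Finset.mem_univ j)
    linarith [abs_nonneg ρ]
  have h2 : (gramLin A j (XC - X)).PosSemidef := posSemidef_gramLin (fun i => by
    rw [block_sub]
    exact (hX i).2) j
  have h3 := (hτ j _ h1).add h2
  convert! h3 using 1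
  rw [gramLin_sub, gramMat, gramMat]
  abel

/-- On sublevel sets of `g` the barrier blocks are uniformly positive definite. -/
lemma exists_block_bound (hr : IsRegular (g β) (h A α ρ) (feasible C)) (hβ : ∀ i, 0 ≤ β i)
    (hC : ∀ i, (C i).PosSemidef) (G : ℝ) :
    ∃ b : ℝ, 1 ≤ b ∧ ∀ X ∈ feasible C, X ∈ dom (g β) → (g β X).toReal ≤ G →
      ∀ i, 0 < β i → (b • block X i - C i).PosSemidef := by
  have key : ∀ i, ∃ b : ℝ, 0 ≤ b ∧ ∀ X ∈ feasible C, X ∈ dom (g β) → (g β X).toReal ≤ G →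
      0 < β i → ∀ t, b ≤ t → (t • block X i - C i).PosSemidef := by
    intro i
    by_cases hi : 0 < β i
    swap
    · exact ⟨0, le_rfl, fun X _ _ _ h => absurd h hi⟩
    -- These open sets increase with N and cover the compact sublevel set, so a single N serves.
    set U : ℕ → Set (SymTuple n) := fun N =>
      {X | (block X i).PosDef} ∩ {X | ((N : ℝ) • block X i - C i).PosDef} with hU
    have hmono : ∀ {X : SymTuple n} {s t : ℝ}, (block X i).PosDef →
        (s • block X i - C i).PosDef → s ≤ t → (t • block X i - C i).PosDef := by
      intro X s t h1 h2 hst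
      have := h2.add_posSemidef (h1.posSemidef.smul (sub_nonneg.2 hst))
      convert! this using 1
      rw [sub_smul]
      abel
    have hcont : ∀ N : ℕ, Continuous fun X : SymTuple n => (N : ℝ) • block X i - C i := fun N => by
      have := continuous_block (n := n) i
      fun_prop
    have hopen : ∀ N, IsOpen (U N) := fun N =>
      (isOpen_posDef (continuous_block i) fun X => isHermitian_block X i).inter
        (isOpen_posDef (hcont N) fun X => by
          have h1 : (((N : ℝ) • block X i)).IsHermitian := by
            rw [← block_smul]
            exact isHermitian_block _ i
          exact h1.sub (hC i).1)
    obtain ⟨N, hN⟩ := (hr.isCompact_sublevel G).elim_directed_cover U hopen (fun X hX => by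
      have hXg : X ∈ dom (g β) := ne_top_of_le_ne_top (EReal.coe_ne_top _) hX.2
      have hPD := (mem_dom_g hβ).1 hXg i hi
      obtain ⟨b, _, hb⟩ := exists_smul_sub_posSemidef hPD (hC i).1
      obtain ⟨N, hN⟩ := exists_nat_ge (b + 1)
      refine mem_iUnion.2 ⟨N, hPD, ?_⟩
      have := hPD.add_posSemidef (hb (N - 1) (by linarith))
      show ((N : ℝ) • block X i - C i).PosDef
      convert! this using 1
      rw [sub_smul, one_smul]
      abel) (fun N₁ N₂ => ⟨max N₁ N₂,
        fun X hX => ⟨hX.1, hmono hX.1 hX.2 (by exact_mod_cast le_max_left _ _)⟩,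
        fun X hX => ⟨hX.1, hmono hX.1 hX.2 (by exact_mod_cast le_max_right _ _)⟩⟩)
    refine ⟨N, N.cast_nonneg, fun X hX hXg hG _ t ht => ?_⟩
    have hmem := hN ⟨hX, by
      show g β X ≤ _
      rw [← hr.g_reg.coe_toReal hXg]
      exact_mod_cast hG⟩
    exact (hmono hmem.1 hmem.2 ht).posSemidef
  choose b hb0 hb using key
  refine ⟨∑ i, b i + 1, ?_, fun X hX hXg hG i hi => hb i X hX hXg hG hi _ ?_⟩
  · have := Finset.sum_nonneg fun i (_ : i ∈ Finset.univ) => hb0 i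
    linarith
  · have := Finset.single_le_sum (fun i _ => hb0 i) (Finset.mem_univ i)
    linarith

namespace IsFrame

variable {X Y : SymTuple n} {L : ∀ i, Matrix (Fin (n i)) (Fin (n i)) ℝ}
  {x : (Σ i, Fin (n i)) → ℝ}

/-- bX ⪰ C ⪰ Y on each barrier block, read in the common frame. -/
lemma le_of_smul_sub (hF : IsFrame β X Y L x) (hY : Y ∈ feasible C) {b : ℝ} (hb : 0 ≤ b)
    (h : ∀ i, 0 < β i → (b • block X i - C i).PosSemidef) (l : Σ i, Fin (n i)) : x l ≤ b := by
  by_cases hl : 0 < β l.1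
  · have h1 := (h l.1 hl).add (hY l.1).2
    have h2 : b • block X l.1 - C l.1 + (C l.1 - block Y l.1) =
        L l.1 * diagonal (fun k => b - x ⟨l.1, k⟩) * (L l.1)ᵀ := by
      rw [← diagonal_sub, ← smul_one_eq_diagonal, Matrix.mul_sub, Matrix.sub_mul, Matrix.mul_smul,
        Matrix.smul_mul, Matrix.mul_one, ← hF.left, ← hF.right]
      abel
    rw [h2, posSemidef_factor_iff (hF.isUnit l.1 hl)] at h1
    linarith [h1 l.2]
  · rw [hF.zero l hl]
    exact hb

/-- The mirror argument, from bY ⪰ C ⪰ X, keeps the weights away from zero. -/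
lemma one_le_mul_of_smul_sub (hF : IsFrame β X Y L x) (hX : X ∈ feasible C) {b : ℝ}
    (h : ∀ i, 0 < β i → (b • block Y i - C i).PosSemidef) (l : Σ i, Fin (n i)) (hl : 0 < β l.1) :
    1 ≤ b * x l := by
  have h1 := (h l.1 hl).add (hX l.1).2
  have h2 : b • block Y l.1 - C l.1 + (C l.1 - block X l.1) =
      L l.1 * diagonal (fun k => b * x ⟨l.1, k⟩ - 1) * (L l.1)ᵀ := by
    have : diagonal (fun k => b * x ⟨l.1, k⟩ - 1) =
        b • diagonal (fun k => x ⟨l.1, k⟩) - (1 : Matrix (Fin (n l.1)) (Fin (n l.1)) ℝ) := by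
      rw [← diagonal_one, ← diagonal_smul, diagonal_sub]
      rfl
    rw [this, Matrix.mul_sub, Matrix.sub_mul, Matrix.mul_smul,
      Matrix.smul_mul, Matrix.mul_one, ← hF.left, ← hF.right]
    abel
  rw [h2, posSemidef_factor_iff (hF.isUnit l.1 hl)] at h1
  linarith [h1 l.2]

end IsFrame

/-- The tuple with the blocks without barrier term replaced by zero. -/
def zeroFree (β : Fin p → ℝ) (X : SymTuple n) : SymTuple n :=
  ofBlocks (fun i => if 0 < β i then block X i else 0) fun i => by
    split_ifs
    · exact isHermitian_block X i
    · exact isHermitian_zero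

lemma block_zeroFree (X : SymTuple n) (i : Fin p) :
    block (zeroFree β X) i = if 0 < β i then block X i else 0 := rfl

lemma zeroFree_mem_feasible (hC : ∀ i, (C i).PosSemidef) {X : SymTuple n} (hX : X ∈ feasible C) :
    zeroFree β X ∈ feasible C := by
  intro i
  rw [block_zeroFree]
  split_ifs
  · exact hX i
  · exact ⟨PosSemidef.zero, by rw [sub_zero]; exact hC i⟩

lemma mem_dom_g_congr (hβ : ∀ i, 0 ≤ β i) {X Y : SymTuple n}
    (hXY : ∀ i, 0 < β i → block X i = block Y i) (hX : X ∈ dom (g β)) : Y ∈ dom (g β) :=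
  (mem_dom_g hβ).2 fun i hi => hXY i hi ▸ (mem_dom_g hβ).1 hX i hi

lemma toReal_g_congr (hβ : ∀ i, 0 ≤ β i) {X Y : SymTuple n}
    (hXY : ∀ i, 0 < β i → block X i = block Y i) (hX : X ∈ dom (g β)) :
    (g β X).toReal = (g β Y).toReal := by
  rw [toReal_g hβ hX, toReal_g hβ (mem_dom_g_congr hβ hXY hX)]
  congr 1
  refine Finset.sum_congr rfl fun i _ => ?_
  rcases (hβ i).eq_or_lt with h0 | h0
  · simp [← h0]
  · rw [hXY i h0]

/-- The matrix weighing the `i`-th block in the first-order expansion of `h`. -/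
def blockWeight (A : ∀ (i : Fin p) (j : Fin q), Matrix (Fin (m j)) (Fin (n i)) ℝ)
    (α : Fin q → ℝ) (i : Fin p) : Matrix (Fin (n i)) (Fin (n i)) ℝ :=
  ∑ j, α j • ((A i j)ᵀ * A i j)

lemma posSemidef_blockWeight (hα : ∀ j, 0 ≤ α j) (i : Fin p) :
    (blockWeight A α i).PosSemidef := by
  refine posSemidef_sum _ fun j _ => PosSemidef.smul ?_ (hα j)
  have := posSemidef_conjTranspose_mul_self (A i j)
  rwa [conjTranspose_eq_transpose_of_trivial] at this

lemma trace_blockWeight_mul (i : Fin p) (X : Matrix (Fin (n i)) (Fin (n i)) ℝ) :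
    (blockWeight A α i * X).trace = ∑ j, α j * (A i j * X * (A i j)ᵀ).trace := by
  rw [blockWeight, Finset.sum_mul, trace_sum]
  refine Finset.sum_congr rfl fun j _ => ?_
  rw [Matrix.smul_mul, trace_smul, smul_eq_mul, trace_mul_comm (A i j * X), Matrix.mul_assoc]

/-- The cost of the blocks without barrier term. -/
lemma sum_trace_le_sub_zeroFree (hC : ∀ i, (C i).PosSemidef) (hα : ∀ j, 0 ≤ α j)
    (hβ : ∀ i, 0 ≤ β i) {τ : ℝ} (hρ : 0 < ρ) (hτ0 : 0 < τ) {X : SymTuple n}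
    (hτ : ∀ j, (τ • (1 : Matrix (Fin (m j)) (Fin (m j)) ℝ) - gramMat A ρ j X).PosSemidef)
    (hX : X ∈ feasible C) (hXg : X ∈ dom (g β)) :
    ∑ i, (if 0 < β i then 0 else (blockWeight A α i * block X i).trace) ≤
      τ * (((g β X).toReal - (h A α ρ X).toReal) -
        ((g β (zeroFree β X)).toReal - (h A α ρ (zeroFree β X)).toReal)) := by
  have hZ := zeroFree_mem_feasible (β := β) hC hX
  have hgeq : (g β X).toReal = (g β (zeroFree β X)).toReal :=
    toReal_g_congr hβ (fun i hi => by rw [block_zeroFree, if_pos hi]) hXg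
  rw [← hgeq, toReal_h hα (feasible_subset_dom_h hα hρ hX),
    toReal_h hα (feasible_subset_dom_h hα hρ hZ)]
  have hj : ∀ j, (gramLin A j (X - zeroFree β X)).trace ≤
      τ * (Real.log (gramMat A ρ j X).det - Real.log (gramMat A ρ j (zeroFree β X)).det) := by
    intro j
    have hM := posDef_gramMat (A := A) hρ (fun i => (hX i).1) j
    -- The tangent is taken at X, so removing the free blocks H lowers log det by at least tr(M⁻¹H),
    -- which is at least tr(H)/τ.
    have h1 := log_det_le_add_trace hM (posDef_gramMat (A := A) hρ (fun i => (hZ i).1) j)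
    have hH : (gramLin A j (X - zeroFree β X)).PosSemidef := posSemidef_gramLin (fun i => by
      rw [block_sub, block_zeroFree]
      split_ifs
      · rw [sub_self]; exact PosSemidef.zero
      · rw [sub_zero]; exact (hX i).1) j
    have h2 := trace_le_smul_trace_inv_mul hM (hτ j) hH
    have h3 : gramMat A ρ j (zeroFree β X) - gramMat A ρ j X =
        -gramLin A j (X - zeroFree β X) := by
      rw [gramLin_sub, gramMat, gramMat]
      abel
    rw [h3, Matrix.mul_neg, trace_neg] at h1
    refine h2.trans (mul_le_mul_of_nonneg_left ?_ hτ0.le)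
    linarith
  have hsum : ∑ i, (if 0 < β i then 0 else (blockWeight A α i * block X i).trace) =
      ∑ j, α j * (gramLin A j (X - zeroFree β X)).trace := by
    have : ∀ i, (if 0 < β i then 0 else (blockWeight A α i * block X i).trace) =
        ∑ j, α j * (A i j * block (X - zeroFree β X) i * (A i j)ᵀ).trace := by
      intro i
      rw [block_sub, block_zeroFree]
      split_ifs
      · simp
      · rw [trace_blockWeight_mul, sub_zero]
    rw [Finset.sum_congr rfl fun i _ => this i, Finset.sum_comm]
    refine Finset.sum_congr rfl fun j _ => ?_
    rw [gramLin, trace_sum, Finset.mul_sum]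
  rw [hsum]
  calc ∑ j, α j * (gramLin A j (X - zeroFree β X)).trace
      ≤ ∑ j, α j * (τ * (Real.log (gramMat A ρ j X).det -
          Real.log (gramMat A ρ j (zeroFree β X)).det)) :=
        Finset.sum_le_sum fun j _ => mul_le_mul_of_nonneg_left (hj j) (hα j)
    _ = τ * (∑ j, α j * Real.log (gramMat A ρ j X).det -
          ∑ j, α j * Real.log (gramMat A ρ j (zeroFree β X)).det) := by
        rw [← Finset.sum_sub_distrib, Finset.mul_sum]
        exact Finset.sum_congr rfl fun j _ => by ring
    _ = _ := by ring

/-- There is a minimizer whose blocks without barrier term vanish. -/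
lemma exists_minimizer_zero (hC : ∀ i, (C i).PosSemidef) (hα : ∀ j, 0 ≤ α j)
    (hβ : ∀ i, 0 ≤ β i) (hρ : 0 < ρ) (hr : IsRegular (g β) (h A α ρ) (feasible C)) :
    ∃ Xs ∈ minimizers (g β) (h A α ρ) (feasible C), ∀ i, ¬0 < β i → block Xs i = 0 := by
  obtain ⟨X, hX⟩ := hr.exists_mem_minimizers
  obtain ⟨hXC, hXg, hmin⟩ := hr.mem_minimizers_iff.1 hX
  obtain ⟨τ, hτ0, -, hτ⟩ := exists_gram_bound (A := A) hC ρ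
  have h1 := sum_trace_le_sub_zeroFree hC hα hβ hρ hτ0 (hτ X hXC) hXC hXg
  have h2 : 0 ≤ ∑ i, (if 0 < β i then 0 else (blockWeight A α i * block X i).trace) := by
    refine Finset.sum_nonneg fun i _ => ?_
    split_ifs
    · exact le_rfl
    · exact trace_mul_nonneg (posSemidef_blockWeight hα i) (hXC i).1
  -- Deleting the free blocks of any minimizer does not increase the objective.
  have h3 := nonneg_of_mul_nonneg_right (h2.trans h1) hτ0
  refine ⟨zeroFree β X, hr.mem_minimizers_iff.2 ⟨zeroFree_mem_feasible hC hXC,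
    mem_dom_g_congr hβ (fun i hi => by rw [block_zeroFree, if_pos hi]) hXg,
    fun z hz hzg => ?_⟩, fun i hi => by rw [block_zeroFree, if_neg hi]⟩
  have := hmin z hz hzg
  linarith

end BrascampLieb

end

/-! ### Quadratic growth, the PL inequality, uniqueness -/

noncomputable section

namespace BrascampLieb

open Matrix LogDet DCProgram Set

variable {p q : ℕ} {n : Fin p → ℕ} {m : Fin q → ℕ}
  {A : ∀ (i : Fin p) (j : Fin q), Matrix (Fin (m j)) (Fin (n i)) ℝ}
  {α : Fin q → ℝ} {β : Fin p → ℝ} {ρ : ℝ} {C : ∀ i : Fin p, Matrix (Fin (n i)) (Fin (n i)) ℝ}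

namespace IsFrame

variable {X Y : SymTuple n} {L : ∀ i, Matrix (Fin (n i)) (Fin (n i)) ℝ}
  {x : (Σ i, Fin (n i)) → ℝ}

lemma trace_free_nonneg (hF : IsFrame β X Y L x) (hρ : 0 < ρ) (j : Fin q) :
    0 ≤ ((gramMat A ρ j X)⁻¹ *
      (flat A L j * diagonal (freeWeight n β) * (flat A L j)ᵀ)).trace := by
  rw [hF.gramMat_left]
  refine trace_inv_gram_mul_nonneg hρ fun l => ?_
  unfold freeWeight
  split_ifs <;> norm_num

lemma le_gain (hF : IsFrame β X Y L x) (hα : ∀ j, 0 ≤ α j) (hρ : 0 < ρ) (s : ℝ) :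
    s * ∑ i, β i * ∑ l, (x ⟨i, l⟩ - 1) ^ 2 ≤ gain A α β ρ s X L x :=
  le_add_of_nonneg_right
    (Finset.sum_nonneg fun j _ => mul_nonneg (hα j) (hF.trace_free_nonneg hρ j))

lemma gain_nonneg (hF : IsFrame β X Y L x) (hα : ∀ j, 0 ≤ α j) (hβ : ∀ i, 0 ≤ β i)
    (hρ : 0 < ρ) {s : ℝ} (hs : 0 ≤ s) : 0 ≤ gain A α β ρ s X L x := by
  refine le_trans (mul_nonneg hs (Finset.sum_nonneg fun i _ => mul_nonneg (hβ i) ?_))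
    (hF.le_gain hα hρ s)
  exact Finset.sum_nonneg fun l _ => sq_nonneg _

lemma frobSq_sub_le (hF : IsFrame β X Y L x) (hX : X ∈ feasible C) (i : Fin p) :
    frobSq (block Y i - block X i) ≤ (C i).trace ^ 2 * ∑ l, (x ⟨i, l⟩ - 1) ^ 2 := by
  have h1 : block Y i - block X i = L i * diagonal (fun l => x ⟨i, l⟩ - 1) * (L i)ᵀ := by
    rw [← diagonal_sub, diagonal_one, Matrix.mul_sub, Matrix.sub_mul, Matrix.mul_one, hF.right,
      hF.left]
  rw [h1]
  refine (frobSq_mul_diagonal_mul_le _ _).trans ?_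
  rw [← hF.left]
  refine mul_le_mul_of_nonneg_right ?_ (Finset.sum_nonneg fun l _ => sq_nonneg _)
  exact pow_le_pow_left₀ (hX i).1.trace_nonneg (trace_le_of_sub_posSemidef (hX i).2) 2

end IsFrame

/-- Since ρ/τ ≤ 1, this s also meets the smallness condition under which the direction stays below Y
− X. -/
lemma gain_weight_le {τ b s : ℝ} (hρτ : ρ ≤ τ) (hτ0 : 0 < τ) (hb : 1 ≤ b)
    (hs : s = ρ / τ / (8 * b ^ 2)) : s ≤ 1 / (4 * b ^ 2) := by
  have h1 : ρ / τ ≤ 1 := (div_le_one hτ0).2 hρτ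
  have hb0 : 0 < b := by linarith
  rw [hs, div_le_div_iff₀ (by positivity) (by positivity)]
  nlinarith [mul_le_mul_of_nonneg_right h1 (sq_nonneg b), sq_nonneg b]

lemma one_le_free_rate {τ R : ℝ} (hρ : 0 < ρ) (hρτ : ρ ≤ τ) (hR : R = 2 - Real.log (ρ / τ)) :
    1 ≤ R := by
  have h1 := Real.log_nonpos (div_nonneg hρ.le (hρ.le.trans hρτ))
    ((div_le_one (hρ.trans_le hρτ)).2 hρτ)
  linarith

/-- Quadratic growth of the objective in the barrier blocks. -/
lemma exists_growth_barrier (hC : ∀ i, (C i).PosSemidef) (hα : ∀ j, 0 ≤ α j)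
    (hβ : ∀ i, 0 ≤ β i) (hρ : 0 < ρ) (hr : IsRegular (g β) (h A α ρ) (feasible C))
    {Xs : SymTuple n} (hXs : Xs ∈ minimizers (g β) (h A α ρ) (feasible C)) :
    ∃ κ : ℝ, 0 ≤ κ ∧ ∀ Y ∈ feasible C, Y ∈ dom (g β) → (∀ i, ¬0 < β i → block Y i = 0) →
      ∑ i, (if 0 < β i then frobSq (block Y i - block Xs i) else 0) ≤
        κ * (((g β Y).toReal - (h A α ρ Y).toReal) -
          ((g β Xs).toReal - (h A α ρ Xs).toReal)) := by
  obtain ⟨hXC, hXg, hmin⟩ := hr.mem_minimizers_iff.1 hXs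
  obtain ⟨τ, hτ0, hρτ, hτ⟩ := exists_gram_bound (A := A) hC ρ
  obtain ⟨b, hb, hbX⟩ := exists_block_bound hr hβ hC (g β Xs).toReal
  obtain ⟨s, hs⟩ : ∃ s, s = ρ / τ / (8 * b ^ 2) := ⟨_, rfl⟩
  obtain ⟨R, hR⟩ : ∃ R, R = 2 - Real.log (ρ / τ) := ⟨_, rfl⟩
  have hb0 : 0 < b := by linarith
  have hs0 : 0 < s := by rw [hs]; positivity
  -- Terms with β_i = 0 vanish because division by zero gives 0; they are never needed.
  set κ : ℝ := ∑ i, (C i).trace ^ 2 / (s * β i) with hκ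
  have hκi : ∀ i, 0 ≤ (C i).trace ^ 2 / (s * β i) := fun i => by
    have := hβ i
    positivity
  have hκ0 : 0 ≤ κ := Finset.sum_nonneg fun i _ => hκi i
  refine ⟨κ, hκ0, fun Y hY hYg hY0 => ?_⟩
  obtain ⟨L, x, hF⟩ := exists_isFrame (fun i => (hXC i).1) ((mem_dom_g hβ).1 hXg)
    ((mem_dom_g hβ).1 hYg) hY0
  have hxb := hF.le_of_smul_sub hY hb0.le (hbX Xs hXC hXg le_rfl)
  have h1 := hF.inner_add_gain_le hα hβ hρ hτ0 (hτ Xs hXC) hb hs hR hxb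
  obtain ⟨t, ht, hmem⟩ := hF.exists_add_smul_mem hXC hY
    (hF.dirWeight_le hb (gain_weight_le hρτ hτ0 hb hs) (one_le_free_rate hρ hρτ hR) hxb)
  -- The slope at a minimizer along the feasible direction is nonnegative, so the gain alone is at
  -- most f(Y) − f⋆.
  have h2 := hr.inner_grad_nonneg hXs ht hmem
  have h3 := hF.le_gain (A := A) hα hρ s
  refine le_trans ?_ (mul_le_mul_of_nonneg_left (h3.trans (by linarith)) hκ0)
  rw [Finset.mul_sum, Finset.mul_sum]
  refine Finset.sum_le_sum fun i _ => ?_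
  have hD : 0 ≤ ∑ l, (x ⟨i, l⟩ - 1) ^ 2 := Finset.sum_nonneg fun l _ => sq_nonneg _
  have hsβ := mul_nonneg hs0.le (mul_nonneg (hβ i) hD)
  split_ifs with hi
  · refine (hF.frobSq_sub_le hXC i).trans ?_
    have h4 := Finset.single_le_sum (fun i _ => hκi i) (Finset.mem_univ i)
    refine le_trans (le_of_eq ?_) (mul_le_mul_of_nonneg_right h4 hsβ)
    field_simp
  · exact mul_nonneg hκ0 hsβ

/-- Quadratic growth of the objective away from the set of minimizers. -/
lemma exists_growth (hC : ∀ i, (C i).PosSemidef) (hα : ∀ j, 0 ≤ α j)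
    (hβ : ∀ i, 0 ≤ β i) (hρ : 0 < ρ) (hr : IsRegular (g β) (h A α ρ) (feasible C))
    {Xs : SymTuple n} (hXs : Xs ∈ minimizers (g β) (h A α ρ) (feasible C))
    (hXs0 : ∀ i, ¬0 < β i → block Xs i = 0) :
    ∃ κ : ℝ, 0 ≤ κ ∧ ∀ X ∈ feasible C, X ∈ dom (g β) →
      Metric.infDist X (minimizers (g β) (h A α ρ) (feasible C)) ^ 2 ≤
        κ * (((g β X).toReal - (h A α ρ X).toReal) -
          ((g β Xs).toReal - (h A α ρ Xs).toReal)) := by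
  obtain ⟨hXC, hXg, hmin⟩ := hr.mem_minimizers_iff.1 hXs
  obtain ⟨τ, hτ0, hρτ, hτ⟩ := exists_gram_bound (A := A) hC ρ
  obtain ⟨κ, hκ0, hκ⟩ := exists_growth_barrier hC hα hβ hρ hr hXs
  choose K hK0 hK using fun i => exists_error_bound (hC i) (posSemidef_blockWeight (A := A) hα i)
  have hKs : 0 ≤ ∑ i, K i := Finset.sum_nonneg fun i _ => hK0 i
  refine ⟨κ + (∑ i, K i) * τ, by positivity, fun X hX hXdom => ?_⟩
  choose Z hZ0 hZC hZQ hZX using fun i => hK i (block X i) (hX i).1 (hX i).2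
  -- A minimizer close to X: barrier blocks from Xs, free blocks from the face tr(QZ) = 0. On that
  -- face every A Z Aᵀ with α_j > 0 vanishes, so h takes the same value as at Xs.
  set W : SymTuple n := ofBlocks (fun i => if 0 < β i then block Xs i else Z i) fun i => by
    split_ifs
    · exact isHermitian_block Xs i
    · exact (hZ0 i).1 with hW
  have hWb : ∀ i, block W i = if 0 < β i then block Xs i else Z i := fun i => rfl
  have hWC : W ∈ feasible C := fun i => by
    rw [hWb]
    split_ifs
    · exact hXC i
    · exact ⟨hZ0 i, hZC i⟩
  have hgW := toReal_g_congr (Y := W) hβ (fun i hi => by rw [hWb, if_pos hi]) hXg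
  have hhW : (h A α ρ W).toReal = (h A α ρ Xs).toReal := by
    rw [toReal_h hα (hr.subset_dom hWC), toReal_h hα (hr.subset_dom hXC)]
    congr 1
    refine Finset.sum_congr rfl fun j _ => ?_
    rcases (hα j).eq_or_lt with h0 | h0
    · simp [← h0]
    · have : gramMat A ρ j W = gramMat A ρ j Xs := by
        rw [gramMat, gramMat, gramLin, gramLin]
        congr 1
        refine Finset.sum_congr rfl fun i _ => ?_
        rw [hWb]
        split_ifs with hi
        · rfl
        · rw [hXs0 i hi, Matrix.mul_zero, Matrix.zero_mul]
          have h1 := hZQ i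
          have hps := fun j => posSemidef_mul_mul_transpose (hZ0 i) (A i j)
          rw [trace_blockWeight_mul, Finset.sum_eq_zero_iff_of_nonneg
            fun j _ => mul_nonneg (hα j) (hps j).trace_nonneg] at h1
          exact (hps j).trace_eq_zero_iff.1
            ((mul_eq_zero.1 (h1 j (Finset.mem_univ j))).resolve_left h0.ne')
      rw [this]
  have hWmin : W ∈ minimizers (g β) (h A α ρ) (feasible C) :=
    hr.mem_minimizers_iff.2 ⟨hWC, mem_dom_g_congr hβ (fun i hi => by rw [hWb, if_pos hi]) hXg,
      fun z hz hzg => by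
        rw [← hgW, hhW]
        exact hmin z hz hzg⟩
  have hX'C := zeroFree_mem_feasible (β := β) hC hX
  have hX'g : zeroFree β X ∈ dom (g β) :=
    mem_dom_g_congr hβ (fun i hi => by rw [block_zeroFree, if_pos hi]) hXdom
  have h1 := hκ _ hX'C hX'g fun i hi => by rw [block_zeroFree, if_neg hi]
  have h2 := sum_trace_le_sub_zeroFree hC hα hβ hρ hτ0 (hτ X hX) hX hXdom
  have h3 : 0 ≤ ∑ i, (if 0 < β i then 0 else (blockWeight A α i * block X i).trace) := by
    refine Finset.sum_nonneg fun i _ => ?_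
    split_ifs
    · exact le_rfl
    · exact trace_mul_nonneg (posSemidef_blockWeight hα i) (hX i).1
  have h4 := hmin _ hX'C hX'g
  have h5 := nonneg_of_mul_nonneg_right (h3.trans h2) hτ0
  have hdist : Metric.infDist X (minimizers (g β) (h A α ρ) (feasible C)) ^ 2 ≤
      ∑ i, frobSq (block X i - block W i) := by
    have h6 : Metric.infDist X (minimizers (g β) (h A α ρ) (feasible C)) ≤ ‖X - W‖ := by
      rw [← dist_eq_norm]
      exact Metric.infDist_le_dist_of_mem hWmin
    have h7 := pow_le_pow_left₀ Metric.infDist_nonneg h6 2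
    rw [norm_sq_eq] at h7
    simpa only [block_sub] using h7
  refine hdist.trans ?_
  have hsplit : ∑ i, frobSq (block X i - block W i) ≤
      ∑ i, (if 0 < β i then frobSq (block (zeroFree β X) i - block Xs i) else 0) +
      (∑ i, K i) * ∑ i, (if 0 < β i then 0 else (blockWeight A α i * block X i).trace) := by
    rw [Finset.mul_sum, ← Finset.sum_add_distrib]
    refine Finset.sum_le_sum fun i _ => ?_
    rw [hWb, block_zeroFree]
    split_ifs with hi
    · simp
    · rw [zero_add]
      exact (hZX i).trans (mul_le_mul_of_nonneg_right
        (Finset.single_le_sum (fun i _ => hK0 i) (Finset.mem_univ i))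
        (trace_mul_nonneg (posSemidef_blockWeight hα i) (hX i).1))
  have h8 := mul_le_mul_of_nonneg_left h2 hKs
  have h9 : 0 ≤ (∑ i, K i) * τ := by positivity
  -- The gap splits as [f(X) − f(X')] + [f(X') − f⋆] with X' = `zeroFree β X`. Both parts are
  -- nonnegative; the first controls the free blocks, the second the barrier blocks.
  nlinarith [mul_nonneg hκ0 h5, mul_nonneg h9 (sub_nonneg.2 h4)]

/-- The second-order error of the step is controlled by the first-order gain. -/
lemma IsFrame.quad_le_gain {X Y : SymTuple n}
    {L : ∀ i, Matrix (Fin (n i)) (Fin (n i)) ℝ} {x : (Σ i, Fin (n i)) → ℝ}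
    (hF : IsFrame β X Y L x) (hα : ∀ j, 0 ≤ α j) (hβ : ∀ i, 0 ≤ β i) (hρ : 0 < ρ) {a s : ℝ}
    (ha0 : 0 < a) (hs0 : 0 < s) (R : ℝ) :
    ∑ j, α j * (m j * ∑ l : Σ i, Fin (n i),
          (1 + 1 / a) ^ 2 * ((1 - freeWeight n β l) * (x l - 1) ^ 2) +
        R ^ 2 * ((gramMat A ρ j X)⁻¹ *
          (flat A L j * diagonal (freeWeight n β) * (flat A L j)ᵀ)).trace) ≤
      ((∑ j, α j * m j) * (1 + 1 / a) ^ 2 * (∑ i, 1 / (s * β i)) + R ^ 2) *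
        gain A α β ρ s X L x := by
  -- For β_i = 0 the term is 0 by the division convention; those blocks drop out through 1 −
  -- `freeWeight`.
  set c : ℝ := ∑ i, 1 / (s * β i) with hc
  have hci : ∀ i, 0 ≤ 1 / (s * β i) := fun i => by
    have := hβ i
    positivity
  have hc0 : 0 ≤ c := Finset.sum_nonneg fun i _ => hci i
  set M : ℝ := ∑ j, α j * m j with hM
  have hM0 : 0 ≤ M := Finset.sum_nonneg fun j _ => mul_nonneg (hα j) (Nat.cast_nonneg _)
  have hsum : ∑ l : Σ i, Fin (n i), (1 + 1 / a) ^ 2 * ((1 - freeWeight n β l) * (x l - 1) ^ 2) ≤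
      (1 + 1 / a) ^ 2 * (c * (s * ∑ i, β i * ∑ l, (x ⟨i, l⟩ - 1) ^ 2)) := by
    rw [← Finset.mul_sum, Fintype.sum_sigma]
    refine mul_le_mul_of_nonneg_left ?_ (by positivity)
    rw [Finset.mul_sum, Finset.mul_sum]
    refine Finset.sum_le_sum fun i _ => ?_
    have hD : 0 ≤ ∑ l, (x ⟨i, l⟩ - 1) ^ 2 := Finset.sum_nonneg fun l _ => sq_nonneg _
    have hsβ := mul_nonneg hs0.le (mul_nonneg (hβ i) hD)
    have hw : ∀ l : Fin (n i), freeWeight n β ⟨i, l⟩ = if 0 < β i then 0 else 1 := fun l => rfl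
    simp only [hw]
    rw [← Finset.mul_sum]
    split_ifs with hi
    · rw [sub_zero, one_mul]
      refine le_trans (le_of_eq ?_) (mul_le_mul_of_nonneg_right
        (Finset.single_le_sum (fun i _ => hci i) (Finset.mem_univ i)) hsβ)
      field_simp
    · rw [sub_self, zero_mul]
      exact mul_nonneg hc0 hsβ
  set g₁ : ℝ := s * ∑ i, β i * ∑ l, (x ⟨i, l⟩ - 1) ^ 2 with hg₁
  set T : Fin q → ℝ := fun j => ((gramMat A ρ j X)⁻¹ *
        (flat A L j * diagonal (freeWeight n β) * (flat A L j)ᵀ)).trace with hT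
  have hgain : gain A α β ρ s X L x = g₁ + ∑ j, α j * T j := rfl
  have hT0 : 0 ≤ ∑ j, α j * T j :=
    Finset.sum_nonneg fun j _ => mul_nonneg (hα j) (hF.trace_free_nonneg hρ j)
  have hg₁0 : 0 ≤ g₁ := mul_nonneg hs0.le (Finset.sum_nonneg fun i _ => mul_nonneg (hβ i)
    (Finset.sum_nonneg fun l _ => sq_nonneg _))
  have h1 : ∀ j, α j * (m j * ∑ l : Σ i, Fin (n i),
        (1 + 1 / a) ^ 2 * ((1 - freeWeight n β l) * (x l - 1) ^ 2) + R ^ 2 * T j) ≤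
      α j * m j * ((1 + 1 / a) ^ 2 * (c * g₁)) + R ^ 2 * (α j * T j) := by
    intro j
    have := mul_le_mul_of_nonneg_left hsum (mul_nonneg (hα j) (Nat.cast_nonneg (m j)))
    linarith
  refine (Finset.sum_le_sum fun j _ => h1 j).trans ?_
  rw [Finset.sum_add_distrib, ← Finset.sum_mul, ← Finset.mul_sum, ← hM, hgain]
  have h2 : 0 ≤ M * (1 + 1 / a) ^ 2 * c := by positivity
  nlinarith [mul_nonneg h2 hT0, mul_nonneg (sq_nonneg R) hg₁0]

/-- The Polyak–Łojasiewicz inequality on sublevel sets of `g`. -/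
lemma exists_dcpl_near (hC : ∀ i, (C i).PosSemidef) (hα : ∀ j, 0 ≤ α j)
    (hβ : ∀ i, 0 ≤ β i) (hρ : 0 < ρ) (hr : IsRegular (g β) (h A α ρ) (feasible C))
    {Xs : SymTuple n} (hXs : Xs ∈ minimizers (g β) (h A α ρ) (feasible C))
    (hXs0 : ∀ i, ¬0 < β i → block Xs i = 0) (G : ℝ) :
    ∃ μ : ℝ, 0 < μ ∧ ∀ X ∈ feasible C, X ∈ dom (g β) → (g β X).toReal ≤ G →
      ∀ y ∈ normalCone (feasible C) X, ∃ Z ∈ dom (h A α ρ),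
        μ * (((g β X).toReal - (h A α ρ X).toReal) -
          ((g β Xs).toReal - (h A α ρ Xs).toReal)) ≤
          inner ℝ (grad (g β) X + y) (Z - X) - (h A α ρ Z).toReal + (h A α ρ X).toReal := by
  obtain ⟨hXC, hXg, hmin⟩ := hr.mem_minimizers_iff.1 hXs
  obtain ⟨τ, hτ0, hρτ, hτ⟩ := exists_gram_bound (A := A) hC ρ
  -- The maximum makes b valid at both X and Xs, so the weights lie in [1/b, b] on barrier blocks.
  obtain ⟨b, hb, hbX⟩ := exists_block_bound hr hβ hC (max G (g β Xs).toReal)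
  obtain ⟨s, hs⟩ : ∃ s, s = ρ / τ / (8 * b ^ 2) := ⟨_, rfl⟩
  obtain ⟨R, hR⟩ : ∃ R, R = 2 - Real.log (ρ / τ) := ⟨_, rfl⟩
  have hb0 : 0 < b := by linarith
  have hs0 : 0 < s := by rw [hs]; positivity
  have hs1 := gain_weight_le hρτ hτ0 hb hs
  have hR1 := one_le_free_rate hρ hρτ hR
  set a : ℝ := 1 / b with ha
  have ha0 : 0 < a := by positivity
  set Θ : ℝ := (1 + 1 / a) * (b + 1) + R with hΘ
  have hΘ0 : 0 < Θ := by positivity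
  set c : ℝ := ∑ i, 1 / (s * β i) with hc
  have hci : ∀ i, 0 ≤ 1 / (s * β i) := fun i => by
    have := hβ i
    positivity
  have hc0 : 0 ≤ c := Finset.sum_nonneg fun i _ => hci i
  set M : ℝ := ∑ j, α j * m j with hM
  have hM0 : 0 ≤ M := Finset.sum_nonneg fun j _ => mul_nonneg (hα j) (Nat.cast_nonneg _)
  set κ : ℝ := 2 * (M * (1 + 1 / a) ^ 2 * c + R ^ 2) with hκ
  have hκ0 : 0 < κ := by positivity
  -- The first bound keeps tσ within 1/2 for the second-order estimate; the second makes the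
  -- quadratic error at most t times the gain.
  set t : ℝ := min (1 / (2 * Θ)) (1 / κ) with ht
  have ht0 : 0 < t := lt_min (by positivity) (by positivity)
  have htΘ : t * Θ ≤ 1 / 2 := by
    have := mul_le_mul_of_nonneg_right (min_le_left (1 / (2 * Θ)) (1 / κ)) hΘ0.le
    rw [← ht] at this
    refine this.trans (le_of_eq ?_)
    field_simp
  have htκ : t * κ ≤ 1 := by
    have := mul_le_mul_of_nonneg_right (min_le_right (1 / (2 * Θ)) (1 / κ)) hκ0.le
    rw [← ht] at this
    refine this.trans (le_of_eq ?_)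
    field_simp
  refine ⟨t, ht0, fun X hX hXdom hG y hy => ?_⟩
  obtain ⟨L, x, hF⟩ := exists_isFrame (fun i => (hX i).1) ((mem_dom_g hβ).1 hXdom)
    ((mem_dom_g hβ).1 hXg) hXs0
  have hxb := hF.le_of_smul_sub hXC hb0.le (hbX X hX hXdom (hG.trans (le_max_left _ _)))
  have hxa : ∀ l : Σ i, Fin (n i), 0 < β l.1 → a ≤ x l := fun l hl => by
    have := hF.one_le_mul_of_smul_sub hX (hbX Xs hXC hXg (le_max_right _ _)) l hl
    rw [ha, div_le_iff₀ hb0]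
    linarith
  have hσ : ∀ l, |dirWeight β s R x l| ≤ Θ := by
    intro l
    have hpos : 0 ≤ (1 + 1 / a) * (b + 1) := by positivity
    unfold dirWeight
    split_ifs with hl
    · have h1 := sq_log_add_sq_le ha0 (hxa l hl) (hxb l) hb hs0.le hs1
      rw [← mul_pow] at h1
      have h2 := sq_le_sq.1 h1
      refine h2.trans ?_
      rw [abs_mul, abs_of_pos (show 0 < 1 + 1 / a by positivity)]
      have h3 : |x l - 1| ≤ b + 1 := by
        rw [abs_le]
        constructor <;> linarith [hxb l, hF.nonneg l]
      have h4 := mul_le_mul_of_nonneg_left h3 (show 0 ≤ 1 + 1 / a by positivity)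
      linarith
    · rw [abs_neg, abs_of_nonneg (by linarith)]
      linarith
  obtain ⟨hZ, hle⟩ := hF.h_sub_le (A := A) hα hρ hb hs0.le hs1 ha0 hxa hxb hΘ0.le hσ ht0.le htΘ
  refine ⟨_, hZ, ?_⟩
  obtain ⟨t', ht', hmem⟩ := hF.exists_add_smul_mem hX hXC (hF.dirWeight_le hb hs1 hR1 hxb)
  have htest := DCProgram.IsRegular.le_test_of_feasible (g := g β) (h := h A α ρ)
    (C := feasible C) (a := (h A α ρ (X - t • ofWeights L (dirWeight β s R x))).toReal)
    (b := (h A α ρ X).toReal) hy ht' hmem ht0.le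
  refine le_trans ?_ htest
  have hcore := hF.inner_add_gain_le hα hβ hρ hτ0 (hτ X hX) hb hs hR hxb
  have hgain0 := hF.gain_nonneg (A := A) hα hβ hρ hs0.le
  have hquad := hF.quad_le_gain (A := A) (α := α) hα hβ hρ ha0 hs0 R
  rw [← hM, ← hc] at hquad
  have hq2 := mul_le_mul_of_nonneg_left hquad (by positivity : 0 ≤ 2 * t ^ 2)
  have hq3 : 2 * t ^ 2 * ((M * (1 + 1 / a) ^ 2 * c + R ^ 2) * gain A α β ρ s X L x) =
      t * (t * κ) * gain A α β ρ s X L x := by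
    rw [hκ]
    ring
  have hq4 : t * (t * κ) * gain A α β ρ s X L x ≤ t * gain A α β ρ s X L x :=
    mul_le_mul_of_nonneg_right (mul_le_of_le_one_right ht0.le htκ) hgain0
  have hc1 := mul_le_mul_of_nonneg_left hcore ht0.le
  nlinarith

/-- The Polyak–Łojasiewicz inequality for the Brascamp–Lieb problem. -/
lemma exists_dcpl (hC : ∀ i, (C i).PosSemidef) (hα : ∀ j, 0 ≤ α j)
    (hβ : ∀ i, 0 ≤ β i) (hρ : 0 < ρ) (hr : IsRegular (g β) (h A α ρ) (feasible C)) (r : ℝ) :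
    ∃ μ : ℝ, 0 < μ ∧ DCPL (g β) (h A α ρ) (feasible C) μ r := by
  obtain ⟨Xs, hXs, hXs0⟩ := exists_minimizer_zero hC hα hβ hρ hr
  -- The direction for large g: identity on barrier blocks, zero elsewhere.
  set I : SymTuple n := ofBlocks (fun i => if 0 < β i then 1 else 0) fun i => by
    split_ifs
    · exact isHermitian_one
    · exact isHermitian_zero with hI
  have hIb : ∀ i, block I i = if 0 < β i then 1 else 0 := fun i => rfl
  choose τ hτ0 hτ using fun j : Fin q =>
    exists_smul_one_sub_posSemidef (isHermitian_gramLin A j I)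
  have hsum : 0 ≤ ∑ j, τ j := Finset.sum_nonneg fun j _ => (hτ0 j).le
  set T : ℝ := ∑ j, τ j + 1 with hT
  have hT0 : 0 < T := by positivity
  -- Moving back by tI costs the Gram matrices at most tT·I = (ρ/2)I, so they remain at least (ρ/2)I
  -- and the test point stays in dom h.
  set t : ℝ := ρ / (2 * T) with ht
  have ht0 : 0 < t := by positivity
  have htT : ρ - t * T = ρ / 2 := by
    rw [ht]
    field_simp
    ring
  refine hr.exists_dcpl hXs ht0 (v := I) (fun X hX => (mem_dom_h hα).2 fun j _ => ?_)
    (fun X hX hXg => ?_) (exists_dcpl_near hC hα hβ hρ hr hXs hXs0) r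
  · have h1 : τ j ≤ T := by
      have := Finset.single_le_sum (fun j _ => (hτ0 j).le) (Finset.mem_univ j)
      linarith
    have h2 := ((PosDef.one (n := Fin (m j)) (R := ℝ)).smul (half_pos hρ)).add_posSemidef
      ((posSemidef_gramLin (A := A) (fun i => (hX i).1) j).add ((hτ j T h1).smul ht0.le))
    convert! h2 using 1
    rw [gramMat, gramLin_sub, gramLin_smul, ← htT, sub_smul, smul_sub, smul_smul]
    abel
  · rw [toReal_g hβ hXg, inner_grad_g hβ hXg, neg_neg, ← Finset.sum_neg_distrib]
    refine Finset.sum_le_sum fun i _ => ?_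
    rcases (hβ i).eq_or_lt with h0 | h0
    · simp [← h0]
    · have hPD := (mem_dom_g hβ).1 hXg i h0
      -- The tangent inequality from X_i to the identity gives −log det X_i ≤ tr(X_i⁻¹) − n_i, so g
      -- is dominated by minus its slope along I.
      have h1 := log_det_le_add_trace hPD PosDef.one
      rw [det_one, Real.log_one, Matrix.mul_sub, trace_sub,
        nonsing_inv_mul _ ((isUnit_iff_isUnit_det _).1 hPD.isUnit), trace_one] at h1
      rw [hIb, if_pos h0, ← mul_neg]
      refine mul_le_mul_of_nonneg_left ?_ h0.le
      have h2 : (0 : ℝ) ≤ Fintype.card (Fin (n i)) := Nat.cast_nonneg _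
      linarith

lemma eq_of_block_eq {X Y : SymTuple n} (hXY : ∀ i, block X i = block Y i) : X = Y := by
  have h1 := norm_sq_eq (X - Y)
  simp only [block_sub, hXY, sub_self] at h1
  have h2 : ‖X - Y‖ ^ 2 = 0 := by
    rw [h1]
    simp [frobSq]
  exact sub_eq_zero.1 (norm_eq_zero.1 (pow_eq_zero_iff two_ne_zero |>.1 h2))

lemma eq_zero_of_frobSq_le_zero {k : ℕ} {X : Matrix (Fin k) (Fin k) ℝ} (hX : frobSq X ≤ 0) :
    X = 0 := by
  rw [frobSq_eq_trace, ← conjTranspose_eq_transpose_of_trivial] at hX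
  exact trace_mul_conjTranspose_self_eq_zero_iff.1
    (le_antisymm hX (posSemidef_self_mul_conjTranspose X).trace_nonneg)

lemma existsUnique_minimizer (hC : ∀ i, (C i).PosSemidef) (hα : ∀ j, 0 ≤ α j)
    (hβ : ∀ i, 0 < β i) (hρ : 0 < ρ) (hr : IsRegular (g β) (h A α ρ) (feasible C)) :
    ∃! Xs : SymTuple n, Xs ∈ minimizers (g β) (h A α ρ) (feasible C) := by
  obtain ⟨Xs, hXs⟩ := hr.exists_mem_minimizers
  refine ⟨Xs, hXs, fun Y hY => ?_⟩
  obtain ⟨κ, hκ0, hκ⟩ := exists_growth_barrier hC hα (fun i => (hβ i).le) hρ hr hXs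
  obtain ⟨hYC, hYg, hYmin⟩ := hr.mem_minimizers_iff.1 hY
  obtain ⟨hXC, hXg, hXmin⟩ := hr.mem_minimizers_iff.1 hXs
  have h1 := hκ Y hYC hYg fun i hi => absurd (hβ i) hi
  have h2 := mul_nonneg hκ0 (sub_nonneg.2 (hXmin Y hYC hYg))
  have h3 := mul_nonneg hκ0 (sub_nonneg.2 (hYmin Xs hXC hXg))
  have h4 : ∑ i, (if 0 < β i then frobSq (block Y i - block Xs i) else 0) ≤ 0 := by nlinarith
  refine eq_of_block_eq fun i => ?_
  have h5 := Finset.single_le_sum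
    (f := fun i => if 0 < β i then frobSq (block Y i - block Xs i) else 0)
    (fun i _ => by
      split_ifs
      · exact frobSq_nonneg _
      · exact le_rfl) (Finset.mem_univ i)
  simp only [hβ, if_true] at h4 h5
  exact sub_eq_zero.1 (eq_zero_of_frobSq_le_zero (h5.trans h4))

end BrascampLieb

end

/-! ### The main theorem -/

theorem mainTheorem4 (p q : ℕ) (n : Fin p → ℕ) (m : Fin q → ℕ)
    (A : ∀ (i : Fin p) (j : Fin q), Matrix (Fin (m j)) (Fin (n i)) ℝ)
    (hA : ∀ i j, (A i j).rank = m j)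
    (C : ∀ i : Fin p, Matrix (Fin (n i)) (Fin (n i)) ℝ)
    (hC : ∀ i, (C i).PosSemidef)
    (α : Fin q → ℝ) (hα : ∀ j, 0 ≤ α j)
    (β : Fin p → ℝ) (hβ : ∀ i, 0 ≤ β i)
    (hCβ : ∀ i, 0 < β i → (C i).PosDef)
    (ρ : ℝ) (hρ : 0 < ρ) :
    (∀ r : ℝ, 0 < r → ∃ μ : ℝ, 0 < μ ∧
      DCProgram.StandingAssumption (BrascampLieb.g β) (BrascampLieb.h A α ρ)
        (BrascampLieb.feasible C) μ r ∧
      ∀ X : ℕ → BrascampLieb.SymTuple n,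
        DCProgram.IsDCASequence (BrascampLieb.g β) (BrascampLieb.h A α ρ)
          (BrascampLieb.feasible C) X →
        ∀ k : ℕ,
          DCProgram.objective (BrascampLieb.g β) (BrascampLieb.h A α ρ) (X (k + 1)) -
              DCProgram.optValue (BrascampLieb.g β) (BrascampLieb.h A α ρ)
                (BrascampLieb.feasible C) ≤
            ((1 / (1 + μ) : ℝ) : EReal) *
              (DCProgram.objective (BrascampLieb.g β) (BrascampLieb.h A α ρ) (X k) -
                DCProgram.optValue (BrascampLieb.g β) (BrascampLieb.h A α ρ)
                  (BrascampLieb.feasible C))) ∧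
    (∃ K c : ℝ, 0 < c ∧ c < 1 ∧
      ∀ X : ℕ → BrascampLieb.SymTuple n,
        DCProgram.IsDCASequence (BrascampLieb.g β) (BrascampLieb.h A α ρ)
          (BrascampLieb.feasible C) X →
        ∀ k : ℕ,
          Metric.infDist (X k)
            (DCProgram.minimizers (BrascampLieb.g β) (BrascampLieb.h A α ρ)
              (BrascampLieb.feasible C)) ≤ K * c ^ k) ∧
    ((∀ i, 0 < β i) →
      ∃! Xs : BrascampLieb.SymTuple n,
        Xs ∈ DCProgram.minimizers (BrascampLieb.g β) (BrascampLieb.h A α ρ)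
          (BrascampLieb.feasible C)) := by
  have hr := BrascampLieb.isRegular (A := A) hC hα hβ hCβ hρ
  have hd := BrascampLieb.exists_dcpl hC hα hβ hρ hr
  refine ⟨fun r _ => ?_, ?_, fun hβ' => BrascampLieb.existsUnique_minimizer hC hα hβ' hρ hr⟩
  · obtain ⟨R, hR⟩ := hr.exists_step_norm_bound
    -- The radius r is required by the standing assumption, R covers the normal vectors of all DCA
    -- steps; one μ serves both.
    obtain ⟨μ, hμ, hdcpl⟩ := hd (max r R)
    refine ⟨μ, hμ, hr.standingAssumption (BrascampLieb.feasible_subset_closure hβ)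
      (hdcpl.mono (le_max_left _ _)), fun X hX k => ?_⟩
    have hk := DCProgram.IsRegular.sequence_mem hX k
    exact hr.step_contract_ereal hμ hdcpl hk (hX.2 k)
      ((hR _ hk _ (hX.2 k)).trans (le_max_right _ _))
  · obtain ⟨Xs, hXs, hXs0⟩ := BrascampLieb.exists_minimizer_zero hC hα hβ hρ hr
    obtain ⟨κ, hκ, hgrowth⟩ := BrascampLieb.exists_growth hC hα hβ hρ hr hXs hXs0
    exact hr.exists_linear_rate hXs hd hκ hgrowth
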